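/- **Setting.** Let either (a) $k$ be a field of characteristic $0$, $X$ a locally Noetherian $k$-scheme and $\mathcal U=\{U_i\}_{i\in I}$ a cover of $X$ by affine open subsets; or (b) $k=\mathbb C$, $X$ a (finite-dimensional, Hausdorff, second countable) complex manifold and $\mathcal U=\{U_i\}_{i\in I}$ a cover of $X$ by Stein open subsets, where an open subset $U$ is called Stein if Cartan's Theorem B holds on it, i.e. the higher cohomology of every coherent $\mathcal O_U$-module vanishes (only $H^1(U,\mathcal F)=0$ for all coherent $\mathcal F$ is required). No projectivity is assumed. Write $U_{ij}=U_i\cap U_j$, and so on. **Twisted sheaves.** Let $\alpha=\{\alpha_{ijl}\in\mathcal O_X^*(U_{ijl})\}$ be a Čech 2-cocycle. An $(\alpha,\mathcal U)$-twisted sheaf $E=(\{E_i\},\{g_{ij}\})$ consists of sheaves $E_i$ of $\mathcal O_{U_i}$-modules and isomorphisms $g_{ij}\colon E_i|_{U_{ij}}\to E_j|_{U_{ij}}$ with $g_{ii}=\mathrm{id}$, $g_{ji}=g_{ij}^{-1}$, such that the composite $E_i\to E_j\to E_l\to E_i$ on $U_{ijl}$ satisfies $g_{li}\circ g_{jl}\circ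 g_{ij}=\alpha_{ijl}\,\mathrm{id}$. **Deformations.** Let $\mathsf{Art}_k$ be the category of local Artinian $k$-algebras $A$ with residue field $k$ and maximal ideal $\mathfrak m_A$. An $(\alpha,\mathcal U)$-deformation of $E$ over $A$ is a triple $(\{E_{i,A}\},\{h_i\},\{g_{ij,A}\})$ where $E_{i,A}$ is a coherent sheaf of $\mathcal O_{U_i}\otimes_k A$-modules, flat over $A$; $h_i\colon E_{i,A}\to E_i$ is a morphism of $\mathcal O_{U_i}\otimes_k A$-modules that induces an isomorphism $E_{i,A}\otimes_A k\cong E_i$; and $g_{ij,A}\colon E_{i,A}|_{U_{ij}}\to E_{j,A}|_{U_{ij}}$ are isomorphisms of $\mathcal O_{U_{ij}}\otimes_k A$-modules with $h_j\circ g_{ij,A}=g_{ij}\circ h_i$ and $g_{li,A}\circ g_{jl,A}\circ g_{ij,A}=(\alpha_{ijl}\otimes 1)\,\mathrm{id}$. An isomorphism of deformations is a family of isomorphisms $\varphi_i\colon E_{i,A}\to E_{i,A}'$ commuting with the $g$'s and the $h$'s. The functor $\mathrm{Def}_E^{(\alpha,\mathcal U)}\colon\mathsf{Art}_k\to\mathsf{Set}$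 sends $A$ to the set of isomorphism classes of deformations of $E$ over $A$, and $f\colon A\to B$ to the pullback $-\otimes_A B$. **The Čech semicosimplicial Lie algebra.** Let $\mathcal End(E)$ be the sheaf on $X$ obtained by gluing the sheaves $\mathcal End(E_i)$ through conjugation by the $g_{ij}$, and let $\mathfrak g^\Delta$ be its Čech semicosimplicial Lie algebra: $\mathfrak g_n=\prod_{i_0,\dots,i_n\in I}\mathcal End(E)(U_{i_0\cdots i_n})$ with the commutator bracket and $(\partial_j x)_{i_0\cdots i_n}=x_{i_0\cdots\widehat{i_j}\cdots i_n}|_{U_{i_0\cdots i_n}}$. For $A\in\mathsf{Art}_k$, let $Z^1_{sc}(\exp\mathfrak g^\Delta)(A)$ be the set of all $m\in\mathfrak g_1\otimes\mathfrak m_A$ with $e^{\partial_0 m}e^{-\partial_1 m}e^{\partial_2 m}=1$, and let $m\sim m'$ if there is $a\in\mathfrak g_0\otimes\mathfrak m_A$ with $e^{-\partial_1 a}e^{m}e^{\partial_0 a}=e^{m'}$; exponentials are taken in the associative algebras $\mathfrak g_n\otimes_k A$. Let $H^1_{sc}(\exp\mathfrak g^\Delta)\colon\mathsf{Art}_k\to\mathsf{Set}$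 be the functor $A\mapsto Z^1_{sc}(\exp\mathfrak g^\Delta)(A)/\!\sim$. **Theorem.** Let $E=(\{E_i\},\{g_{ij}\})$ be an $(\alpha,\mathcal U)$-twisted sheaf such that every $E_i$ is locally free of finite rank. Then there is an isomorphism of functors $\mathsf{Art}_k\to\mathsf{Set}$ $$\mathrm{Def}_E^{(\alpha,\mathcal U)}\;\cong\;H^1_{sc}(\exp\mathfrak g^\Delta).$$ -/

import Mathlib

open CategoryTheory TopologicalSpace Opposite AlgebraicGeometry
open scoped TensorProduct Manifold ContDiff

universe u

namespace TwistedDef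

noncomputable section

set_option linter.style.haveILetI false

section ScalarExtension

variable {A B C : Type u} [CommRing A] [CommRing B] [CommRing C]
variable {M N P : Type u} [AddCommGroup M] [AddCommGroup N] [AddCommGroup P]
variable [Module A M] [Module B N] [Module C P]

/-- A map `ℓ : M → N` that is semilinear over `f : A → B` exhibits the `B`-module `N` as the
extension of scalars `B ⊗_A M`: the induced map `B ⊗_A M → N`, `b ⊗ m ↦ b • ℓ m`, is bijective. -/
def IsExtension (f : A →+* B) (ℓ : M →+ N) (hℓ : ∀ a m, ℓ (a • m) = f a • ℓ m) : Prop :=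
  letI : Algebra A B := f.toAlgebra
  letI : Module A N := Module.compHom N f
  haveI : IsScalarTower A B N := ⟨fun a b n => mul_smul (f a) b n⟩
  IsBaseChange B ({ toFun := ℓ, map_add' := ℓ.map_add, map_smul' := hℓ } : M →ₗ[A] N)

theorem IsExtension.induct {f : A →+* B} {ℓ : M →+ N} {hℓ : ∀ a m, ℓ (a • m) = f a • ℓ m}
    (h : IsExtension f ℓ hℓ) (Q : N → Prop) (zero : Q 0) (gen : ∀ (b : B) (m : M), Q (b • ℓ m))
    (add : ∀ x y, Q x → Q y → Q (x + y)) (n : N) : Q n := by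
  letI : Algebra A B := f.toAlgebra
  letI : Module A N := Module.compHom N f
  haveI : IsScalarTower A B N := ⟨fun a b n => mul_smul (f a) b n⟩
  let ℓ₁ : M →ₗ[A] N := { toFun := ℓ, map_add' := ℓ.map_add, map_smul' := hℓ }
  have h₁ : IsBaseChange B ℓ₁ := h
  obtain ⟨t, rfl⟩ := h₁.equiv.surjective n
  induction t using TensorProduct.induction_on with
  | zero => simpa using zero
  | tmul b m => rw [IsBaseChange.equiv_tmul]; exact gen b m
  | add x y hx hy => rw [map_add]; exact add _ _ hx hy

theorem IsExtension.exists_lift {f : A →+* B} {ℓ : M →+ N}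
    {hℓ : ∀ a m, ℓ (a • m) = f a • ℓ m} (h : IsExtension f ℓ hℓ) (g : B →+* C) (ψ : M →+ P)
    (hψ : ∀ a m, ψ (a • m) = g (f a) • ψ m) :
    ∃ θ : N →+ P, (∀ b n, θ (b • n) = g b • θ n) ∧ ∀ m, θ (ℓ m) = ψ m := by
  letI : Algebra A B := f.toAlgebra
  letI : Module A N := Module.compHom N f
  haveI : IsScalarTower A B N := ⟨fun a b n => mul_smul (f a) b n⟩
  letI : Module B P := Module.compHom P g
  letI : Module A P := Module.compHom P (g.comp f)
  haveI : IsScalarTower A B P := ⟨fun a b n => by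
    change g (f a * b) • n = g (f a) • g b • n
    rw [map_mul, mul_smul]⟩
  let ψ' : M →ₗ[A] P := { toFun := ψ, map_add' := ψ.map_add, map_smul' := hψ }
  refine ⟨(IsBaseChange.lift h ψ').toAddMonoidHom, fun b n => ?_, fun m => ?_⟩
  · exact (IsBaseChange.lift h ψ').map_smul b n
  · exact IsBaseChange.lift_eq h ψ' m

theorem IsExtension.comp {f : A →+* B} {ℓ : M →+ N} {hℓ : ∀ a m, ℓ (a • m) = f a • ℓ m}
    (h : IsExtension f ℓ hℓ) {g : B →+* C} {ℓ' : N →+ P} {hℓ' : ∀ a m, ℓ' (a • m) = g a • ℓ' m}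
    (h' : IsExtension g ℓ' hℓ') {e : A →+* C} {ℓ'' : M →+ P}
    {hℓ'' : ∀ a m, ℓ'' (a • m) = e a • ℓ'' m} (he : ∀ a, e a = g (f a))
    (hc : ∀ m, ℓ'' m = ℓ' (ℓ m)) : IsExtension e ℓ'' hℓ'' := by
  obtain rfl : e = g.comp f := RingHom.ext he
  obtain rfl : ℓ'' = ℓ'.comp ℓ := AddMonoidHom.ext hc
  letI : Algebra A B := f.toAlgebra
  letI : Algebra B C := g.toAlgebra
  letI : Algebra A C := (g.comp f).toAlgebra
  letI : Module A N := Module.compHom N f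
  letI : Module B P := Module.compHom P g
  letI : Module A P := Module.compHom P (g.comp f)
  haveI : IsScalarTower A B N := ⟨fun a b n => mul_smul (f a) b n⟩
  haveI : IsScalarTower B C P := ⟨fun a b n => mul_smul (g a) b n⟩
  haveI : IsScalarTower A C P := ⟨fun a b n => mul_smul (g (f a)) b n⟩
  haveI : IsScalarTower A B C := ⟨fun a b c => by
    change g (f a * b) * c = g (f a) * (g b * c)
    rw [map_mul, mul_assoc]⟩
  haveI : IsScalarTower A B P := ⟨fun a b n => by
    change g (f a * b) • n = g (f a) • g b • n
    rw [map_mul, mul_smul]⟩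
  let ℓ₁ : M →ₗ[A] N := { toFun := ℓ, map_add' := ℓ.map_add, map_smul' := hℓ }
  let ℓ₂ : N →ₗ[B] P := { toFun := ℓ', map_add' := ℓ'.map_add, map_smul' := hℓ' }
  have h₁ : IsBaseChange B ℓ₁ := h
  have h₂ : IsBaseChange C ℓ₂ := h'
  have h₃ := h₁.comp h₂
  let ℓ₃ : M →ₗ[A] P := { toFun := ℓ'.comp ℓ, map_add' := (ℓ'.comp ℓ).map_add, map_smul' := hℓ'' }
  have e : (ℓ₂.restrictScalars A).comp ℓ₁ = ℓ₃ := LinearMap.ext fun _ => rfl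
  rw [e] at h₃
  exact h₃

theorem IsExtension.of_comp {f : A →+* B} {ℓ : M →+ N} {hℓ : ∀ a m, ℓ (a • m) = f a • ℓ m}
    (h : IsExtension f ℓ hℓ) {g : B →+* C} {ℓ' : N →+ P} {hℓ' : ∀ a m, ℓ' (a • m) = g a • ℓ' m}
    {e : A →+* C} {ℓ'' : M →+ P}
    {hℓ'' : ∀ a m, ℓ'' (a • m) = e a • ℓ'' m} (he : ∀ a, e a = g (f a))
    (hc : ∀ m, ℓ'' m = ℓ' (ℓ m)) (h'' : IsExtension e ℓ'' hℓ'') : IsExtension g ℓ' hℓ' := by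
  obtain rfl : e = g.comp f := RingHom.ext he
  obtain rfl : ℓ'' = ℓ'.comp ℓ := AddMonoidHom.ext hc
  letI : Algebra A B := f.toAlgebra
  letI : Algebra B C := g.toAlgebra
  letI : Algebra A C := (g.comp f).toAlgebra
  letI : Module A N := Module.compHom N f
  letI : Module B P := Module.compHom P g
  letI : Module A P := Module.compHom P (g.comp f)
  haveI : IsScalarTower A B N := ⟨fun a b n => mul_smul (f a) b n⟩
  haveI : IsScalarTower B C P := ⟨fun a b n => mul_smul (g a) b n⟩
  haveI : IsScalarTower A C P := ⟨fun a b n => mul_smul (g (f a)) b n⟩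
  haveI : IsScalarTower A B C := ⟨fun a b c => by
    change g (f a * b) * c = g (f a) * (g b * c)
    rw [map_mul, mul_assoc]⟩
  haveI : IsScalarTower A B P := ⟨fun a b n => by
    change g (f a * b) • n = g (f a) • g b • n
    rw [map_mul, mul_smul]⟩
  exact IsBaseChange.of_comp h h''

theorem IsExtension.flat {f : A →+* B} {ℓ : M →+ N} {hℓ : ∀ a m, ℓ (a • m) = f a • ℓ m}
    (h : IsExtension f ℓ hℓ) [Module.Flat A M] : Module.Flat B N := by
  letI : Algebra A B := f.toAlgebra
  letI : Module A N := Module.compHom N f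
  haveI : IsScalarTower A B N := ⟨fun a b n => mul_smul (f a) b n⟩
  exact Module.Flat.isBaseChange A B M N h

theorem isExtension_of_bijective {M N : Type u} [AddCommGroup M] [AddCommGroup N] [Module A M]
    [Module A N] (f : A →+* A) (hf : ∀ a, f a = a) (ℓ : M →+ N)
    (hℓ : ∀ a m, ℓ (a • m) = f a • ℓ m) (hb : Function.Bijective ℓ) : IsExtension f ℓ hℓ := by
  obtain rfl : f = RingHom.id A := RingHom.ext hf
  have := IsBaseChange.ofEquiv (LinearEquiv.ofBijective
    ({ toFun := ℓ, map_add' := ℓ.map_add, map_smul' := hℓ } : M →ₗ[A] N) hb)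
  unfold IsExtension
  convert! this

/-- The extension of scalars `B ⊗_A M` of a module along `f : A → B`. -/
def Sc (f : A →+* B) (M : Type u) [AddCommGroup M] [Module A M] : Type u :=
  letI : Algebra A B := f.toAlgebra
  B ⊗[A] M

instance (f : A →+* B) : AddCommGroup (Sc f M) :=
  letI : Algebra A B := f.toAlgebra
  (inferInstance : AddCommGroup (B ⊗[A] M))

instance (f : A →+* B) : Module B (Sc f M) :=
  letI : Algebra A B := f.toAlgebra
  (inferInstance : Module B (B ⊗[A] M))

/-- The canonical map `m ↦ 1 ⊗ m`. -/
def Sc.mk (f : A →+* B) : M →+ Sc f M :=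
  letI : Algebra A B := f.toAlgebra
  (TensorProduct.mk A B M 1).toAddMonoidHom

theorem Sc.mk_smul (f : A →+* B) (a : A) (m : M) :
    Sc.mk f (a • m) = f a • Sc.mk f m := by
  letI : Algebra A B := f.toAlgebra
  change (1 : B) ⊗ₜ[A] (a • m) = (f a) • ((1 : B) ⊗ₜ[A] m)
  rw [TensorProduct.tmul_smul, TensorProduct.smul_tmul', TensorProduct.smul_tmul']
  rfl

theorem Sc.isExtension (f : A →+* B) :
    IsExtension f (Sc.mk f : M →+ Sc f M) (Sc.mk_smul f) := by
  letI : Algebra A B := f.toAlgebra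
  have := TensorProduct.isBaseChange A M B
  unfold IsExtension
  convert! this

/-- Functoriality of `B ⊗_A -`. -/
def Sc.map (f : A →+* B) {M M' : Type u} [AddCommGroup M] [Module A M] [AddCommGroup M']
    [Module A M'] (φ : M →ₗ[A] M') : Sc f M →ₗ[B] Sc f M' :=
  letI : Algebra A B := f.toAlgebra
  LinearMap.baseChange B φ

section
variable {M₁ M₂ M₃ : Type u} [AddCommGroup M₁] [AddCommGroup M₂] [AddCommGroup M₃]
variable [Module A M₁] [Module A M₂] [Module A M₃]

@[simp] theorem Sc.map_mk (f : A →+* B) (φ : M₁ →ₗ[A] M₂) (m : M₁) :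
    Sc.map f φ (Sc.mk f m) = Sc.mk f (φ m) := rfl

theorem Sc.hom_ext (f : A →+* B) {N : Type u} [AddCommGroup N] [Module B N]
    {φ ψ : Sc f M →ₗ[B] N} (h : ∀ m, φ (Sc.mk f m) = ψ (Sc.mk f m)) : φ = ψ := by
  ext t
  refine IsExtension.induct (Sc.isExtension f) (fun t => φ t = ψ t) (by simp)
    (fun b m => by simp [h]) ?_ t
  intro x y hx hy
  simp only [map_add, hx, hy]

theorem Sc.map_comp (f : A →+* B) (ψ : M₂ →ₗ[A] M₃) (φ : M₁ →ₗ[A] M₂) :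
    Sc.map f (ψ ∘ₗ φ) = Sc.map f ψ ∘ₗ Sc.map f φ :=
  Sc.hom_ext f fun m => by simp

theorem Sc.map_id (f : A →+* B) : Sc.map f (LinearMap.id : M →ₗ[A] M) = LinearMap.id :=
  Sc.hom_ext f fun m => by simp

/-- `B ⊗_A -` on endomorphisms. -/
def Sc.mapEnd (f : A →+* B) (M : Type u) [AddCommGroup M] [Module A M] :
    Module.End A M →+* Module.End B (Sc f M) where
  toFun := Sc.map f
  map_one' := Sc.map_id f
  map_mul' φ ψ := Sc.map_comp f φ ψ
  map_zero' := Sc.hom_ext f fun m => by simp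
  map_add' φ ψ := Sc.hom_ext f fun m => by simp

end

end ScalarExtension

/-- A locally ringed space over a field `k`: a locally ringed space whose structure sheaf is a
sheaf of `k`-algebras through a ring homomorphism from `k` to the global functions. -/
structure KSpace (k : Type u) [Field k] where
  /-- the underlying locally ringed space -/
  X : LocallyRingedSpace.{u}
  /-- the constants -/
  str : k →+* X.presheaf.obj (op ⊤)

variable {k : Type u} [Field k]

namespace KSpace

variable (S : KSpace k)

/-- The open subsets of the space. -/
abbrev Op : Type u := Opens S.X.toTopCat

/-- The ring `O(V)`. -/
abbrev O (V : S.Op) : Type u := S.X.presheaf.obj (op V)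

/-- Restriction of functions. -/
def res {V W : S.Op} (h : W ≤ V) : S.O V →+* S.O W := (S.X.presheaf.map (homOfLE h).op).hom

@[simp] theorem res_self {V : S.Op} (r : S.O V) : S.res le_rfl r = r := by
  simp [res]

theorem res_res {V W Y : S.Op} (h : W ≤ V) (h' : Y ≤ W) (r : S.O V) :
    S.res h' (S.res h r) = S.res (h'.trans h) r := by
  have : (homOfLE (h'.trans h)).op = (homOfLE h).op ≫ (homOfLE h').op := rfl
  simp [res, this]

variable {S} in
theorem infl {V W : S.Op} : V ⊓ W ≤ V := inf_le_left

variable {S} in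
theorem infr {V W : S.Op} : V ⊓ W ≤ W := inf_le_right

theorem mem_inf {V W : S.Op} {x : S.X} (hV : x ∈ V) (hW : x ∈ W) : x ∈ V ⊓ W := ⟨hV, hW⟩

instance (V : S.Op) : Algebra k (S.O V) := ((S.res le_top).comp S.str).toAlgebra

theorem res_algebraMap {V W : S.Op} (h : W ≤ V) (c : k) :
    S.res h (algebraMap k (S.O V) c) = algebraMap k (S.O W) c :=
  S.res_res le_top h (S.str c)

/-- Restriction of functions as a map of `k`-algebras. -/
def resₐ {V W : S.Op} (h : W ≤ V) : S.O V →ₐ[k] S.O W :=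
  { S.res h with commutes' := S.res_algebraMap h }

@[simp] theorem resₐ_apply {V W : S.Op} (h : W ≤ V) (r : S.O V) : S.resₐ h r = S.res h r := rfl

end KSpace

/-- A sheaf of `O_U ⊗_k A`-modules on the open subset `U`, where `A` is a `k`-algebra.
An `O(V) ⊗_k A`-module is the same as an abelian group with commuting actions of `O(V)` and of
`A` that agree on `k`.  For `A = k` this is a sheaf of `O_U`-modules. -/
structure ModSheaf (S : KSpace k) (A : Type u) [CommRing A] [Algebra k A] (U : S.Op) where
  /-- sections over the open subsets of `U` -/
  sec : ∀ V : S.Op, V ≤ U → Type u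
  [grp : ∀ V hV, AddCommGroup (sec V hV)]
  [modO : ∀ V hV, Module (S.O V) (sec V hV)]
  [modA : ∀ V hV, Module A (sec V hV)]
  [comm : ∀ V hV, SMulCommClass (S.O V) A (sec V hV)]
  smul_const : ∀ V hV (c : k) (s : sec V hV),
    algebraMap k (S.O V) c • s = algebraMap k A c • s
  /-- restriction of sections -/
  res : ∀ {V W : S.Op} (hV : V ≤ U) (h : W ≤ V), sec V hV →+ sec W (h.trans hV)
  res_smulO : ∀ {V W : S.Op} (hV : V ≤ U) (h : W ≤ V) (r : S.O V) (s : sec V hV),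
    res hV h (r • s) = S.res h r • res hV h s
  res_smulA : ∀ {V W : S.Op} (hV : V ≤ U) (h : W ≤ V) (a : A) (s : sec V hV),
    res hV h (a • s) = a • res hV h s
  res_self : ∀ {V : S.Op} (hV : V ≤ U) (s : sec V hV), res hV le_rfl s = s
  res_res : ∀ {V W Y : S.Op} (hV : V ≤ U) (h : W ≤ V) (h' : Y ≤ W) (s : sec V hV),
    res (h.trans hV) h' (res hV h s) = res hV (h'.trans h) s
  /-- compatible sections on an open cover glue uniquely -/
  exists_unique_glue : ∀ {V : S.Op} (hV : V ≤ U) {ι : Type u} (W : ι → S.Op) (hW : ∀ i, W i ≤ V)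
    (_ : V ≤ ⨆ i, W i) (s : ∀ i, sec (W i) ((hW i).trans hV)),
    (∀ i j, res ((hW i).trans hV) (inf_le_left : W i ⊓ W j ≤ W i) (s i) =
      res ((hW j).trans hV) (inf_le_right : W i ⊓ W j ≤ W j) (s j)) →
    ∃! t : sec V hV, ∀ i, res hV (hW i) t = s i

attribute [instance] ModSheaf.grp ModSheaf.modO ModSheaf.modA ModSheaf.comm

namespace ModSheaf

variable {S : KSpace k} {A B C : Type u} [CommRing A] [CommRing B] [CommRing C]
variable [Algebra k A] [Algebra k B] [Algebra k C] {U U' U'' : S.Op}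

/-- Restriction of sections as an `A`-linear map. -/
def resₗ (F : ModSheaf S A U) {V W : S.Op} (hV : V ≤ U) (h : W ≤ V) :
    F.sec V hV →ₗ[A] F.sec W (h.trans hV) :=
  { F.res hV h with map_smul' := F.res_smulA hV h }

@[simp] theorem resₗ_apply (F : ModSheaf S A U) {V W : S.Op} (hV : V ≤ U) (h : W ≤ V)
    (s : F.sec V hV) : F.resₗ hV h s = F.res hV h s := rfl

/-- The open neighbourhoods of `x` inside `U`, smaller neighbourhoods being larger elements. -/
def Nhd (U : S.Op) (x : S.X) : Type u := {V : S.Op // V ≤ U ∧ x ∈ V}ᵒᵈ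

instance (x : S.X) : Preorder (Nhd U x) :=
  inferInstanceAs (Preorder {V : S.Op // V ≤ U ∧ x ∈ V}ᵒᵈ)

instance (x : S.X) : DecidableEq (Nhd U x) := Classical.decEq _

/-- A neighbourhood as an element of the index set. -/
def Nhd.mk {x : S.X} (V : S.Op) (hV : V ≤ U) (hx : x ∈ V) : Nhd U x :=
  OrderDual.toDual ⟨V, hV, hx⟩

/-- The open set underlying a neighbourhood. -/
def Nhd.op {x : S.X} (V : Nhd U x) : S.Op := (OrderDual.ofDual V).1

theorem Nhd.le {x : S.X} (V : Nhd U x) : V.op ≤ U := (OrderDual.ofDual V).2.1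

theorem Nhd.mem {x : S.X} (V : Nhd U x) : x ∈ V.op := (OrderDual.ofDual V).2.2

theorem Nhd.op_le {x : S.X} {V W : Nhd U x} (h : V ≤ W) : W.op ≤ V.op := h

instance (x : S.X) : IsDirectedOrder (Nhd U x) :=
  ⟨fun V W => ⟨Nhd.mk (V.op ⊓ W.op) (KSpace.infl.trans V.le) (S.mem_inf V.mem W.mem),
    (KSpace.infl : V.op ⊓ W.op ≤ V.op), (KSpace.infr : V.op ⊓ W.op ≤ W.op)⟩⟩

/-- The transition maps whose colimit is the stalk. -/
abbrev trans (F : ModSheaf S A U) (x : S.X) (V W : Nhd U x) (h : V ≤ W) :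
    F.sec V.op V.le →ₗ[A] F.sec W.op W.le := F.resₗ V.le (Nhd.op_le h)

instance (F : ModSheaf S A U) (x : S.X) :
    DirectedSystem (fun V : Nhd U x => F.sec V.op V.le) (fun V W h => F.trans x V W h) where
  map_self V s := F.res_self V.le s
  map_map _ _ _ _ _ s := F.res_res _ _ _ s

/-- The stalk at `x`. -/
def stalk (F : ModSheaf S A U) (x : S.X) : Type u :=
  Module.DirectLimit (fun V : Nhd U x => F.sec V.op V.le) (F.trans x)

instance (F : ModSheaf S A U) (x : S.X) : AddCommGroup (F.stalk x) :=
  inferInstanceAs (AddCommGroup (Module.DirectLimit _ (F.trans x)))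

instance (F : ModSheaf S A U) (x : S.X) : Module A (F.stalk x) :=
  inferInstanceAs (Module A (Module.DirectLimit _ (F.trans x)))

/-- The germ at `x` of a section. -/
def germ (F : ModSheaf S A U) {V : S.Op} (hV : V ≤ U) (x : S.X) (hx : x ∈ V) :
    F.sec V hV →ₗ[A] F.stalk x :=
  Module.DirectLimit.of A (Nhd U x) (fun V : Nhd U x => F.sec V.op V.le) (F.trans x)
    (Nhd.mk V hV hx)

theorem germ_res (F : ModSheaf S A U) {V W : S.Op} (hV : V ≤ U) (h : W ≤ V) (x : S.X)
    (hx : x ∈ W) (s : F.sec V hV) :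
    F.germ (h.trans hV) x hx (F.res hV h s) = F.germ hV x (h hx) s :=
  Module.DirectLimit.of_f (R := A) (G := fun V : Nhd U x => F.sec V.op V.le) (f := F.trans x)
    (i := Nhd.mk V hV (h hx)) (j := Nhd.mk W (h.trans hV) hx) (hij := h)

theorem exists_germ (F : ModSheaf S A U) {x : S.X} (hx : x ∈ U) (t : F.stalk x) :
    ∃ (V : S.Op) (hV : V ≤ U) (hxV : x ∈ V) (s : F.sec V hV), F.germ hV x hxV s = t := by
  haveI : Nonempty (Nhd U x) := ⟨Nhd.mk U le_rfl hx⟩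
  obtain ⟨V, s, h⟩ := Module.DirectLimit.exists_of (R := A) (f := F.trans x) t
  exact ⟨V.op, V.le, V.mem, s, h⟩

/-- Germs can be represented inside a given neighbourhood. -/
theorem exists_germ_le (F : ModSheaf S A U) {x : S.X} {Y : S.Op} (hY : Y ≤ U) (hx : x ∈ Y)
    (t : F.stalk x) :
    ∃ (V : S.Op) (hV : V ≤ Y) (hxV : x ∈ V) (s : F.sec V (hV.trans hY)),
      F.germ (hV.trans hY) x hxV s = t := by
  obtain ⟨V, hV, hxV, s, rfl⟩ := F.exists_germ (hY hx) t
  exact ⟨V ⊓ Y, KSpace.infr, S.mem_inf hxV hx, F.res hV KSpace.infl s, F.germ_res hV KSpace.infl x _ s⟩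

theorem germ_eq_zero (F : ModSheaf S A U) {V : S.Op} (hV : V ≤ U) {x : S.X} (hx : x ∈ V)
    {s : F.sec V hV} (h : F.germ hV x hx s = 0) :
    ∃ (W : S.Op) (hW : W ≤ V), x ∈ W ∧ F.res hV hW s = 0 := by
  obtain ⟨W, hW, h'⟩ := Module.DirectLimit.of.zero_exact (R := A) (f := F.trans x) h
  exact ⟨W.op, hW, W.mem, h'⟩

theorem germ_eq (F : ModSheaf S A U) {V : S.Op} (hV : V ≤ U) {x : S.X} (hx : x ∈ V)
    {s t : F.sec V hV} (h : F.germ hV x hx s = F.germ hV x hx t) :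
    ∃ (W : S.Op) (hW : W ≤ V), x ∈ W ∧ F.res hV hW s = F.res hV hW t := by
  obtain ⟨W, hW, hx, h'⟩ := F.germ_eq_zero hV hx (s := s - t) (by rw [map_sub, h, sub_self])
  exact ⟨W, hW, hx, by rwa [map_sub, sub_eq_zero] at h'⟩

/-- Sections that agree locally are equal. -/
theorem ext_local (F : ModSheaf S A U) {V : S.Op} (hV : V ≤ U) {s t : F.sec V hV}
    (h : ∀ x ∈ V, ∃ (W : S.Op) (hW : W ≤ V), x ∈ W ∧ F.res hV hW s = F.res hV hW t) : s = t := by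
  choose! W hW hxW e using h
  refine (F.exists_unique_glue hV (ι := V) (fun x => W x.1) (fun x => hW x.1 x.2)
    (fun x hx => Opens.mem_iSup.2 ⟨⟨x, hx⟩, hxW x hx⟩)
    (fun x => F.res hV (hW x.1 x.2) s) ?_).unique (fun _ => rfl) (fun x => (e x.1 x.2).symm)
  intro x y
  rw [F.res_res, F.res_res]

theorem ext_germ (F : ModSheaf S A U) {V : S.Op} (hV : V ≤ U) {s t : F.sec V hV}
    (h : ∀ x hx, F.germ hV x hx s = F.germ hV x hx t) : s = t :=
  F.ext_local hV fun x hx => F.germ_eq hV hx (h x hx)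

/-- Sections given locally, and compatible on germs, glue. -/
theorem exists_glue_germ (F : ModSheaf S A U) {V : S.Op} (hV : V ≤ U)
    (t : ∀ x : S.X, x ∈ V → F.stalk x)
    (h : ∀ x ∈ V, ∃ (W : S.Op) (hW : W ≤ V) (_ : x ∈ W) (s : F.sec W (hW.trans hV)),
      ∀ y (hy : y ∈ W), F.germ (hW.trans hV) y hy s = t y (hW hy)) :
    ∃ s : F.sec V hV, ∀ x hx, F.germ hV x hx s = t x hx := by
  choose W hW hxW s hs using fun x : V => h x.1 x.2
  obtain ⟨s', hs', -⟩ := F.exists_unique_glue hV (ι := V) W hW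
    (fun x hx => Opens.mem_iSup.2 ⟨⟨x, hx⟩, hxW ⟨x, hx⟩⟩) s (fun i j => by
      refine F.ext_germ _ fun x hx => ?_
      rw [F.germ_res, F.germ_res, hs, hs])
  refine ⟨s', fun x hx => ?_⟩
  rw [← hs ⟨x, hx⟩ x (hxW ⟨x, hx⟩), ← hs' ⟨x, hx⟩, F.germ_res]

/-- The action of the functions on a neighbourhood of `x` on the stalk at `x`. -/
def stalkAct (F : ModSheaf S A U) {V : S.Op} {x : S.X} (hx : x ∈ V) (r : S.O V) :
    F.stalk x →ₗ[A] F.stalk x :=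
  Module.DirectLimit.lift A (Nhd U x) (fun V : Nhd U x => F.sec V.op V.le) (F.trans x)
    (fun W =>
      { toFun := fun s => F.germ (V := V ⊓ W.op) ((KSpace.infr : V ⊓ W.op ≤ W.op).trans W.le) x (S.mem_inf hx W.mem)
          (S.res (KSpace.infl : V ⊓ W.op ≤ V) r • F.res W.le (KSpace.infr : V ⊓ W.op ≤ W.op) s)
        map_add' := fun s t => by simp only [map_add, smul_add]
        map_smul' := fun a s => by
          rw [F.res_smulA, smul_comm, map_smul, RingHom.id_apply] })
    (fun W Y h s => by
      change F.germ _ x _ (_ • F.res _ _ (F.res _ _ s)) = F.germ _ x _ (_ • F.res _ _ s)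
      rw [← F.germ_res (V := V ⊓ W.op) (W := V ⊓ Y.op) _
        (inf_le_inf_left V (Nhd.op_le h)) x (S.mem_inf hx Y.mem), F.res_smulO, F.res_res, F.res_res,
        S.res_res])

theorem stalkAct_germ (F : ModSheaf S A U) {V W : S.Op} {x : S.X} (hW : W ≤ U) (h : W ≤ V)
    (hx : x ∈ W) (r : S.O V) (s : F.sec W hW) :
    F.stalkAct (h hx) r (F.germ hW x hx s) = F.germ hW x hx (S.res h r • s) := by
  refine (Module.DirectLimit.lift_of (R := A) (G := fun V : Nhd U x => F.sec V.op V.le)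
    (f := F.trans x) _ _ (i := Nhd.mk W hW hx) s).trans ?_
  change F.germ _ x _ (_ • F.res _ _ s) = _
  rw [← F.germ_res hW (KSpace.infr : V ⊓ W ≤ W) x (S.mem_inf (h hx) hx), F.res_smulO, S.res_res]
  rfl

end ModSheaf

namespace ModSheaf

variable {S : KSpace k} {A B C : Type u} [CommRing A] [CommRing B] [CommRing C]
variable [Algebra k A] [Algebra k B] [Algebra k C] {U U' U'' : S.Op}

/-- A morphism `F|_W → G|_W` of sheaves on the open set `W`, linear over `O_W` and semilinear over
the homomorphism `f : A → B`.  For `f = id` this is a morphism of `O_W ⊗_k A`-modules; in general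
it is a morphism of `O_W ⊗_k A`-modules from `F|_W` to `G|_W`, the latter viewed as
an `O_W ⊗_k A`-module through `f`. -/
@[ext]
structure HomOn (f : A →ₐ[k] B) (F : ModSheaf S A U) (G : ModSheaf S B U') (W : S.Op)
    (hF : W ≤ U) (hG : W ≤ U') where
  /-- the map on sections -/
  app : ∀ (V : S.Op) (hV : V ≤ W), F.sec V (hV.trans hF) →+ G.sec V (hV.trans hG)
  app_smulO : ∀ V hV (r : S.O V) s, app V hV (r • s) = r • app V hV s
  app_smulA : ∀ V hV (a : A) s, app V hV (a • s) = f a • app V hV s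
  app_res : ∀ {V V' : S.Op} (hV : V ≤ W) (h : V' ≤ V) (s : F.sec V (hV.trans hF)),
    app V' (h.trans hV) (F.res (hV.trans hF) h s) = G.res (hV.trans hG) h (app V hV s)

namespace HomOn

variable {F : ModSheaf S A U} {G : ModSheaf S B U'} {H : ModSheaf S C U''} {W : S.Op}
variable {hF : W ≤ U} {hG : W ≤ U'} {hH : W ≤ U''}
variable {f : A →ₐ[k] B} {g : B →ₐ[k] C} {e : A →ₐ[k] C}

/-- The map on germs before passing to the colimit. -/
def preStalkMap (φ : HomOn f F G W hF hG) (x : S.X) (hx : x ∈ W) (V : Nhd U x) :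
    letI : Module A (G.stalk x) := Module.compHom _ f.toRingHom
    F.sec V.op V.le →ₗ[A] G.stalk x :=
  letI : Module A (G.stalk x) := Module.compHom _ f.toRingHom
  { toFun := fun s => G.germ (V := V.op ⊓ W) ((KSpace.infr : V.op ⊓ W ≤ W).trans hG) x
      (S.mem_inf V.mem hx)
      (φ.app (V.op ⊓ W) KSpace.infr (F.res V.le (KSpace.infl : V.op ⊓ W ≤ V.op) s))
    map_add' := fun s t => by simp only [map_add]
    map_smul' := fun a s => by
      rw [F.res_smulA, φ.app_smulA, map_smul]
      rfl }

theorem preStalkMap_trans (φ : HomOn f F G W hF hG) (x : S.X) (hx : x ∈ W) (V V' : Nhd U x)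
    (h : V ≤ V') (s : F.sec V.op V.le) :
    φ.preStalkMap x hx V' (F.trans x V V' h s) = φ.preStalkMap x hx V s := by
  change G.germ _ x _ (φ.app _ _ (F.res _ _ (F.res _ _ s))) =
    G.germ _ x _ (φ.app _ _ (F.res _ _ s))
  rw [← G.germ_res (V := V.op ⊓ W) (W := V'.op ⊓ W) _
    (inf_le_inf_right W (Nhd.op_le h)) x (S.mem_inf V'.mem hx), ← φ.app_res, F.res_res,
    F.res_res]

/-- The induced map on the stalks. -/
def stalkMap (φ : HomOn f F G W hF hG) (x : S.X) (hx : x ∈ W) : F.stalk x →+ G.stalk x :=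
  letI : Module A (G.stalk x) := Module.compHom _ f.toRingHom
  (Module.DirectLimit.lift A (Nhd U x) (fun V : Nhd U x => F.sec V.op V.le) (F.trans x)
    (φ.preStalkMap x hx) (φ.preStalkMap_trans x hx)).toAddMonoidHom

theorem stalkMap_germ (φ : HomOn f F G W hF hG) {V : S.Op} (hV : V ≤ W) (x : S.X) (hx : x ∈ V)
    (s : F.sec V (hV.trans hF)) :
    φ.stalkMap x (hV hx) (F.germ (hV.trans hF) x hx s) =
      G.germ (hV.trans hG) x hx (φ.app V hV s) := by
  letI : Module A (G.stalk x) := Module.compHom _ f.toRingHom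
  refine (Module.DirectLimit.lift_of (φ.preStalkMap x (hV hx))
    (φ.preStalkMap_trans x (hV hx)) (i := Nhd.mk V (hV.trans hF) hx) s).trans ?_
  rw [← G.germ_res (hV.trans hG) (KSpace.infl : V ⊓ W ≤ V) x (S.mem_inf hx (hV hx)), ← φ.app_res]
  rfl

theorem stalkMap_smul (φ : HomOn f F G W hF hG) {x : S.X} (hx : x ∈ W) (a : A) (t : F.stalk x) :
    φ.stalkMap x hx (a • t) = f.toRingHom a • φ.stalkMap x hx t := by
  obtain ⟨V, hV, hxV, s, rfl⟩ := F.exists_germ_le hF hx t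
  rw [← map_smul, φ.stalkMap_germ hV x hxV, φ.stalkMap_germ hV x hxV, φ.app_smulA, map_smul]
  rfl

/-- `φ : F|_W → G|_W` exhibits `G|_W` as the pullback of `F|_W` along
`W × Spec B → W × Spec A`: the induced morphism `F ⊗_A B → G` is an isomorphism, that
is, it is bijective on the stalks. -/
def IsPullback (φ : HomOn f F G W hF hG) : Prop :=
  ∀ x (hx : x ∈ W), IsExtension f.toRingHom (φ.stalkMap x hx) (φ.stalkMap_smul hx)

/-- Isomorphisms of sheaves. -/
def IsIso (φ : HomOn f F G W hF hG) : Prop := ∀ V hV, Function.Bijective (φ.app V hV)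

/-- Composition. -/
def comp (ψ : HomOn g G H W hG hH) (φ : HomOn f F G W hF hG) (he : ∀ a, e a = g (f a)) :
    HomOn e F H W hF hH where
  app V hV := (ψ.app V hV).comp (φ.app V hV)
  app_smulO V hV r s := by
    change ψ.app V hV (φ.app V hV _) = _ • ψ.app V hV (φ.app V hV _)
    rw [φ.app_smulO, ψ.app_smulO]
  app_smulA V hV a s := by
    change ψ.app V hV (φ.app V hV _) = _ • ψ.app V hV (φ.app V hV _)
    rw [φ.app_smulA, ψ.app_smulA, he]
  app_res hV h s := by
    change ψ.app _ _ (φ.app _ _ _) = H.res _ _ (ψ.app _ _ (φ.app _ _ _))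
    rw [φ.app_res, ψ.app_res]

@[simp] theorem comp_app (ψ : HomOn g G H W hG hH) (φ : HomOn f F G W hF hG)
    (he : ∀ a, e a = g (f a)) (V : S.Op) (hV : V ≤ W) (s : F.sec V (hV.trans hF)) :
    (ψ.comp φ he).app V hV s = ψ.app V hV (φ.app V hV s) := rfl

/-- Restriction to a smaller open set. -/
def restrict (φ : HomOn f F G W hF hG) {W' : S.Op} (h : W' ≤ W) :
    HomOn f F G W' (h.trans hF) (h.trans hG) where
  app V hV := φ.app V (hV.trans h)
  app_smulO V _ r s := φ.app_smulO V _ r s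
  app_smulA V _ a s := φ.app_smulA V _ a s
  app_res hV h' s := φ.app_res (hV.trans h) h' s

@[simp] theorem restrict_app (φ : HomOn f F G W hF hG) {W' : S.Op} (h : W' ≤ W) (V : S.Op)
    (hV : V ≤ W') (s : F.sec V (hV.trans (h.trans hF))) :
    (φ.restrict h).app V hV s = φ.app V (hV.trans h) s := rfl

theorem stalkMap_comp (ψ : HomOn g G H W hG hH) (φ : HomOn f F G W hF hG)
    (he : ∀ a, e a = g (f a)) {x : S.X} (hx : x ∈ W) (t : F.stalk x) :
    (ψ.comp φ he).stalkMap x hx t = ψ.stalkMap x hx (φ.stalkMap x hx t) := by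
  obtain ⟨V, hV, hxV, s, rfl⟩ := F.exists_germ_le hF hx t
  rw [stalkMap_germ _ hV x hxV, stalkMap_germ _ hV x hxV, stalkMap_germ _ hV x hxV, comp_app]

theorem stalkMap_restrict (φ : HomOn f F G W hF hG) {W' : S.Op} (h : W' ≤ W) {x : S.X}
    (hx : x ∈ W') (t : F.stalk x) : (φ.restrict h).stalkMap x hx t = φ.stalkMap x (h hx) t := by
  obtain ⟨V, hV, hxV, s, rfl⟩ := F.exists_germ_le (h.trans hF) hx t
  rw [stalkMap_germ _ hV x hxV, stalkMap_germ _ (hV.trans h) x hxV, restrict_app]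

theorem IsPullback.restrict {φ : HomOn f F G W hF hG} (hφ : φ.IsPullback) {W' : S.Op}
    (h : W' ≤ W) : (φ.restrict h).IsPullback := by
  intro x hx
  have e : (φ.restrict h).stalkMap x hx = φ.stalkMap x (h hx) :=
    AddMonoidHom.ext fun t => φ.stalkMap_restrict h hx t
  have := hφ x (h hx)
  simp only [e]
  exact this

theorem IsPullback.comp {ψ : HomOn g G H W hG hH} {φ : HomOn f F G W hF hG}
    (hψ : ψ.IsPullback) (hφ : φ.IsPullback) (he : ∀ a, e a = g (f a)) :
    (ψ.comp φ he).IsPullback := fun x hx =>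
  (hφ x hx).comp (hψ x hx) he (stalkMap_comp ψ φ he hx)

theorem IsPullback.of_comp {ψ : HomOn g G H W hG hH} {φ : HomOn f F G W hF hG}
    {χ : HomOn e F H W hF hH} (hφ : φ.IsPullback) (hχ : χ.IsPullback) (he : ∀ a, e a = g (f a))
    (hc : ∀ V hV s, ψ.app V hV (φ.app V hV s) = χ.app V hV s) : ψ.IsPullback := fun x hx =>
  (hφ x hx).of_comp he (fun t => by
    obtain ⟨V, hV, hxV, s, rfl⟩ := F.exists_germ_le hF hx t
    rw [stalkMap_germ _ hV x hxV, stalkMap_germ _ hV x hxV, stalkMap_germ _ hV x hxV, hc])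
    (hχ x hx)

theorem IsIso.isPullback {G : ModSheaf S A U'} {f : A →ₐ[k] A} {φ : HomOn f F G W hF hG}
    (hφ : φ.IsIso) (hf : ∀ a, f a = a) : φ.IsPullback := by
  intro x hx
  refine isExtension_of_bijective _ hf _ _ ⟨?_, ?_⟩
  · rw [injective_iff_map_eq_zero]
    intro t ht
    obtain ⟨V, hV, hxV, s, rfl⟩ := F.exists_germ_le hF hx t
    rw [stalkMap_germ _ hV x hxV] at ht
    obtain ⟨V', hV', hx', h0⟩ := G.germ_eq_zero _ _ ht
    rw [← φ.app_res] at h0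
    rw [← F.germ_res (hV.trans hF) hV' x hx', (injective_iff_map_eq_zero _).1 (hφ _ _).1 _ h0,
      map_zero]
  · intro t
    obtain ⟨V, hV, hxV, s, rfl⟩ := G.exists_germ_le hG hx t
    obtain ⟨s, rfl⟩ := (hφ V hV).2 s
    exact ⟨_, stalkMap_germ _ hV x hxV s⟩

/-- A morphism out of a pullback is determined by its composite with the canonical morphism. -/
theorem IsPullback.hom_ext {φ : HomOn f F G W hF hG} (hφ : φ.IsPullback)
    {θ θ' : HomOn g G H W hG hH}
    (h : ∀ V hV s, θ.app V hV (φ.app V hV s) = θ'.app V hV (φ.app V hV s)) : θ = θ' := by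
  ext V hV s
  refine H.ext_germ _ fun x hx => ?_
  rw [← stalkMap_germ _ hV x hx, ← stalkMap_germ _ hV x hx]
  generalize G.germ _ x hx s = t
  refine (hφ x (hV hx)).induct (fun t => θ.stalkMap x (hV hx) t = θ'.stalkMap x (hV hx) t)
    (by simp) (fun b m => ?_) (fun _ _ h₁ h₂ => by simp only [map_add, h₁, h₂]) t
  obtain ⟨Y, hY, hxY, s, rfl⟩ := F.exists_germ_le hF (hV hx) m
  rw [stalkMap_smul, stalkMap_smul, stalkMap_germ _ hY x hxY, stalkMap_germ _ hY x hxY,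
    stalkMap_germ _ hY x hxY, h]

/-- The universal property of the pullback. -/
theorem IsPullback.exists_desc {φ : HomOn f F G W hF hG} (hφ : φ.IsPullback)
    (ψ : HomOn e F H W hF hH) (he : ∀ a, e a = g (f a)) :
    ∃ θ : HomOn g G H W hG hH, ∀ V hV s, θ.app V hV (φ.app V hV s) = ψ.app V hV s := by
  choose θ hθ hθψ using fun x (hx : x ∈ W) =>
    (hφ x hx).exists_lift g.toRingHom (ψ.stalkMap x hx) (fun a m => by
      rw [stalkMap_smul]
      congr 1
      exact he a)
  have key : ∀ V (hV : V ≤ W) (s : G.sec V (hV.trans hG)), ∃ s' : H.sec V (hV.trans hH),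
      ∀ x hx, H.germ _ x hx s' = θ x (hV hx) (G.germ _ x hx s) := by
    intro V hV s
    refine H.exists_glue_germ (hV.trans hH) (fun x hx => θ x (hV hx) (G.germ _ x hx s)) ?_
    intro x hx
    -- every germ is realised near `x`
    have loc : ∀ t : G.stalk x, ∃ (Y : S.Op) (hY : Y ≤ V) (_ : x ∈ Y)
        (u : G.sec Y (hY.trans (hV.trans hG))) (u' : H.sec Y (hY.trans (hV.trans hH))),
        G.germ _ x ‹_› u = t ∧
        ∀ y (hy : y ∈ Y), H.germ _ y hy u' = θ y (hV (hY hy)) (G.germ _ y hy u) := by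
      intro t
      refine (hφ x (hV hx)).induct (fun t => ∃ (Y : S.Op) (hY : Y ≤ V) (_ : x ∈ Y)
        (u : G.sec Y (hY.trans (hV.trans hG))) (u' : H.sec Y (hY.trans (hV.trans hH))),
        G.germ _ x ‹_› u = t ∧
        ∀ y (hy : y ∈ Y), H.germ _ y hy u' = θ y (hV (hY hy)) (G.germ _ y hy u)) ?_ ?_ ?_ t
      · exact ⟨V, le_rfl, hx, 0, 0, by simp, fun y hy => by simp⟩
      · intro b m
        obtain ⟨Y, hY, hxY, u, rfl⟩ := F.exists_germ_le (hV.trans hF) hx m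
        refine ⟨Y, hY, hxY, b • φ.app Y (hY.trans hV) u, g b • ψ.app Y (hY.trans hV) u, ?_, ?_⟩
        · rw [map_smul, stalkMap_germ _ (hY.trans hV) x hxY]
        · intro y hy
          rw [map_smul, map_smul, hθ, ← stalkMap_germ _ (hY.trans hV) y hy,
            ← stalkMap_germ _ (hY.trans hV) y hy, hθψ]
          rfl
      · rintro _ _ ⟨Y, hY, hxY, u, u', rfl, h⟩ ⟨Z, hZ, hxZ, v, v', rfl, h'⟩
        have hi : Y ⊓ Z ≤ V := KSpace.infl.trans hY
        refine ⟨Y ⊓ Z, hi, S.mem_inf hxY hxZ,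
          G.res _ (KSpace.infl : Y ⊓ Z ≤ Y) u + G.res _ (KSpace.infr : Y ⊓ Z ≤ Z) v,
          H.res _ (KSpace.infl : Y ⊓ Z ≤ Y) u' + H.res _ (KSpace.infr : Y ⊓ Z ≤ Z) v', ?_, ?_⟩
        · rw [map_add, G.germ_res, G.germ_res]
        · intro y hy
          rw [map_add, map_add, H.germ_res, H.germ_res, G.germ_res, G.germ_res, map_add, h, h']
    obtain ⟨Y, hY, hxY, u, u', hu, hu'⟩ := loc (G.germ _ x hx s)
    rw [← G.germ_res _ hY x hxY] at hu
    obtain ⟨Z, hZ, hxZ, hs⟩ := G.germ_eq _ _ hu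
    refine ⟨Z, hZ.trans hY, hxZ, H.res _ hZ u', fun y hy => ?_⟩
    rw [H.germ_res, hu', ← G.germ_res _ hZ y hy, hs, G.res_res, G.germ_res]
  choose θ' hθ' using key
  refine ⟨⟨fun V hV => ⟨⟨θ' V hV, ?_⟩, ?_⟩, ?_, ?_, ?_⟩, ?_⟩
  · exact H.ext_germ _ fun x hx => by simp [hθ']
  · intro s t
    exact H.ext_germ _ fun x hx => by simp [hθ']
  · intro V hV r s
    refine H.ext_germ _ fun x hx => ?_
    change H.germ _ x hx (θ' V hV (r • s)) = H.germ _ x hx (r • θ' V hV s)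
    have h1 := H.stalkAct_germ (hV.trans hH) le_rfl hx r (θ' V hV s)
    have h2 := G.stalkAct_germ (hV.trans hG) le_rfl hx r s
    rw [S.res_self] at h1 h2
    rw [hθ', ← h1, ← h2, hθ']
    generalize G.germ _ x hx s = t
    refine (hφ x (hV hx)).induct (fun t => θ x (hV hx) (G.stalkAct hx r t) =
      H.stalkAct hx r (θ x (hV hx) t)) (by simp) (fun b m => ?_)
      (fun _ _ h₁ h₂ => by simp only [map_add, h₁, h₂]) t
    obtain ⟨Y, hY, hxY, s, rfl⟩ := F.exists_germ_le (hV.trans hF) hx m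
    rw [map_smul, hθ, hθ, map_smul, hθψ, stalkMap_germ _ (hY.trans hV) x hxY,
      stalkMap_germ _ (hY.trans hV) x hxY, G.stalkAct_germ _ hY hxY, H.stalkAct_germ _ hY hxY,
      ← ψ.app_smulO, ← φ.app_smulO, ← stalkMap_germ _ (hY.trans hV) x hxY,
      ← stalkMap_germ _ (hY.trans hV) x hxY, hθψ]
  · intro V hV b s
    refine H.ext_germ _ fun x hx => ?_
    change H.germ _ x hx (θ' V hV (b • s)) = H.germ _ x hx (g b • θ' V hV s)
    rw [map_smul, hθ', hθ', map_smul, hθ]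
    rfl
  · intro V V' hV h s
    refine H.ext_germ _ fun x hx => ?_
    change H.germ _ x hx (θ' V' _ (G.res _ h s)) = H.germ _ x hx (H.res _ h (θ' V hV s))
    rw [hθ', H.germ_res, hθ', G.germ_res]
  · intro V hV s
    refine H.ext_germ _ fun x hx => ?_
    change H.germ _ x hx (θ' V hV (φ.app V hV s)) = _
    rw [hθ', ← stalkMap_germ _ hV x hx, hθψ, stalkMap_germ _ hV x hx]

end HomOn

end ModSheaf

namespace ModSheaf

variable {S : KSpace k} {A B : Type u} [CommRing A] [CommRing B]
variable [Algebra k A] [Algebra k B] {U : S.Op}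

section StalkAct

variable (F : ModSheaf S A U) {V : S.Op} {x : S.X} (hx : x ∈ V)

theorem stalkAct_res {W : S.Op} (h : W ≤ V) (hxW : x ∈ W) (hU : x ∈ U) (r : S.O V) :
    F.stalkAct hxW (S.res h r) = F.stalkAct (h hxW) r := by
  ext t
  obtain ⟨Y, hY, hxY, s, rfl⟩ := F.exists_germ_le (KSpace.infr : W ⊓ U ≤ U) (S.mem_inf hxW hU) t
  rw [F.stalkAct_germ _ (hY.trans KSpace.infl) hxY,
    F.stalkAct_germ _ ((hY.trans KSpace.infl).trans h) hxY, S.res_res]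

theorem stalkAct_one (hU : x ∈ U) : F.stalkAct hx (1 : S.O V) = LinearMap.id := by
  ext t
  obtain ⟨Y, hY, hxY, s, rfl⟩ := F.exists_germ_le (KSpace.infr : V ⊓ U ≤ U) (S.mem_inf hx hU) t
  rw [F.stalkAct_germ _ (hY.trans KSpace.infl) hxY, map_one, one_smul, LinearMap.id_apply]

theorem stalkAct_mul (hU : x ∈ U) (r r' : S.O V) :
    F.stalkAct hx (r * r') = F.stalkAct hx r ∘ₗ F.stalkAct hx r' := by
  ext t
  obtain ⟨Y, hY, hxY, s, rfl⟩ := F.exists_germ_le (KSpace.infr : V ⊓ U ≤ U) (S.mem_inf hx hU) t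
  rw [LinearMap.comp_apply, F.stalkAct_germ _ (hY.trans KSpace.infl) hxY,
    F.stalkAct_germ _ (hY.trans KSpace.infl) hxY, F.stalkAct_germ _ (hY.trans KSpace.infl) hxY,
    map_mul, mul_smul]

theorem stalkAct_add (hU : x ∈ U) (r r' : S.O V) :
    F.stalkAct hx (r + r') = F.stalkAct hx r + F.stalkAct hx r' := by
  ext t
  obtain ⟨Y, hY, hxY, s, rfl⟩ := F.exists_germ_le (KSpace.infr : V ⊓ U ≤ U) (S.mem_inf hx hU) t
  rw [LinearMap.add_apply, F.stalkAct_germ _ (hY.trans KSpace.infl) hxY,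
    F.stalkAct_germ _ (hY.trans KSpace.infl) hxY, F.stalkAct_germ _ (hY.trans KSpace.infl) hxY,
    map_add, add_smul, map_add]

theorem stalkAct_const (hU : x ∈ U) (c : k) (t : F.stalk x) :
    F.stalkAct hx (algebraMap k (S.O V) c) t = algebraMap k A c • t := by
  obtain ⟨Y, hY, hxY, s, rfl⟩ := F.exists_germ_le (KSpace.infr : V ⊓ U ≤ U) (S.mem_inf hx hU) t
  rw [F.stalkAct_germ _ (hY.trans KSpace.infl) hxY, S.res_algebraMap, F.smul_const, map_smul]

/-- The ring `O(V)` acts on the stalks at the points of `V`. -/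
def stalkActHom (hU : x ∈ U) : S.O V →+* Module.End A (F.stalk x) where
  toFun := F.stalkAct hx
  map_one' := F.stalkAct_one hx hU
  map_mul' := F.stalkAct_mul hx hU
  map_zero' := by
    have := F.stalkAct_add hx hU 0 0
    rw [add_zero] at this
    exact left_eq_add.mp this
  map_add' := F.stalkAct_add hx hU

end StalkAct

section Pullback

variable (f : A →ₐ[k] B) (F : ModSheaf S A U)

/-- The sections over `V` of the pullback of `F` along `U × Spec B → U × Spec A`, that is of the
sheaf associated with `V ↦ B ⊗_A F(V)`: the functions that assign to each `x ∈ V` an element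
of `B ⊗_A F_x` and that locally come from an element of `B ⊗_A F(W)`. -/
def pullbackSec (V : S.Op) (hV : V ≤ U) :
    Submodule B (∀ x : V, Sc f.toRingHom (F.stalk x.1)) where
  carrier := {s | ∀ x : V, ∃ (W : S.Op) (hW : W ≤ V) (_ : x.1 ∈ W)
    (t : Sc f.toRingHom (F.sec W (hW.trans hV))), ∀ y (hy : y ∈ W),
      s ⟨y, hW hy⟩ = Sc.map f.toRingHom (F.germ (hW.trans hV) y hy) t}
  zero_mem' x := ⟨V, le_rfl, x.2, 0, fun y hy => by rw [map_zero]; rfl⟩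
  add_mem' := by
    rintro s s' hs hs' x
    obtain ⟨W, hW, hx, t, ht⟩ := hs x
    obtain ⟨W', hW', hx', t', ht'⟩ := hs' x
    refine ⟨W ⊓ W', KSpace.infl.trans hW, S.mem_inf hx hx',
      Sc.map f.toRingHom (F.resₗ (hW.trans hV) (KSpace.infl : W ⊓ W' ≤ W)) t +
      Sc.map f.toRingHom (F.resₗ (hW'.trans hV) (KSpace.infr : W ⊓ W' ≤ W')) t', fun y hy => ?_⟩
    rw [map_add, ← LinearMap.comp_apply, ← LinearMap.comp_apply, ← Sc.map_comp, ← Sc.map_comp,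
      Pi.add_apply, ht y (KSpace.infl hy), ht' y (KSpace.infr hy)]
    congr 3
    · ext u; exact (F.germ_res _ _ y hy u).symm
    · ext u; exact (F.germ_res _ _ y hy u).symm
  smul_mem' := by
    rintro b s hs x
    obtain ⟨W, hW, hx, t, ht⟩ := hs x
    exact ⟨W, hW, hx, b • t, fun y hy => by rw [map_smul, ← ht y hy, Pi.smul_apply]⟩

variable {f F}

/-- `O(V)` acts pointwise on the sections of the pullback. -/
def pullbackAct {V : S.Op} (hV : V ≤ U) (r : S.O V) (s : F.pullbackSec f V hV) :
    F.pullbackSec f V hV :=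
  ⟨fun x => Sc.mapEnd f.toRingHom (F.stalk x.1) (F.stalkActHom x.2 (hV x.2) r) (s.1 x), by
    intro x
    obtain ⟨W, hW, hx, t, ht⟩ := s.2 x
    refine ⟨W, hW, hx, Sc.map f.toRingHom
      { toFun := fun u => S.res hW r • u
        map_add' := fun u v => smul_add _ u v
        map_smul' := fun a u => smul_comm _ _ u } t, fun y hy => ?_⟩
    change Sc.map f.toRingHom (F.stalkAct (hW hy) r) _ = _
    rw [ht y hy, ← LinearMap.comp_apply, ← LinearMap.comp_apply, ← Sc.map_comp, ← Sc.map_comp]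
    congr 2
    ext u
    exact F.stalkAct_germ _ hW hy r u⟩

instance {V : S.Op} (hV : V ≤ U) : Module (S.O V) (F.pullbackSec f V hV) where
  smul := pullbackAct hV
  one_smul s := Subtype.ext <| funext fun x => by
    change Sc.mapEnd f.toRingHom (F.stalk x.1) (F.stalkActHom x.2 (hV x.2) 1) (s.1 x) = s.1 x
    rw [map_one, map_one]; rfl
  mul_smul r r' s := Subtype.ext <| funext fun x => by
    change Sc.mapEnd f.toRingHom (F.stalk x.1) (F.stalkActHom x.2 (hV x.2) (r * r')) (s.1 x) = _
    rw [map_mul, map_mul]; rfl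
  smul_zero r := Subtype.ext <| funext fun x => map_zero _
  smul_add r s s' := Subtype.ext <| funext fun x => map_add _ _ _
  add_smul r r' s := Subtype.ext <| funext fun x => by
    change Sc.mapEnd f.toRingHom (F.stalk x.1) (F.stalkActHom x.2 (hV x.2) (r + r')) (s.1 x) = _
    rw [map_add, map_add]; rfl
  zero_smul s := Subtype.ext <| funext fun x => by
    change Sc.mapEnd f.toRingHom (F.stalk x.1) (F.stalkActHom x.2 (hV x.2) 0) (s.1 x) = _
    rw [map_zero, map_zero]; rfl

theorem pullbackSec_smulO {V : S.Op} (hV : V ≤ U) (r : S.O V) (s : F.pullbackSec f V hV) (x : V) :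
    (r • s).1 x = Sc.map f.toRingHom (F.stalkAct x.2 r) (s.1 x) := rfl

variable (f F)

/-- Restriction of sections of the pullback. -/
def pullbackRes {V W : S.Op} (hV : V ≤ U) (h : W ≤ V) :
    F.pullbackSec f V hV →+ F.pullbackSec f W (h.trans hV) where
  toFun s := ⟨fun x => s.1 ⟨x.1, h x.2⟩, fun x => by
    obtain ⟨Y, hY, hx, t, ht⟩ := s.2 ⟨x.1, h x.2⟩
    refine ⟨Y ⊓ W, KSpace.infr, S.mem_inf hx x.2,
      Sc.map f.toRingHom (F.resₗ (hY.trans hV) (KSpace.infl : Y ⊓ W ≤ Y)) t, fun y hy => ?_⟩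
    rw [← LinearMap.comp_apply, ← Sc.map_comp]
    refine (ht y (KSpace.infl hy)).trans ?_
    congr 2
    ext u; exact (F.germ_res _ _ y hy u).symm⟩
  map_zero' := rfl
  map_add' _ _ := rfl

/-- The pullback of `F` along `U × Spec B → U × Spec A`, i.e. `F ⊗_A B`. -/
def pullback : ModSheaf S B U where
  sec V hV := F.pullbackSec f V hV
  comm V hV := ⟨fun r b s => Subtype.ext <| funext fun x => by
    rw [pullbackSec_smulO]
    exact map_smul (Sc.map f.toRingHom (F.stalkAct x.2 r)) b (s.1 x)⟩
  smul_const V hV c s := Subtype.ext <| funext fun x => by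
    rw [pullbackSec_smulO]
    change _ = algebraMap k B c • s.1 x
    generalize s.1 x = t
    refine (Sc.isExtension f.toRingHom).induct (fun t =>
      Sc.map f.toRingHom (F.stalkAct x.2 (algebraMap k (S.O V) c)) t = algebraMap k B c • t)
      (by rw [map_zero, smul_zero]) (fun b m => ?_)
      (fun u v hu hv => by rw [map_add, smul_add, hu, hv]) t
    rw [map_smul, Sc.map_mk, F.stalkAct_const x.2 (hV x.2), Sc.mk_smul, smul_comm]
    congr 1
    exact f.commutes c
  res hV h := F.pullbackRes f hV h
  res_smulO hV h r s := Subtype.ext <| funext fun x => by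
    rw [pullbackSec_smulO, F.stalkAct_res h x.2 (hV (h x.2))]
    rfl
  res_smulA _ _ _ _ := rfl
  res_self _ _ := rfl
  res_res _ _ _ _ := rfl
  exists_unique_glue {V} hV ι W hW hc s hs := by
    have hc' : ∀ x : V, ∃ i, x.1 ∈ W i := fun x => Opens.mem_iSup.1 (hc x.2)
    choose i hi using hc'
    have key : ∀ (x : V) (j : ι) (hj : x.1 ∈ W j),
        (s (i x)).1 ⟨x.1, hi x⟩ = (s j).1 ⟨x.1, hj⟩ := fun x j hj =>
      congrFun (congrArg Subtype.val (hs (i x) j)) ⟨x.1, S.mem_inf (hi x) hj⟩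
    refine ⟨⟨fun x => (s (i x)).1 ⟨x.1, hi x⟩, fun x => ?_⟩, fun j => ?_, fun t ht => ?_⟩
    · obtain ⟨Y, hY, hx, t, ht⟩ := (s (i x)).2 ⟨x.1, hi x⟩
      exact ⟨Y, hY.trans (hW _), hx, t, fun y hy =>
        (key ⟨y, hW _ (hY hy)⟩ (i x) (hY hy)).trans (ht y hy)⟩
    · exact Subtype.ext <| funext fun x => key ⟨x.1, hW j x.2⟩ j x.2
    · exact Subtype.ext <| funext fun x =>
        congrFun (congrArg Subtype.val (ht (i x))) ⟨x.1, hi x⟩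

/-- The canonical morphism from `F` to its pullback. -/
def toPullback : HomOn f F (F.pullback f) U le_rfl le_rfl where
  app V hV :=
    { toFun := fun s => ⟨fun x => Sc.mk f.toRingHom (F.germ hV x.1 x.2 s), fun x =>
        ⟨V, le_rfl, x.2, Sc.mk f.toRingHom s, fun y hy => (Sc.map_mk _ _ _).symm⟩⟩
      map_zero' := Subtype.ext <| funext fun x =>
        (congrArg (Sc.mk f.toRingHom) (map_zero (F.germ hV x.1 x.2))).trans (map_zero _)
      map_add' := fun s t => Subtype.ext <| funext fun x =>
        (congrArg (Sc.mk f.toRingHom) (map_add (F.germ hV x.1 x.2) s t)).trans (map_add _ _ _) }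
  app_smulO V hV r s := Subtype.ext <| funext fun x => by
    change Sc.mk f.toRingHom (F.germ hV x.1 x.2 (r • s)) =
      Sc.map f.toRingHom (F.stalkAct x.2 r) (Sc.mk f.toRingHom (F.germ hV x.1 x.2 s))
    rw [Sc.map_mk]
    have := F.stalkAct_germ hV le_rfl x.2 r s
    rw [S.res_self] at this
    rw [this]
  app_smulA V hV a s := Subtype.ext <| funext fun x => by
    change Sc.mk f.toRingHom (F.germ hV x.1 x.2 (a • s)) = f a • Sc.mk f.toRingHom _
    rw [map_smul, Sc.mk_smul]
    rfl
  app_res hV h s := Subtype.ext <| funext fun x => by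
    change Sc.mk f.toRingHom (F.germ _ x.1 x.2 (F.res _ h s)) = Sc.mk f.toRingHom _
    rw [F.germ_res]

theorem toPullback_app {V : S.Op} (hV : V ≤ U) (s : F.sec V hV) (x : V) :
    ((F.toPullback f).app V hV s).1 x = Sc.mk f.toRingHom (F.germ hV x.1 x.2 s) := rfl

/-- An element of `B ⊗_A F(V)` that vanishes in `B ⊗_A F_x` vanishes near `x`. -/
theorem exists_res_eq_zero {V : S.Op} (hV : V ≤ U) {x : S.X} (hx : x ∈ V)
    (t : Sc f.toRingHom (F.sec V hV)) (h : Sc.map f.toRingHom (F.germ hV x hx) t = 0) :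
    ∃ (W : S.Op) (hW : W ≤ V), x ∈ W ∧ Sc.map f.toRingHom (F.resₗ hV hW) t = 0 := by
  letI : Algebra A B := f.toRingHom.toAlgebra
  let V₀ : Nhd U x := Nhd.mk V hV hx
  have h1 : ∀ t : B ⊗[A] F.sec V₀.op V₀.le, TensorProduct.directLimitRight (F.trans x) B
      (LinearMap.lTensor B (Module.DirectLimit.of A (Nhd U x) _ (F.trans x) V₀) t) =
      Module.DirectLimit.of A (Nhd U x) (fun V : Nhd U x => B ⊗[A] F.sec V.op V.le)
        (fun V W h => LinearMap.lTensor B (F.trans x V W h)) V₀ t := by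
    intro t
    induction t using TensorProduct.induction_on with
    | zero => simp
    | tmul b m => simp
    | add u v hu hv => rw [map_add, map_add, hu, hv, map_add]
  have h2 := h1 t
  rw [show LinearMap.lTensor B (Module.DirectLimit.of A (Nhd U x) _ (F.trans x) V₀) t = 0 from h,
    map_zero] at h2
  obtain ⟨W, hW, h3⟩ := Module.DirectLimit.of.zero_exact h2.symm
  exact ⟨W.op, hW, W.mem, h3⟩

/-- Evaluation of germs of the pullback. -/
theorem exists_eval {x : S.X} (hx : x ∈ U) :
    ∃ ε : (F.pullback f).stalk x →ₗ[B] Sc f.toRingHom (F.stalk x), Function.Bijective ε ∧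
      ∀ (V : S.Op) (hV : V ≤ U) (hxV : x ∈ V) (s : (F.pullback f).sec V hV),
        ε ((F.pullback f).germ hV x hxV s) = s.1 ⟨x, hxV⟩ := by
  let ε : (F.pullback f).stalk x →ₗ[B] Sc f.toRingHom (F.stalk x) :=
    Module.DirectLimit.lift B (Nhd U x) (fun V : Nhd U x => (F.pullback f).sec V.op V.le)
      ((F.pullback f).trans x)
      (fun V => { toFun := fun s => s.1 ⟨x, V.mem⟩
                  map_add' := fun _ _ => rfl
                  map_smul' := fun _ _ => rfl }) (fun _ _ _ _ => rfl)
  have hε : ∀ (V : S.Op) (hV : V ≤ U) (hxV : x ∈ V) (s : (F.pullback f).sec V hV),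
        ε ((F.pullback f).germ hV x hxV s) = s.1 ⟨x, hxV⟩ := fun V hV hxV s =>
    Module.DirectLimit.lift_of (R := B) (G := fun V : Nhd U x => (F.pullback f).sec V.op V.le)
      (f := (F.pullback f).trans x) _ _ (i := Nhd.mk V hV hxV) s
  refine ⟨ε, ⟨?_, ?_⟩, hε⟩
  · rw [injective_iff_map_eq_zero]
    intro t ht
    obtain ⟨V, hV, hxV, s, rfl⟩ := (F.pullback f).exists_germ hx t
    rw [hε] at ht
    obtain ⟨W, hW, hxW, u, hu⟩ := s.2 ⟨x, hxV⟩
    rw [hu x hxW] at ht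
    obtain ⟨Y, hY, hxY, h0⟩ := F.exists_res_eq_zero f _ hxW u ht
    rw [← (F.pullback f).germ_res hV (hY.trans hW) x hxY]
    convert map_zero ((F.pullback f).germ ((hY.trans hW).trans hV) x hxY)
    refine Subtype.ext <| funext fun y => (hu y.1 (hY y.2)).trans ?_
    have e : F.germ (hW.trans hV) y.1 (hY y.2) =
        F.germ (hY.trans (hW.trans hV)) y.1 y.2 ∘ₗ F.resₗ (hW.trans hV) hY := by
      ext v; exact (F.germ_res _ _ y.1 y.2 v).symm
    rw [e, Sc.map_comp, LinearMap.comp_apply, h0, map_zero]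
    rfl
  · intro t
    refine (Sc.isExtension f.toRingHom).induct (fun t => ∃ a, ε a = t) ⟨0, map_zero _⟩
      (fun b m => ?_) ?_ t
    · obtain ⟨V, hV, hxV, s, rfl⟩ := F.exists_germ hx m
      exact ⟨b • (F.pullback f).germ hV x hxV ((F.toPullback f).app V hV s), by
        rw [map_smul, hε, toPullback_app]⟩
    · rintro _ _ ⟨a, rfl⟩ ⟨b, rfl⟩
      exact ⟨a + b, map_add _ _ _⟩

theorem toPullback_isPullback : (F.toPullback f).IsPullback := by
  intro x hx
  obtain ⟨ε, hb, hε⟩ := F.exists_eval f hx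
  let e := LinearEquiv.ofBijective ε hb
  have h1 := isExtension_of_bijective (RingHom.id B) (fun _ => rfl)
    (e.symm.toLinearMap.toAddMonoidHom) (fun b m => e.symm.map_smul b m)
    e.symm.bijective
  refine (Sc.isExtension f.toRingHom).comp h1 (fun _ => rfl) fun t => ?_
  obtain ⟨V, hV, hxV, s, rfl⟩ := F.exists_germ hx t
  rw [(F.toPullback f).stalkMap_germ hV x hxV]
  refine (e.symm_apply_eq.2 ?_).symm
  exact ((hε V hV hxV _).trans (F.toPullback_app f hV s ⟨x, hxV⟩)).symm

end Pullback

end ModSheaf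

/-- Restriction on `O_X ⊗_k A`. -/
def KSpace.resT (S : KSpace k) (A : Type u) [CommRing A] [Algebra k A] {V W : S.Op} (h : W ≤ V) :
    S.O V ⊗[k] A →ₐ[k] S.O W ⊗[k] A :=
  Algebra.TensorProduct.map (S.resₐ h) (AlgHom.id k A)

/-- The map `O(V) ⊗_k A → O(V) ⊗_k B` induced by `f : A → B`. -/
def KSpace.mapT (S : KSpace k) {A B : Type u} [CommRing A] [Algebra k A] [CommRing B] [Algebra k B]
    (f : A →ₐ[k] B) (V : S.Op) : S.O V ⊗[k] A →ₐ[k] S.O V ⊗[k] B :=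
  Algebra.TensorProduct.map (AlgHom.id k (S.O V)) f

theorem KSpace.resT_self (S : KSpace k) {A : Type u} [CommRing A] [Algebra k A] {V : S.Op}
    (c : S.O V ⊗[k] A) : S.resT A le_rfl c = c := by
  induction c using TensorProduct.induction_on with
  | zero => simp
  | tmul r a => simp [resT]
  | add u v hu hv => rw [map_add, hu, hv]

theorem KSpace.resT_resT (S : KSpace k) {A : Type u} [CommRing A] [Algebra k A] {V W Y : S.Op}
    (h : W ≤ V) (h' : Y ≤ W) (c : S.O V ⊗[k] A) :
    S.resT A h' (S.resT A h c) = S.resT A (h'.trans h) c := by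
  induction c using TensorProduct.induction_on with
  | zero => simp
  | tmul r a => simp [resT, S.res_res]
  | add u v hu hv => rw [map_add, map_add, hu, hv, map_add]

theorem KSpace.resT_mapT (S : KSpace k) {A B : Type u} [CommRing A] [Algebra k A] [CommRing B]
    [Algebra k B] (f : A →ₐ[k] B) {V W : S.Op} (h : W ≤ V) (c : S.O V ⊗[k] A) :
    S.resT B h (S.mapT f V c) = S.mapT f W (S.resT A h c) := by
  induction c using TensorProduct.induction_on with
  | zero => simp
  | tmul r a => simp [resT, mapT]
  | add u v hu hv => rw [map_add, map_add, hu, hv, map_add, map_add]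

/-- Finitely many properties that hold near `x` hold on a common neighbourhood of `x`. -/
theorem KSpace.exists_common (S : KSpace k) {x : S.X} {V : S.Op} (hx : x ∈ V) {n : ℕ}
    (P : Fin n → ∀ W : S.Op, W ≤ V → Prop)
    (mono : ∀ i W (hW : W ≤ V) W' (h : W' ≤ W), P i W hW → P i W' (h.trans hW))
    (h : ∀ i, ∃ (W : S.Op) (hW : W ≤ V), x ∈ W ∧ P i W hW) :
    ∃ (W : S.Op) (hW : W ≤ V), x ∈ W ∧ ∀ i, P i W hW := by
  induction n with
  | zero => exact ⟨V, le_rfl, hx, fun i => i.elim0⟩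
  | succ n ih =>
    obtain ⟨W, hW, hxW, hP⟩ := ih (fun i => P i.succ) (fun i => mono i.succ) (fun i => h i.succ)
    obtain ⟨W', hW', hxW', hP'⟩ := h 0
    refine ⟨W ⊓ W', KSpace.infl.trans hW, S.mem_inf hxW hxW', fun i => ?_⟩
    refine Fin.cases ?_ (fun i => ?_) i
    · exact mono 0 W' hW' _ KSpace.infr hP'
    · exact mono _ W hW _ KSpace.infl (hP i)

namespace ModSheaf

variable {S : KSpace k} {A B : Type u} [CommRing A] [CommRing B]
variable [Algebra k A] [Algebra k B] {U U' : S.Op}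

/-- The action of `O(V) ⊗_k A` on the sections over `V`. -/
def tact (F : ModSheaf S A U) {V : S.Op} (hV : V ≤ U) :
    S.O V ⊗[k] A →+ F.sec V hV →+ F.sec V hV :=
  TensorProduct.liftAddHom
    (AddMonoidHom.mk' (fun r => AddMonoidHom.mk'
      (fun a => (DistribSMul.toAddMonoidHom (F.sec V hV) r).comp
        (DistribSMul.toAddMonoidHom (F.sec V hV) a))
      (fun a b => by ext s; simp [add_smul])) (fun r r' => by ext a s; simp [add_smul]))
    (fun c r a => by
      ext s
      change (c • r) • a • s = r • (c • a) • s
      rw [Algebra.smul_def, mul_comm, mul_smul, Algebra.smul_def, mul_smul, F.smul_const])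

@[simp] theorem tact_tmul (F : ModSheaf S A U) {V : S.Op} (hV : V ≤ U) (r : S.O V) (a : A)
    (s : F.sec V hV) : F.tact hV (r ⊗ₜ a) s = r • a • s := rfl

theorem tact_mul (F : ModSheaf S A U) {V : S.Op} (hV : V ≤ U) (c d : S.O V ⊗[k] A)
    (s : F.sec V hV) : F.tact hV (c * d) s = F.tact hV c (F.tact hV d s) := by
  induction c using TensorProduct.induction_on with
  | zero => simp
  | add u v hu hv => rw [add_mul, map_add, AddMonoidHom.add_apply, hu, hv, map_add,
      AddMonoidHom.add_apply]
  | tmul r a =>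
    induction d using TensorProduct.induction_on with
    | zero => simp
    | add u v hu hv => rw [mul_add, map_add, AddMonoidHom.add_apply, hu, hv, map_add,
        AddMonoidHom.add_apply, map_add]
    | tmul r' a' =>
      rw [Algebra.TensorProduct.tmul_mul_tmul, tact_tmul, tact_tmul, tact_tmul, mul_smul, mul_smul,
        smul_comm r' a]

theorem res_tact (F : ModSheaf S A U) {V W : S.Op} (hV : V ≤ U) (h : W ≤ V) (c : S.O V ⊗[k] A)
    (s : F.sec V hV) :
    F.res hV h (F.tact hV c s) = F.tact (h.trans hV) (S.resT A h c) (F.res hV h s) := by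
  induction c using TensorProduct.induction_on with
  | zero => simp
  | add u v hu hv => rw [map_add, AddMonoidHom.add_apply, map_add, hu, hv, map_add, map_add,
      AddMonoidHom.add_apply]
  | tmul r a => rw [tact_tmul, F.res_smulO, F.res_smulA]; rfl

theorem HomOn.app_tact {F : ModSheaf S A U} {G : ModSheaf S B U'} {W : S.Op} {hF : W ≤ U}
    {hG : W ≤ U'} {f : A →ₐ[k] B} (φ : HomOn f F G W hF hG) {V : S.Op} (hV : V ≤ W)
    (c : S.O V ⊗[k] A) (s : F.sec V (hV.trans hF)) :
    φ.app V hV (F.tact (hV.trans hF) c s) =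
      G.tact (hV.trans hG) (S.mapT f V c) (φ.app V hV s) := by
  induction c using TensorProduct.induction_on with
  | zero => simp
  | add u v hu hv => rw [map_add, AddMonoidHom.add_apply, map_add, hu, hv, map_add, map_add,
      AddMonoidHom.add_apply]
  | tmul r a => rw [tact_tmul, φ.app_smulO, φ.app_smulA]; rfl

/-- `F` is a locally free `O_U`-module of finite rank: locally there are finitely many sections
`s₁, …, s_n` that induce an isomorphism `O^n ≅ F`. -/
def IsLocallyFree (F : ModSheaf S k U) : Prop :=
  ∀ x ∈ U, ∃ (W : S.Op) (hW : W ≤ U), x ∈ W ∧ ∃ (n : ℕ) (s : Fin n → F.sec W hW),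
    ∀ (V : S.Op) (hV : V ≤ W), Function.Bijective
      (fun c : Fin n → S.O V => ∑ i, c i • F.res hW hV (s i))

/-- `F` is a coherent `O_U ⊗_k A`-module, in the form of local finite presentation: locally there
is an exact sequence `(O ⊗_k A)^p → (O ⊗_k A)^q → F → 0` of sheaves.  When `O ⊗_k A` is a coherent
sheaf of rings (for instance on locally Noetherian schemes and on complex manifolds, if `A` is
finite-dimensional), these are exactly the coherent sheaves. -/
def IsCoherent (F : ModSheaf S A U) : Prop :=
  ∀ x ∈ U, ∃ (W : S.Op) (hW : W ≤ U), x ∈ W ∧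
    ∃ (q p : ℕ) (s : Fin q → F.sec W hW) (r : Fin p → Fin q → S.O W ⊗[k] A),
      (∀ j, ∑ i, F.tact hW (r j i) (s i) = 0) ∧
      (∀ (V : S.Op) (hV : V ≤ W) (t : F.sec V (hV.trans hW)), ∀ y ∈ V,
        ∃ (Y : S.Op) (hY : Y ≤ V), y ∈ Y ∧ ∃ c : Fin q → S.O Y ⊗[k] A,
          F.res (hV.trans hW) hY t =
            ∑ i, F.tact (hY.trans (hV.trans hW)) (c i) (F.res hW (hY.trans hV) (s i))) ∧
      (∀ (V : S.Op) (hV : V ≤ W) (c : Fin q → S.O V ⊗[k] A),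
        ∑ i, F.tact (hV.trans hW) (c i) (F.res hW hV (s i)) = 0 → ∀ y ∈ V,
          ∃ (Y : S.Op) (hY : Y ≤ V), y ∈ Y ∧ ∃ d : Fin p → S.O Y ⊗[k] A,
            ∀ i, S.resT A hY (c i) = ∑ j, d j * S.resT A (hY.trans hV) (r j i))

/-- The element of `B ⊗_A F(V)` given by `O(V) ⊗_k B` acting on `1 ⊗ s`. -/
def tlift (f : A →ₐ[k] B) (F : ModSheaf S A U) {V : S.Op} (hV : V ≤ U) (s : F.sec V hV) :
    S.O V ⊗[k] B →+ Sc f.toRingHom (F.sec V hV) :=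
  TensorProduct.liftAddHom
    (AddMonoidHom.mk' (fun r => AddMonoidHom.mk' (fun b => b • Sc.mk f.toRingHom (r • s))
      (fun a b => add_smul _ _ _)) (fun r r' => by
        ext b
        change b • Sc.mk f.toRingHom ((r + r') • s) = _ + _
        rw [add_smul, map_add, smul_add]
        rfl))
    (fun c r b => by
      change b • Sc.mk f.toRingHom ((c • r) • s) = (c • b) • Sc.mk f.toRingHom (r • s)
      rw [Algebra.smul_def, mul_smul, F.smul_const, Sc.mk_smul, smul_smul, Algebra.smul_def,
        mul_comm]
      congr 2
      exact f.commutes c)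

theorem tlift_tmul (f : A →ₐ[k] B) (F : ModSheaf S A U) {V : S.Op} (hV : V ≤ U)
    (s : F.sec V hV) (r : S.O V) (b : B) :
    F.tlift f hV s (r ⊗ₜ b) = b • Sc.mk f.toRingHom (r • s) := rfl

theorem map_germ_tlift (f : A →ₐ[k] B) (F : ModSheaf S A U) {V : S.Op} (hV : V ≤ U)
    (s : F.sec V hV) (c : S.O V ⊗[k] B) (y : V) :
    Sc.map f.toRingHom (F.germ hV y.1 y.2) (F.tlift f hV s c) =
      ((F.pullback f).tact hV c ((F.toPullback f).app V hV s)).1 y := by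
  induction c using TensorProduct.induction_on with
  | zero => rw [map_zero, map_zero, map_zero]; rfl
  | add u v hu hv => rw [map_add, map_add, hu, hv, map_add]; rfl
  | tmul r b =>
    rw [tlift_tmul, map_smul, Sc.map_mk, tact_tmul, smul_comm, ← (F.toPullback f).app_smulO]
    rfl

theorem map_res_tlift (f : A →ₐ[k] B) (F : ModSheaf S A U) {V W : S.Op} (hV : V ≤ U) (h : W ≤ V)
    (s : F.sec V hV) (c : S.O V ⊗[k] B) :
    Sc.map f.toRingHom (F.resₗ hV h) (F.tlift f hV s c) =
      F.tlift f (h.trans hV) (F.res hV h s) (S.resT B h c) := by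
  induction c using TensorProduct.induction_on with
  | zero => rw [map_zero, map_zero, map_zero, map_zero]
  | add u v hu hv => rw [map_add, map_add, hu, hv, map_add, map_add]
  | tmul r b =>
    rw [tlift_tmul, map_smul, Sc.map_mk, resₗ_apply, F.res_smulO]
    rfl

theorem IsCoherent.pullback [Module.Finite k B] {F : ModSheaf S A U} (hF : F.IsCoherent)
    (f : A →ₐ[k] B) : (F.pullback f).IsCoherent := by
  intro x hx
  obtain ⟨W, hW, hxW, q, p, s, r, rel, gen, ker⟩ := hF x hx
  refine ⟨W, hW, hxW, q, p, fun i => (F.toPullback f).app W hW (s i),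
    fun j i => S.mapT f W (r j i), fun j => ?_, ?_, ?_⟩
  · have := congrArg ((F.toPullback f).app W hW) (rel j)
    rw [map_zero, map_sum] at this
    rw [← this]
    exact Finset.sum_congr rfl fun i _ => ((F.toPullback f).app_tact hW _ _).symm
  · intro V hV t y hy
    obtain ⟨Y, hY, hyY, τ, hτ⟩ := t.2 ⟨y, hy⟩
    have claim : ∀ τ : Sc f.toRingHom (F.sec Y (hY.trans (hV.trans hW))),
        ∃ (Z : S.Op) (hZ : Z ≤ Y), y ∈ Z ∧ ∃ c : Fin q → S.O Z ⊗[k] B,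
        ∀ z : Z, Sc.map f.toRingHom (F.germ _ z.1 (hZ z.2)) τ =
          (∑ i, (F.pullback f).tact (hZ.trans (hY.trans (hV.trans hW))) (c i)
            ((F.pullback f).res hW (hZ.trans (hY.trans hV))
              ((F.toPullback f).app W hW (s i)))).1 z := by
      intro τ
      refine (Sc.isExtension f.toRingHom).induct (fun τ =>
        ∃ (Z : S.Op) (hZ : Z ≤ Y), y ∈ Z ∧ ∃ c : Fin q → S.O Z ⊗[k] B,
        ∀ z : Z, Sc.map f.toRingHom (F.germ _ z.1 (hZ z.2)) τ =
          (∑ i, (F.pullback f).tact (hZ.trans (hY.trans (hV.trans hW))) (c i)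
            ((F.pullback f).res hW (hZ.trans (hY.trans hV))
              ((F.toPullback f).app W hW (s i)))).1 z) ?_ ?_ ?_ τ
      · refine ⟨Y, le_rfl, hyY, 0, fun z => ?_⟩
        rw [map_zero, Finset.sum_eq_zero]
        · rfl
        · intro i _
          rw [Pi.zero_apply, map_zero]
          rfl
      · intro b m
        obtain ⟨Z, hZ, hyZ, c, hc⟩ := gen Y (hY.trans hV) m y hyY
        refine ⟨Z, hZ, hyZ, fun i => (1 ⊗ₜ b) * S.mapT f Z (c i), fun z => ?_⟩
        have e : (∑ i, (F.pullback f).tact (hZ.trans (hY.trans (hV.trans hW)))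
            ((1 ⊗ₜ b) * S.mapT f Z (c i)) ((F.pullback f).res hW (hZ.trans (hY.trans hV))
              ((F.toPullback f).app W hW (s i)))) =
            b • (F.toPullback f).app Z (hZ.trans (hY.trans (hV.trans hW)))
              (F.res _ hZ m) := by
          rw [hc, map_sum, Finset.smul_sum]
          refine Finset.sum_congr rfl fun i _ => ?_
          rw [tact_mul, tact_tmul, one_smul, ← (F.toPullback f).app_res,
            ← (F.toPullback f).app_tact]
        rw [e, map_smul, Sc.map_mk, ← F.germ_res _ hZ z.1 z.2]
        rfl
      · rintro τ τ' ⟨Z, hZ, hyZ, c, hc⟩ ⟨Z', hZ', hyZ', c', hc'⟩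
        refine ⟨Z ⊓ Z', KSpace.infl.trans hZ, S.mem_inf hyZ hyZ',
          fun i => S.resT B (KSpace.infl : Z ⊓ Z' ≤ Z) (c i) +
            S.resT B (KSpace.infr : Z ⊓ Z' ≤ Z') (c' i), fun z => ?_⟩
        rw [map_add, hc ⟨z.1, KSpace.infl z.2⟩, hc' ⟨z.1, KSpace.infr z.2⟩]
        have e1 := congrArg (fun u => u.1 z) (map_sum ((F.pullback f).res
          (hZ.trans (hY.trans (hV.trans hW))) (KSpace.infl : Z ⊓ Z' ≤ Z)) (fun i =>
            (F.pullback f).tact (hZ.trans (hY.trans (hV.trans hW))) (c i)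
            ((F.pullback f).res hW (hZ.trans (hY.trans hV))
              ((F.toPullback f).app W hW (s i)))) Finset.univ)
        have e2 := congrArg (fun u => u.1 z) (map_sum ((F.pullback f).res
          (hZ'.trans (hY.trans (hV.trans hW))) (KSpace.infr : Z ⊓ Z' ≤ Z')) (fun i =>
            (F.pullback f).tact (hZ'.trans (hY.trans (hV.trans hW))) (c' i)
            ((F.pullback f).res hW (hZ'.trans (hY.trans hV))
              ((F.toPullback f).app W hW (s i)))) Finset.univ)
        refine (congrArg₂ (· + ·) e1 e2).trans ?_
        simp only [res_tact, ModSheaf.res_res, map_add, AddMonoidHom.add_apply,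
          Finset.sum_add_distrib]
        rfl
    obtain ⟨Z, hZ, hyZ, c, hc⟩ := claim τ
    refine ⟨Z, hZ.trans hY, hyZ, c, Subtype.ext <| funext fun z => ?_⟩
    exact (hτ z.1 (hZ z.2)).trans (hc z)
  · intro V hV c hc y hy
    have h0 : Sc.map f.toRingHom (F.germ (hV.trans hW) y hy)
        (∑ i, F.tlift f (hV.trans hW) (F.res hW hV (s i)) (c i)) = 0 := by
      rw [map_sum]
      let ev : (F.pullback f).sec V (hV.trans hW) →+ Sc f.toRingHom (F.stalk y) :=
        { toFun := fun u => u.1 ⟨y, hy⟩, map_zero' := rfl, map_add' := fun _ _ => rfl }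
      have h0 := congrArg ev hc
      rw [map_zero, map_sum] at h0
      refine Eq.trans (Finset.sum_congr rfl fun i _ => ?_) h0
      rw [map_germ_tlift f F _ _ _ ⟨y, hy⟩, (F.toPullback f).app_res]
      rfl
    obtain ⟨Y, hY, hyY, h1⟩ := F.exists_res_eq_zero f _ hy _ h0
    rw [map_sum] at h1
    simp only [map_res_tlift, F.res_res] at h1
    have hYW := hY.trans (hV.trans hW)
    -- expand the coefficients in a basis of `B`
    let b := Module.finBasis k B
    have hcoef : ∀ i, ∃ o : Fin (Module.finrank k B) → S.O Y,
        S.resT B hY (c i) = ∑ l, o l ⊗ₜ[k] b l := by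
      intro i
      induction S.resT B hY (c i) using TensorProduct.induction_on with
      | zero => exact ⟨0, by simp⟩
      | tmul o β =>
        refine ⟨fun l => b.repr β l • o, ?_⟩
        conv_lhs => rw [← b.sum_repr β, TensorProduct.tmul_sum]
        exact Finset.sum_congr rfl fun l _ => by rw [TensorProduct.smul_tmul]
      | add u v hu hv =>
        obtain ⟨o, ho⟩ := hu
        obtain ⟨o', ho'⟩ := hv
        exact ⟨o + o', by simp [ho, ho', TensorProduct.add_tmul, Finset.sum_add_distrib]⟩
    choose o ho using hcoef
    letI : Algebra A B := f.toRingHom.toAlgebra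
    haveI : IsScalarTower k A B := IsScalarTower.of_algebraMap_eq fun c => (f.commutes c).symm
    let n : Fin (Module.finrank k B) → F.sec Y hYW := fun l =>
      ∑ i, o i l • F.res hW (hY.trans hV) (s i)
    have h2 : ∑ l, b l ⊗ₜ[A] n l = (0 : B ⊗[A] F.sec Y hYW) := by
      rw [← show _ = (0 : B ⊗[A] F.sec Y hYW) from h1]
      simp only [n, TensorProduct.tmul_sum]
      rw [Finset.sum_comm]
      refine Finset.sum_congr rfl fun i _ => ?_
      rw [ho i, map_sum]
      refine Finset.sum_congr rfl fun l _ => ?_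
      rw [tlift_tmul]
      change _ = b l • ((1 : B) ⊗ₜ[A] _)
      rw [TensorProduct.smul_tmul', smul_eq_mul, mul_one]
    have hspan : Submodule.span A (Set.range b) = ⊤ := by
      rw [eq_top_iff, ← Submodule.restrictScalars_le (S := k)]
      refine le_trans ?_ (Submodule.span_le_restrictScalars k A _)
      rw [b.span_eq]
      exact le_top
    obtain ⟨N, a, w, hw, hab⟩ := TensorProduct.vanishesTrivially_of_sum_tmul_eq_zero A hspan h2
    obtain ⟨Z, hZ, hyZ, hgen⟩ := S.exists_common hyY (fun (j : Fin N) Z hZ =>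
      ∃ e : Fin q → S.O Z ⊗[k] A, F.res hYW hZ (w j) =
        ∑ i, F.tact (hZ.trans hYW) (e i) (F.res hW (hZ.trans (hY.trans hV)) (s i)))
      (by
        rintro j Z hZ Z' h ⟨e, he⟩
        refine ⟨fun i => S.resT A h (e i), ?_⟩
        rw [← F.res_res hYW hZ h, he, map_sum]
        exact Finset.sum_congr rfl fun i _ => by rw [F.res_tact, F.res_res])
      (fun j => gen Y (hY.trans hV) (w j) y hyY)
    choose e he using hgen
    have hZW := hZ.trans hYW
    -- relations over `A`
    let ρ : Fin (Module.finrank k B) → Fin q → S.O Z ⊗[k] A := fun l i =>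
      (S.res hZ (o i l)) ⊗ₜ[k] (1 : A) - ∑ j, ((1 : S.O Z) ⊗ₜ[k] a l j) * e j i
    have hρ : ∀ l, ∑ i, F.tact hZW (ρ l i) (F.res hW (hZ.trans (hY.trans hV)) (s i)) = 0 := by
      intro l
      have h3 := congrArg (F.res hYW hZ) (hw l)
      simp only [n, map_sum, F.res_smulO, F.res_smulA, F.res_res, he, Finset.smul_sum] at h3
      simp only [ρ, map_sub, map_sum, AddMonoidHom.sub_apply, AddMonoidHom.finsetSum_apply,
        tact_tmul, one_smul, tact_mul, Finset.sum_sub_distrib]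
      rw [h3, Finset.sum_comm, sub_self]
    obtain ⟨Z', hZ', hyZ', hker⟩ := S.exists_common hyZ (fun l Z' hZ' =>
      ∃ d : Fin p → S.O Z' ⊗[k] A, ∀ i, S.resT A hZ' (ρ l i) =
        ∑ j, d j * S.resT A (hZ'.trans (hZ.trans (hY.trans hV))) (r j i))
      (by
        rintro l Z₁ hZ₁ Z₂ h ⟨d, hd⟩
        refine ⟨fun j => S.resT A h (d j), fun i => ?_⟩
        rw [← S.resT_resT hZ₁ h, hd, map_sum]
        exact Finset.sum_congr rfl fun j _ => by rw [map_mul, S.resT_resT])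
      (fun l => ker Z (hZ.trans (hY.trans hV)) (ρ l) (hρ l) y hyZ)
    choose d hd using hker
    refine ⟨Z', hZ'.trans (hZ.trans hY), hyZ',
      fun j => ∑ l, ((1 : S.O Z') ⊗ₜ[k] b l) * S.mapT f Z' (d l j), fun i => ?_⟩
    have h4 : ∀ l, (S.res (hZ'.trans hZ) (o i l)) ⊗ₜ[k] (1 : B) =
        ∑ j, ((1 : S.O Z') ⊗ₜ[k] f (a l j)) * S.mapT f Z' (S.resT A hZ' (e j i)) +
        ∑ j, S.mapT f Z' (d l j) *
          S.mapT f Z' (S.resT A (hZ'.trans (hZ.trans (hY.trans hV))) (r j i)) := by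
      intro l
      have h5 := congrArg (S.mapT f Z') (hd l i)
      simp only [ρ, map_sub, map_sum, map_mul] at h5
      rw [sub_eq_iff_eq_add, add_comm] at h5
      refine Eq.trans ?_ (h5.trans ?_)
      · simp [KSpace.resT, KSpace.mapT, S.res_res]
      · simp [KSpace.resT, KSpace.mapT]
    have h6 : S.resT B (hZ'.trans (hZ.trans hY)) (c i) =
        ∑ l, ((1 : S.O Z') ⊗ₜ[k] b l) * ((S.res (hZ'.trans hZ) (o i l)) ⊗ₜ[k] (1 : B)) := by
      rw [← S.resT_resT hY (hZ'.trans hZ), ho i, map_sum]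
      exact Finset.sum_congr rfl fun l _ => by simp [KSpace.resT]
    rw [h6]
    simp only [h4, mul_add, Finset.sum_add_distrib, Finset.mul_sum, Finset.sum_mul]
    have h7 : ∑ l, ∑ j, ((1 : S.O Z') ⊗ₜ[k] b l) * (((1 : S.O Z') ⊗ₜ[k] f (a l j)) *
        S.mapT f Z' (S.resT A hZ' (e j i))) = 0 := by
      rw [Finset.sum_comm]
      refine Finset.sum_eq_zero fun j _ => ?_
      have h8 : ∑ l, ((1 : S.O Z') ⊗ₜ[k] b l) * ((1 : S.O Z') ⊗ₜ[k] f (a l j)) = 0 := by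
        simp only [Algebra.TensorProduct.tmul_mul_tmul, one_mul]
        rw [← TensorProduct.tmul_sum]
        have : ∑ l, b l * f (a l j) = 0 := by
          rw [← hab j]
          exact Finset.sum_congr rfl fun l _ => mul_comm _ _
        rw [this, TensorProduct.tmul_zero]
      simp only [← mul_assoc]
      rw [← Finset.sum_mul, h8, zero_mul]
    rw [h7, zero_add, Finset.sum_comm]
    refine Finset.sum_congr rfl fun j _ => Finset.sum_congr rfl fun l _ => ?_
    rw [S.resT_mapT, mul_assoc]

end ModSheaf

namespace ModSheaf

variable {S : KSpace k} {A B : Type u} [CommRing A] [CommRing B]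
variable [Algebra k A] [Algebra k B] {U U' : S.Op}

namespace HomOn

/-- The identity. -/
def id (F : ModSheaf S A U) {W : S.Op} (h : W ≤ U) : HomOn (AlgHom.id k A) F F W h h where
  app _ _ := AddMonoidHom.id _
  app_smulO _ _ _ _ := rfl
  app_smulA _ _ _ _ := rfl
  app_res _ _ _ := rfl

/-- Multiplication of a morphism by a function. -/
def smul {f : A →ₐ[k] B} {F : ModSheaf S A U} {G : ModSheaf S B U'} {W : S.Op} {hF : W ≤ U}
    {hG : W ≤ U'} (r : S.O W) (φ : HomOn f F G W hF hG) : HomOn f F G W hF hG where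
  app V hV := (DistribSMul.toAddMonoidHom (G.sec V (hV.trans hG)) (S.res hV r)).comp (φ.app V hV)
  app_smulO V hV r' s := by
    change S.res hV r • φ.app V hV (r' • s) = r' • S.res hV r • φ.app V hV s
    rw [φ.app_smulO, smul_comm]
  app_smulA V hV a s := by
    change S.res hV r • φ.app V hV (a • s) = f a • S.res hV r • φ.app V hV s
    rw [φ.app_smulA, smul_comm]
  app_res {V V'} hV h s := by
    change S.res (h.trans hV) r • φ.app V' _ (F.res _ h s) =
      G.res _ h (S.res hV r • φ.app V hV s)
    rw [φ.app_res, G.res_smulO, S.res_res]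

theorem IsPullback.isIso {F : ModSheaf S A U} {G : ModSheaf S A U'} {W : S.Op} {hF : W ≤ U}
    {hG : W ≤ U'} {φ : HomOn (AlgHom.id k A) F G W hF hG} (hφ : φ.IsPullback) : φ.IsIso := by
  obtain ⟨θ, hθ⟩ := hφ.exists_desc (g := AlgHom.id k A) (HomOn.id F hF) (fun _ => rfl)
  have h2 : (φ.comp θ (fun _ => rfl) : HomOn (AlgHom.id k A) G G W hG hG) = HomOn.id G hG :=
    hφ.hom_ext fun V hV s => congrArg (φ.app V hV) (hθ V hV s)
  intro V hV
  refine ⟨Function.LeftInverse.injective (g := θ.app V hV) (hθ V hV), fun t => ⟨θ.app V hV t, ?_⟩⟩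
  have h3 : (φ.comp θ (fun _ => rfl) : HomOn (AlgHom.id k A) G G W hG hG).app V hV t =
    (HomOn.id G hG).app V hV t := by rw [h2]
  exact h3

end HomOn

/-- `H¹(U, F) = 0`: for every open cover of `U`, every Čech 1-cocycle of `F` is a coboundary. -/
def H1Vanishes (F : ModSheaf S A U) : Prop :=
  ∀ (ι : Type u) (W : ι → S.Op) (hW : ∀ a, W a ≤ U), U ≤ ⨆ a, W a →
    ∀ z : ∀ a b, F.sec (W a ⊓ W b) (KSpace.infl.trans (hW a)),
      (∀ (a b c : ι) (V : S.Op) (ha : V ≤ W a) (hb : V ≤ W b) (hc : V ≤ W c),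
        F.res (KSpace.infl.trans (hW b)) (le_inf hb hc) (z b c) -
          F.res (KSpace.infl.trans (hW a)) (le_inf ha hc) (z a c) +
          F.res (KSpace.infl.trans (hW a)) (le_inf ha hb) (z a b) = 0) →
      ∃ y : ∀ a, F.sec (W a) (hW a), ∀ a b,
        z a b = F.res (hW b) KSpace.infr (y b) - F.res (hW a) KSpace.infl (y a)

end ModSheaf

/-- An open subset `U` is Stein if `H¹(U, F) = 0` for every coherent sheaf of `O_U`-modules `F`.
For complex manifolds (and complex spaces) with countable topology this is the definition of Stein
spaces by the validity of Theorem B, in the form that only asks for the vanishing of `H¹`. -/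
def KSpace.IsStein (S : KSpace k) (U : S.Op) : Prop :=
  ∀ F : ModSheaf S k U, F.IsCoherent → F.H1Vanishes

/-- Local Artinian `k`-algebras with residue field `k`. -/
structure ArtAlg (k : Type u) [Field k] where
  /-- the underlying type -/
  carrier : Type u
  [ring : CommRing carrier]
  [alg : Algebra k carrier]
  [loc : IsLocalRing carrier]
  [fin : Module.Finite k carrier]
  residue : Function.Bijective (algebraMap k (IsLocalRing.ResidueField carrier))

namespace ArtAlg

attribute [instance] ring alg loc fin

instance : CategoryTheory.Category (ArtAlg k) where
  Hom A B := A.carrier →ₐ[k] B.carrier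
  id A := AlgHom.id k A.carrier
  comp f g := g.comp f

/-- The projection `A → A/𝔪_A = k`. -/
def aug (A : ArtAlg k) : A.carrier →ₐ[k] k :=
  ((AlgEquiv.ofBijective (Algebra.ofId k (IsLocalRing.ResidueField A.carrier))
    A.residue).symm : IsLocalRing.ResidueField A.carrier →ₐ[k] k).comp
      (IsScalarTower.toAlgHom k A.carrier (IsLocalRing.ResidueField A.carrier))

theorem aug_eq_zero_iff (A : ArtAlg k) (a : A.carrier) :
    A.aug a = 0 ↔ a ∈ IsLocalRing.maximalIdeal A.carrier := by
  rw [← IsLocalRing.residue_eq_zero_iff]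
  change (AlgEquiv.ofBijective (Algebra.ofId k (IsLocalRing.ResidueField A.carrier))
    A.residue).symm (IsLocalRing.residue A.carrier a) = 0 ↔ _
  exact map_eq_zero_iff _ (AlgEquiv.injective _)

instance (A : ArtAlg k) : IsArtinianRing A.carrier := IsArtinianRing.of_finite k A.carrier

theorem isNilpotent_maximalIdeal (A : ArtAlg k) :
    IsNilpotent (IsLocalRing.maximalIdeal A.carrier) := by
  rw [← IsLocalRing.jacobson_eq_maximalIdeal ⊥ bot_ne_top]
  exact IsArtinianRing.isNilpotent_jacobson_bot

theorem aug_map {A B : ArtAlg k} (f : A.carrier →ₐ[k] B.carrier) (a : A.carrier) :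
    A.aug a = B.aug (f a) := by
  have h1 : a - algebraMap k _ (A.aug a) ∈ IsLocalRing.maximalIdeal A.carrier := by
    rw [← aug_eq_zero_iff, map_sub, AlgHom.commutes, Algebra.algebraMap_self_apply, sub_self]
  obtain ⟨n, hn⟩ := A.isNilpotent_maximalIdeal
  have h2 : (a - algebraMap k _ (A.aug a)) ^ n = 0 := by
    have := Ideal.pow_mem_pow h1 n
    rwa [hn] at this
  have h3 : B.aug (f (a - algebraMap k _ (A.aug a))) = 0 := by
    refine eq_zero_of_pow_eq_zero (n := n) ?_
    rw [← map_pow, ← map_pow, h2, map_zero, map_zero]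
  rw [map_sub, map_sub, AlgHom.commutes, AlgHom.commutes, Algebra.algebraMap_self_apply,
    sub_eq_zero] at h3
  exact h3.symm

theorem map_mem {A B : ArtAlg k} (f : A.carrier →ₐ[k] B.carrier) {a : A.carrier}
    (h : a ∈ IsLocalRing.maximalIdeal A.carrier) : f a ∈ IsLocalRing.maximalIdeal B.carrier := by
  rw [← aug_eq_zero_iff] at h ⊢
  rw [← aug_map, h]

end ArtAlg

/-- Čech 2-cocycles of invertible functions. -/
structure Cocycle2 (S : KSpace k) {I : Type u} (U : I → S.Op) where
  /-- the functions `α_ijl` -/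
  val : ∀ i j l, (S.O (U i ⊓ U j ⊓ U l))ˣ
  cocycle : ∀ (i j l m : I) (V : S.Op) (hi : V ≤ U i) (hj : V ≤ U j) (hl : V ≤ U l) (hm : V ≤ U m),
    S.res (le_inf (le_inf hj hl) hm) (val j l m).1 * S.res (le_inf (le_inf hi hj) hm) (val i j m).1 =
      S.res (le_inf (le_inf hi hl) hm) (val i l m).1 *
        S.res (le_inf (le_inf hi hj) hl) (val i j l).1

/-- An `(α, U)`-twisted sheaf: sheaves of modules `E_i` on `U_i` and isomorphisms
`g_ij : E_i → E_j` over `U_i ∩ U_j` with `g_ii = id`, `g_ji = g_ij⁻¹` such that the composite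
`E_i → E_j → E_l → E_i` is multiplication by `α_ijl`. -/
structure TwistedSheaf (S : KSpace k) {I : Type u} (U : I → S.Op) (α : Cocycle2 S U) where
  /-- the sheaves -/
  sheaf : ∀ i, ModSheaf S k (U i)
  /-- the gluing isomorphisms -/
  g : ∀ i j, ModSheaf.HomOn (AlgHom.id k k) (sheaf i) (sheaf j) (U i ⊓ U j) KSpace.infl KSpace.infr
  g_self : ∀ (i : I) (V : S.Op) (hi : V ≤ U i) (s : (sheaf i).sec V hi),
    (g i i).app V (le_inf hi hi) s = s
  g_symm : ∀ (i j : I) (V : S.Op) (hi : V ≤ U i) (hj : V ≤ U j) (s : (sheaf i).sec V hi),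
    (g j i).app V (le_inf hj hi) ((g i j).app V (le_inf hi hj) s) = s
  g_cocycle : ∀ (i j l : I) (V : S.Op) (hi : V ≤ U i) (hj : V ≤ U j) (hl : V ≤ U l)
    (s : (sheaf i).sec V hi),
    (g l i).app V (le_inf hl hi) ((g j l).app V (le_inf hj hl) ((g i j).app V (le_inf hi hj) s)) =
      S.res (le_inf (le_inf hi hj) hl) (α.val i j l).1 • s

variable {S : KSpace k} {I : Type u} {U : I → S.Op} {α : Cocycle2 S U}

/-- An `(α, U)`-deformation of the twisted sheaf `E` over `A`. -/
structure Deformation (E : TwistedSheaf S U α) (A : ArtAlg k) where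
  /-- sheaves on `U_i × Spec A` -/
  F : ∀ i, ModSheaf S A.carrier (U i)
  coherent : ∀ i, (F i).IsCoherent
  flat : ∀ i, ∀ x ∈ U i, Module.Flat A.carrier ((F i).stalk x)
  /-- the morphisms to the sheaves `E_i` -/
  h : ∀ i, ModSheaf.HomOn A.aug (F i) (E.sheaf i) (U i) le_rfl le_rfl
  /-- `F_i ⊗_A k → E_i` is an isomorphism -/
  h_isPullback : ∀ i, (h i).IsPullback
  /-- the gluing isomorphisms -/
  g : ∀ i j, ModSheaf.HomOn (AlgHom.id k A.carrier) (F i) (F j) (U i ⊓ U j)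
    KSpace.infl KSpace.infr
  g_isIso : ∀ i j, (g i j).IsIso
  comm : ∀ (i j : I) (V : S.Op) (hi : V ≤ U i) (hj : V ≤ U j) (s : (F i).sec V hi),
    (h j).app V hj ((g i j).app V (le_inf hi hj) s) =
      (E.g i j).app V (le_inf hi hj) ((h i).app V hi s)
  cocycle : ∀ (i j l : I) (V : S.Op) (hi : V ≤ U i) (hj : V ≤ U j) (hl : V ≤ U l)
    (s : (F i).sec V hi),
    (g l i).app V (le_inf hl hi) ((g j l).app V (le_inf hj hl) ((g i j).app V (le_inf hi hj) s)) =
      S.res (le_inf (le_inf hi hj) hl) (α.val i j l).1 • s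

namespace Deformation

variable {E : TwistedSheaf S U α} {A B C : ArtAlg k}

/-- Two deformations over `A` are isomorphic. -/
def Equiv (D D' : Deformation E A) : Prop :=
  ∃ φ : ∀ i, ModSheaf.HomOn (AlgHom.id k A.carrier) (D.F i) (D'.F i) (U i) le_rfl le_rfl,
    (∀ i, (φ i).IsIso) ∧
    (∀ (i j : I) (V : S.Op) (hi : V ≤ U i) (hj : V ≤ U j) (s : (D.F i).sec V hi),
      (φ j).app V hj ((D.g i j).app V (le_inf hi hj) s) =
        (D'.g i j).app V (le_inf hi hj) ((φ i).app V hi s)) ∧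
    ∀ (i : I) (V : S.Op) (hi : V ≤ U i) (s : (D.F i).sec V hi),
      (D'.h i).app V hi ((φ i).app V hi s) = (D.h i).app V hi s

/-- `D'` is a pullback of `D` along `f : A → B`. -/
def IsPullbackOf (f : A.carrier →ₐ[k] B.carrier) (D : Deformation E A) (D' : Deformation E B) :
    Prop :=
  ∃ φ : ∀ i, ModSheaf.HomOn f (D.F i) (D'.F i) (U i) le_rfl le_rfl,
    (∀ i, (φ i).IsPullback) ∧
    (∀ (i j : I) (V : S.Op) (hi : V ≤ U i) (hj : V ≤ U j) (s : (D.F i).sec V hi),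
      (φ j).app V hj ((D.g i j).app V (le_inf hi hj) s) =
        (D'.g i j).app V (le_inf hi hj) ((φ i).app V hi s)) ∧
    ∀ (i : I) (V : S.Op) (hi : V ≤ U i) (s : (D.F i).sec V hi),
      (D'.h i).app V hi ((φ i).app V hi s) = (D.h i).app V hi s

theorem equiv_iff {D D' : Deformation E A} :
    D.Equiv D' ↔ D.IsPullbackOf (AlgHom.id k A.carrier) D' := by
  constructor
  · rintro ⟨φ, h, h'⟩
    exact ⟨φ, fun i => (h i).isPullback fun _ => rfl, h'⟩
  · rintro ⟨φ, h, h'⟩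
    exact ⟨φ, fun i => (h i).isIso, h'⟩

theorem IsPullbackOf.comp {f : A.carrier →ₐ[k] B.carrier} {g : B.carrier →ₐ[k] C.carrier}
    {e : A.carrier →ₐ[k] C.carrier} {D : Deformation E A} {D' : Deformation E B}
    {D'' : Deformation E C} (h : D.IsPullbackOf f D') (h' : D'.IsPullbackOf g D'')
    (he : ∀ a, e a = g (f a)) : D.IsPullbackOf e D'' := by
  obtain ⟨φ, hφ, hg, hh⟩ := h
  obtain ⟨ψ, hψ, hg', hh'⟩ := h'
  refine ⟨fun i => (ψ i).comp (φ i) he, fun i => (hψ i).comp (hφ i) he, ?_, ?_⟩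
  · intro i j V hi hj s
    rw [ModSheaf.HomOn.comp_app, ModSheaf.HomOn.comp_app, hg i j V hi hj, hg' i j V hi hj]
  · intro i V hi s
    rw [ModSheaf.HomOn.comp_app, hh', hh]

theorem IsPullbackOf.desc {f : A.carrier →ₐ[k] B.carrier} {g : B.carrier →ₐ[k] C.carrier}
    {e : A.carrier →ₐ[k] C.carrier} {D : Deformation E A} {D' : Deformation E B}
    {D'' : Deformation E C} (h : D.IsPullbackOf f D') (h' : D.IsPullbackOf e D'')
    (he : ∀ a, e a = g (f a)) : D'.IsPullbackOf g D'' := by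
  obtain ⟨φ, hφ, hg, hh⟩ := h
  obtain ⟨ψ, hψ, hg', hh'⟩ := h'
  choose θ hθ using fun i => (hφ i).exists_desc (g := g) (ψ i) he
  refine ⟨θ, fun i => (hφ i).of_comp (hψ i) he (hθ i), ?_, ?_⟩
  · intro i j V hi hj s
    have key : (((θ j).restrict hj).comp ((D'.g i j).restrict (le_inf hi hj)) (e := g)
        (fun _ => rfl)) = (((D''.g i j).restrict (le_inf hi hj)).comp ((θ i).restrict hi) (e := g)
        (fun _ => rfl)) := by
      refine ((hφ i).restrict hi).hom_ext fun Y hY t => ?_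
      change (θ j).app Y (hY.trans hj) ((D'.g i j).app Y (hY.trans (le_inf hi hj))
          ((φ i).app Y (hY.trans hi) t)) = (D''.g i j).app Y (hY.trans (le_inf hi hj))
          ((θ i).app Y (hY.trans hi) ((φ i).app Y (hY.trans hi) t))
      rw [← hg i j Y (hY.trans hi) (hY.trans hj), hθ, hθ, hg' i j Y (hY.trans hi) (hY.trans hj)]
    exact DFunLike.congr_fun (congrFun (congrFun (congrArg ModSheaf.HomOn.app key) V) le_rfl) s
  · intro i V hi s
    have key : (((D''.h i).restrict hi).comp ((θ i).restrict hi) (e := B.aug)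
        (fun a => ArtAlg.aug_map g a)) = (D'.h i).restrict hi := by
      refine ((hφ i).restrict hi).hom_ext fun Y hY t => ?_
      change (D''.h i).app Y (hY.trans hi) ((θ i).app Y (hY.trans hi)
        ((φ i).app Y (hY.trans hi) t)) = (D'.h i).app Y (hY.trans hi)
        ((φ i).app Y (hY.trans hi) t)
      rw [hθ, hh', hh]
    exact DFunLike.congr_fun (congrFun (congrFun (congrArg ModSheaf.HomOn.app key) V) le_rfl) s

theorem exists_pullback (f : A.carrier →ₐ[k] B.carrier) (D : Deformation E A) :
    ∃ D' : Deformation E B, (∀ i, D'.F i = (D.F i).pullback f) ∧ D.IsPullbackOf f D' := by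
  have hp := fun i => (D.F i).toPullback_isPullback f
  choose h hh using fun i => (hp i).exists_desc (g := B.aug) (D.h i) (fun a => ArtAlg.aug_map f a)
  choose g hg using fun i j => ((hp i).restrict (KSpace.infl : U i ⊓ U j ≤ U i)).exists_desc
    (g := AlgHom.id k B.carrier) (((((D.F j).toPullback f).restrict
      (KSpace.infr : U i ⊓ U j ≤ U j)).comp (D.g i j) (e := f) (fun _ => rfl)))
    (fun _ => rfl)
  have hg' : ∀ (i j : I) (V : S.Op) (hi : V ≤ U i) (hj : V ≤ U j) (s : (D.F i).sec V hi),
      (g i j).app V (le_inf hi hj) (((D.F i).toPullback f).app V hi s) =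
        ((D.F j).toPullback f).app V hj ((D.g i j).app V (le_inf hi hj) s) :=
    fun i j V hi hj s => hg i j V (le_inf hi hj) s
  refine ⟨{ F := fun i => (D.F i).pullback f
            coherent := fun i => (D.coherent i).pullback f
            flat := fun i x hx => by
              haveI := D.flat i x hx
              exact (hp i x hx).flat
            h := h
            h_isPullback := fun i => (hp i).of_comp (D.h_isPullback i)
              (fun a => ArtAlg.aug_map f a) (hh i)
            g := g
            g_isIso := fun i j => ModSheaf.HomOn.IsPullback.isIso
              (((hp i).restrict _).of_comp (((hp j).restrict (KSpace.infr : U i ⊓ U j ≤ U j)).comp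
                ((D.g_isIso i j).isPullback fun _ => rfl) (fun _ => rfl)) (fun _ => rfl) (hg i j))
            comm := ?_
            cocycle := ?_ }, fun _ => rfl, fun i => (D.F i).toPullback f, hp,
            fun i j V hi hj s => (hg' i j V hi hj s).symm, hh⟩
  · intro i j V hi hj s
    have key : (((h j).restrict hj).comp ((g i j).restrict (le_inf hi hj)) (e := B.aug)
        (fun _ => rfl)) = (((E.g i j).restrict (le_inf hi hj)).comp ((h i).restrict hi)
        (e := B.aug) (fun _ => rfl)) := by
      refine ((hp i).restrict hi).hom_ext fun Y hY t => ?_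
      change (h j).app Y (hY.trans hj) ((g i j).app Y (hY.trans (le_inf hi hj))
          (((D.F i).toPullback f).app Y (hY.trans hi) t)) =
        (E.g i j).app Y (hY.trans (le_inf hi hj)) ((h i).app Y (hY.trans hi)
          (((D.F i).toPullback f).app Y (hY.trans hi) t))
      rw [hg' i j Y (hY.trans hi) (hY.trans hj), hh, hh, D.comm i j Y (hY.trans hi) (hY.trans hj)]
    exact DFunLike.congr_fun (congrFun (congrFun (congrArg ModSheaf.HomOn.app key) V) le_rfl) s
  · intro i j l V hi hj hl s
    have key : (((g l i).restrict (le_inf hl hi)).comp (((g j l).restrict (le_inf hj hl)).comp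
        ((g i j).restrict (le_inf hi hj)) (e := AlgHom.id k B.carrier) (fun _ => rfl))
        (e := AlgHom.id k B.carrier) (fun _ => rfl)) =
        (ModSheaf.HomOn.id ((D.F i).pullback f) hi).smul
          (S.res (le_inf (le_inf hi hj) hl) (α.val i j l).1) := by
      refine ((hp i).restrict hi).hom_ext fun Y hY t => ?_
      change (g l i).app Y (hY.trans (le_inf hl hi)) ((g j l).app Y (hY.trans (le_inf hj hl))
        ((g i j).app Y (hY.trans (le_inf hi hj))
          (((D.F i).toPullback f).app Y (hY.trans hi) t))) =
        S.res hY (S.res (le_inf (le_inf hi hj) hl) (α.val i j l).1) •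
          ((D.F i).toPullback f).app Y (hY.trans hi) t
      rw [hg' i j Y (hY.trans hi) (hY.trans hj), hg' j l Y (hY.trans hj) (hY.trans hl),
        hg' l i Y (hY.trans hl) (hY.trans hi),
        D.cocycle i j l Y (hY.trans hi) (hY.trans hj) (hY.trans hl)]
      rw [((D.F i).toPullback f).app_smulO, S.res_res]
    have := DFunLike.congr_fun
      (congrFun (congrFun (congrArg ModSheaf.HomOn.app key) V) le_rfl) s
    refine this.trans ?_
    change S.res (le_refl V) _ • s = _
    rw [S.res_self]

/-- The pullback of a deformation along `f : A → B`: its sheaves are the pullbacks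
`F_i ⊗_A B`, and its structure morphisms are the ones induced by those of `D`. -/
def pullback (f : A.carrier →ₐ[k] B.carrier) (D : Deformation E A) : Deformation E B :=
  (D.exists_pullback f).choose

theorem pullback_isPullbackOf (f : A.carrier →ₐ[k] B.carrier) (D : Deformation E A) :
    D.IsPullbackOf f (D.pullback f) := (D.exists_pullback f).choose_spec.2

theorem isPullbackOf_refl (D : Deformation E A) :
    D.IsPullbackOf (AlgHom.id k A.carrier) D := by
  refine equiv_iff.1 ⟨fun i => ModSheaf.HomOn.id _ le_rfl, fun i V hV => Function.bijective_id,
    fun _ _ _ _ _ _ => rfl, fun _ _ _ _ => rfl⟩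

/-- Isomorphism of deformations is an equivalence relation. -/
def setoid (E : TwistedSheaf S U α) (A : ArtAlg k) : Setoid (Deformation E A) where
  r := Equiv
  iseqv :=
    { refl := fun D => equiv_iff.2 D.isPullbackOf_refl
      symm := fun h => equiv_iff.2 ((equiv_iff.1 h).desc (isPullbackOf_refl _) fun _ => rfl)
      trans := fun h h' => equiv_iff.2 ((equiv_iff.1 h).comp (equiv_iff.1 h') fun _ => rfl) }

theorem equiv_of_isPullbackOf {f : A.carrier →ₐ[k] B.carrier} {D : Deformation E A}
    {D' D'' : Deformation E B} (h : D.IsPullbackOf f D') (h' : D.IsPullbackOf f D'') :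
    D'.Equiv D'' := equiv_iff.2 (h.desc h' fun _ => rfl)

end Deformation

/-- The functor of `(α, U)`-deformations of `E`: it sends `A` to the set of isomorphism classes of
deformations of `E` over `A`, and a homomorphism to the pullback along it. -/
def TwistedSheaf.defFunctor (E : TwistedSheaf S U α) : ArtAlg k ⥤ Type (u + 1) where
  obj A := Quotient (Deformation.setoid E A)
  map f := TypeCat.ofHom (Quotient.map (sa := Deformation.setoid E _) (sb := Deformation.setoid E _)
    (Deformation.pullback f) fun D D' h => Deformation.equiv_of_isPullbackOf
      (D.pullback_isPullbackOf f)
      ((Deformation.equiv_iff.1 h).comp (D'.pullback_isPullbackOf f) fun _ => rfl))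
  map_id A := by
    ext x
    induction x using Quotient.inductionOn with | h D => ?_
    exact Quotient.sound (s := Deformation.setoid E A) (Deformation.equiv_of_isPullbackOf
      (D.pullback_isPullbackOf _) D.isPullbackOf_refl)
  map_comp f g := by
    ext x
    induction x using Quotient.inductionOn with | h D => ?_
    exact Quotient.sound (s := Deformation.setoid E _) (Deformation.equiv_of_isPullbackOf
      (D.pullback_isPullbackOf _) ((D.pullback_isPullbackOf f).comp
        ((D.pullback f).pullback_isPullbackOf g) fun _ => rfl))

instance {W : S.Op} (F : ModSheaf S k W) (V : S.Op) (hV : V ≤ W) :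
    IsScalarTower k (S.O V) (F.sec V hV) :=
  ⟨fun c r s => by rw [Algebra.smul_def, mul_smul, F.smul_const]; rfl⟩

/-- The sections over `V` of the sheaf `End(E)` obtained by gluing the sheaves `End(E_i)` through
conjugation by the `g_ij`: families of endomorphisms of the sheaves of modules `E_i` restricted to
`V ∩ U_i` that correspond to each other under the `g_ij`.  This is a `k`-algebra under composition;
its commutator makes it a Lie algebra. -/
def TwistedSheaf.endAlg (E : TwistedSheaf S U α) (V : S.Op) :
    Subalgebra k (∀ (i : I) (W : {W : S.Op // W ≤ V ⊓ U i}),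
      Module.End (S.O W.1) ((E.sheaf i).sec W.1 (W.2.trans KSpace.infr))) where
  carrier := {x |
    (∀ (i : I) (W W' : S.Op) (hW : W ≤ V ⊓ U i) (h : W' ≤ W)
      (s : (E.sheaf i).sec W (hW.trans KSpace.infr)),
      (E.sheaf i).res (hW.trans KSpace.infr) h (x i ⟨W, hW⟩ s) =
        x i ⟨W', h.trans hW⟩ ((E.sheaf i).res (hW.trans KSpace.infr) h s)) ∧
    (∀ (i j : I) (W : S.Op) (hi : W ≤ V ⊓ U i) (hj : W ≤ V ⊓ U j)
      (s : (E.sheaf i).sec W (hi.trans KSpace.infr)),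
      (E.g i j).app W (le_inf (hi.trans KSpace.infr) (hj.trans KSpace.infr)) (x i ⟨W, hi⟩ s) =
        x j ⟨W, hj⟩
          ((E.g i j).app W (le_inf (hi.trans KSpace.infr) (hj.trans KSpace.infr)) s))}
  mul_mem' {x y} hx hy := by
    refine ⟨fun i W W' hW h s => ?_, fun i j W hi hj s => ?_⟩
    · exact (hx.1 i W W' hW h _).trans (congrArg (x i ⟨W', h.trans hW⟩) (hy.1 i W W' hW h s))
    · exact (hx.2 i j W hi hj _).trans (congrArg (x j ⟨W, hj⟩) (hy.2 i j W hi hj s))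
  add_mem' {x y} hx hy := by
    refine ⟨fun i W W' hW h s => ?_, fun i j W hi hj s => ?_⟩
    · exact (map_add _ _ _).trans (congrArg₂ (· + ·) (hx.1 i W W' hW h s) (hy.1 i W W' hW h s))
    · exact (map_add _ _ _).trans (congrArg₂ (· + ·) (hx.2 i j W hi hj s) (hy.2 i j W hi hj s))
  algebraMap_mem' c := by
    refine ⟨fun i W W' hW h s => ?_, fun i j W hi hj s => ?_⟩
    · exact (E.sheaf i).res_smulA _ h c s
    · exact (E.g i j).app_smulA W _ c s

/-- Restriction of sections of `End(E)`. -/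
def TwistedSheaf.endRes (E : TwistedSheaf S U α) {V V' : S.Op} (h : V' ≤ V) :
    E.endAlg V →ₐ[k] E.endAlg V' where
  toFun x := ⟨fun i W => x.1 i ⟨W.1, W.2.trans (inf_le_inf_right (U i) h)⟩,
    fun i W W' _ h' s => x.2.1 i W W' _ h' s, fun i j W _ _ s => x.2.2 i j W _ _ s⟩
  map_one' := rfl
  map_mul' _ _ := rfl
  map_zero' := rfl
  map_add' _ _ := rfl
  commutes' _ := rfl

/-- The map between products of the `End(E)(U_{i₀} ∩ … ∩ U_{i_n})` that sends `x` to the family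
with components `x_{i_{φ(0)}, …, i_{φ(n)}}` restricted to `U_{i₀} ∩ … ∩ U_{i_m}`. -/
def TwistedSheaf.cechMap (E : TwistedSheaf S U α) {n m : ℕ} (φ : Fin (n + 1) ↪o Fin (m + 1)) :
    (∀ idx : Fin (n + 1) → I, E.endAlg (⨅ a, U (idx a))) →ₐ[k]
      ∀ idx : Fin (m + 1) → I, E.endAlg (⨅ a, U (idx a)) :=
  AlgHom.pi fun idx : Fin (m + 1) → I =>
    (E.endRes (le_iInf fun b => iInf_le (fun a => U (idx a)) (φ b))).comp
      (Pi.evalAlgHom k (fun idx : Fin (n + 1) → I => E.endAlg (⨅ a, U (idx a)))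
        (fun b => idx (φ b)))

/-- The Čech semicosimplicial algebra of `End(E)`:
in degree `n` it is the product of the `End(E)(U_{i₀} ∩ … ∩ U_{i_n})` over all `i₀, …, i_n`. -/
def TwistedSheaf.cech (E : TwistedSheaf S U α) : SemiSimplexCategory ⥤ AlgCat.{u} k where
  obj n := AlgCat.of k (∀ idx : Fin (n.len + 1) → I, E.endAlg (⨅ a, U (idx a)))
  map φ := AlgCat.ofHom (E.cechMap (SemiSimplexCategory.homEquiv φ))
  map_id n := by rw [SemiSimplexCategory.homEquiv_id]; rfl
  map_comp φ ψ := by rw [SemiSimplexCategory.homEquiv_comp]; rfl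

section Semicosimplicial

variable (k) in
/-- The exponential of a nilpotent element of a `k`-algebra, for `k` of characteristic zero. -/
def nexp [CharZero k] {R : Type u} [Ring R] [Algebra k R] (x : R) : R :=
  letI : Module ℚ R := Module.compHom R (algebraMap ℚ k)
  IsNilpotent.exp x

theorem map_nexp [CharZero k] {R R' : Type u} [Ring R] [Algebra k R] [Ring R'] [Algebra k R']
    (f : R →ₐ[k] R') {x : R} (hx : IsNilpotent x) : f (nexp k x) = nexp k (f x) := by
  letI : Module ℚ R := Module.compHom R (algebraMap ℚ k)
  letI : Module ℚ R' := Module.compHom R' (algebraMap ℚ k)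
  obtain ⟨n, hn⟩ := hx
  have hn' : f x ^ n = 0 := by rw [← map_pow, hn, map_zero]
  change f (IsNilpotent.exp x) = IsNilpotent.exp (f x)
  rw [IsNilpotent.exp_eq_sum hn, IsNilpotent.exp_eq_sum hn', map_sum]
  refine Finset.sum_congr rfl fun i _ => ?_
  rw [← map_pow]
  exact map_smul f (algebraMap ℚ k (i.factorial : ℚ)⁻¹) (x ^ i)

/-- The subspace `R ⊗ J` of `R ⊗_k A`, for an ideal `J` of `A`. -/
def tensorIdeal (R : Type u) [Ring R] [Algebra k R] {A : Type u} [CommRing A] [Algebra k A]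
    (J : Ideal A) : Submodule k (R ⊗[k] A) :=
  Submodule.span k {t | ∃ (r : R), ∃ a ∈ J, t = r ⊗ₜ[k] a}

theorem tensorIdeal_mul {R : Type u} [Ring R] [Algebra k R] {A : Type u} [CommRing A] [Algebra k A]
    {J J' : Ideal A} {x y : R ⊗[k] A} (hx : x ∈ tensorIdeal R J) (hy : y ∈ tensorIdeal R J') :
    x * y ∈ tensorIdeal R (J * J') := by
  induction hx using Submodule.span_induction with
  | zero => rw [zero_mul]; exact Submodule.zero_mem _
  | add x x' _ _ h h' => rw [add_mul]; exact Submodule.add_mem _ h h'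
  | smul c x _ h => rw [smul_mul_assoc]; exact Submodule.smul_mem _ c h
  | mem x hx =>
    obtain ⟨r, a, ha, rfl⟩ := hx
    induction hy using Submodule.span_induction with
    | zero => rw [mul_zero]; exact Submodule.zero_mem _
    | add x x' _ _ h h' => rw [mul_add]; exact Submodule.add_mem _ h h'
    | smul c x _ h => rw [mul_smul_comm]; exact Submodule.smul_mem _ c h
    | mem y hy =>
      obtain ⟨r', a', ha', rfl⟩ := hy
      exact Submodule.subset_span ⟨r * r', a * a', Ideal.mul_mem_mul ha ha', by simp⟩

theorem tensorIdeal_map {R R' : Type u} [Ring R] [Algebra k R] [Ring R'] [Algebra k R']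
    {A A' : Type u} [CommRing A] [Algebra k A] [CommRing A'] [Algebra k A'] (f : R →ₐ[k] R')
    (g : A →ₐ[k] A') {J : Ideal A} {J' : Ideal A'} (hg : ∀ a ∈ J, g a ∈ J') {x : R ⊗[k] A}
    (hx : x ∈ tensorIdeal R J) : Algebra.TensorProduct.map f g x ∈ tensorIdeal R' J' := by
  induction hx using Submodule.span_induction with
  | zero => rw [map_zero]; exact Submodule.zero_mem _
  | add x x' _ _ h h' => rw [map_add]; exact Submodule.add_mem _ h h'
  | smul c x _ h => rw [map_smul]; exact Submodule.smul_mem _ c h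
  | mem x hx =>
    obtain ⟨r, a, ha, rfl⟩ := hx
    exact Submodule.subset_span ⟨f r, g a, hg a ha, by simp⟩

/-- The nilpotent Lie algebra `R ⊗ 𝔪_A` inside the algebra `R ⊗_k A`. -/
def nilp (R : Type u) [Ring R] [Algebra k R] (A : ArtAlg k) : Submodule k (R ⊗[k] A.carrier) :=
  tensorIdeal R (IsLocalRing.maximalIdeal A.carrier)

theorem isNilpotent_of_mem {R : Type u} [Ring R] [Algebra k R] {A : ArtAlg k}
    {x : R ⊗[k] A.carrier} (hx : x ∈ nilp R A) : IsNilpotent x := by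
  have h : ∀ n, x ^ (n + 1) ∈ tensorIdeal R (IsLocalRing.maximalIdeal A.carrier ^ (n + 1)) := by
    intro n
    induction n with
    | zero => rw [zero_add, pow_one, pow_one]; exact hx
    | succ n ih => rw [pow_succ, pow_succ _ (n + 1)]; exact tensorIdeal_mul ih hx
  obtain ⟨n, hn⟩ := A.isNilpotent_maximalIdeal
  refine ⟨n + 1, ?_⟩
  have h1 := h n
  have h0 : IsLocalRing.maximalIdeal A.carrier ^ (n + 1) = ⊥ := by
    rw [pow_succ, hn, zero_mul]; rfl
  rw [h0] at h1
  refine (Submodule.mem_bot k).1 ((le_of_eq (Submodule.span_eq_bot.2 ?_)) h1)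
  rintro _ ⟨r, a, ha, rfl⟩
  rw [(Ideal.mem_bot.1 ha : a = 0), TensorProduct.tmul_zero]

/-- The face map `[n] → [n + 1]` that omits `j`. -/
def face (n : ℕ) (j : Fin (n + 2)) : SemiSimplexCategory.mk n ⟶ SemiSimplexCategory.mk (n + 1) :=
  SemiSimplexCategory.homEquiv.symm (Fin.succAboveOrderEmb j)

variable (G : SemiSimplexCategory ⥤ AlgCat.{u} k)

/-- The face operator `∂_j : G_n ⊗ A → G_{n+1} ⊗ A`. -/
def coface (A : ArtAlg k) (n : ℕ) (j : Fin (n + 2)) :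
    G.obj (SemiSimplexCategory.mk n) ⊗[k] A.carrier →ₐ[k]
      G.obj (SemiSimplexCategory.mk (n + 1)) ⊗[k] A.carrier :=
  Algebra.TensorProduct.map (G.map (face n j)).hom (AlgHom.id k A.carrier)

/-- Functoriality of `G_n ⊗ A` in `A`. -/
def scMap {A B : ArtAlg k} (f : A ⟶ B) (n : ℕ) :
    G.obj (SemiSimplexCategory.mk n) ⊗[k] A.carrier →ₐ[k]
      G.obj (SemiSimplexCategory.mk n) ⊗[k] B.carrier :=
  Algebra.TensorProduct.map (AlgHom.id k _) (f : A.carrier →ₐ[k] B.carrier)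

theorem scMap_coface {A B : ArtAlg k} (f : A ⟶ B) (n : ℕ) (j : Fin (n + 2))
    (x : G.obj (SemiSimplexCategory.mk n) ⊗[k] A.carrier) :
    scMap G f (n + 1) (coface G A n j x) = coface G B n j (scMap G f n x) := by
  induction x using TensorProduct.induction_on with
  | zero => simp
  | tmul r a => simp [scMap, coface]
  | add x y hx hy => simp only [map_add, hx, hy]

theorem coface_mem {A : ArtAlg k} {n : ℕ} (j : Fin (n + 2))
    {x : G.obj (SemiSimplexCategory.mk n) ⊗[k] A.carrier} (hx : x ∈ nilp _ A) :
    coface G A n j x ∈ nilp _ A :=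
  tensorIdeal_map _ _ (fun _ h => h) hx

theorem scMap_mem {A B : ArtAlg k} (f : A ⟶ B) {n : ℕ}
    {x : G.obj (SemiSimplexCategory.mk n) ⊗[k] A.carrier} (hx : x ∈ nilp _ A) :
    scMap G f n x ∈ nilp _ B :=
  tensorIdeal_map _ _ (fun _ h => ArtAlg.map_mem _ h) hx

variable [CharZero k]

/-- `Z¹_sc(exp G)(A)`: the elements `m` of `G₁ ⊗ 𝔪_A` such that
`e^{∂₀ m} e^{-∂₁ m} e^{∂₂ m} = 1`. -/
def Z1sc (A : ArtAlg k) : Type u :=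
  {m : G.obj (SemiSimplexCategory.mk 1) ⊗[k] A.carrier // m ∈ nilp _ A ∧
    nexp k (coface G A 1 0 m) * nexp k (-(coface G A 1 1 m)) * nexp k (coface G A 1 2 m) = 1}

/-- The relation `m ~ m'` on `Z¹_sc(exp G)(A)`: there is `a` in `G₀ ⊗ 𝔪_A` such that
`e^{-∂₁ a} e^m e^{∂₀ a} = e^{m'}`. -/
def relSc (A : ArtAlg k) (m m' : Z1sc G A) : Prop :=
  ∃ a ∈ nilp (G.obj (SemiSimplexCategory.mk 0)) A,
    nexp k (-(coface G A 0 1 a)) * nexp k m.1 * nexp k (coface G A 0 0 a) = nexp k m'.1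

/-- Functoriality of `Z¹_sc(exp G)`. -/
def Z1map {A B : ArtAlg k} (f : A ⟶ B) (m : Z1sc G A) : Z1sc G B :=
  ⟨scMap G f 1 m.1, scMap_mem G f m.2.1, by
    have h := congrArg (scMap G f 2) m.2.2
    have h0 := isNilpotent_of_mem (coface_mem G 0 m.2.1)
    have h1 := (isNilpotent_of_mem (coface_mem G 1 m.2.1)).neg
    have h2 := isNilpotent_of_mem (coface_mem G 2 m.2.1)
    rw [map_mul, map_mul, map_one, map_nexp _ h0, map_nexp _ h1, map_nexp _ h2, map_neg,
      scMap_coface, scMap_coface, scMap_coface] at h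
    exact h⟩

theorem relSc_map {A B : ArtAlg k} (f : A ⟶ B) {m m' : Z1sc G A} (h : relSc G A m m') :
    relSc G B (Z1map G f m) (Z1map G f m') := by
  obtain ⟨a, ha, h⟩ := h
  refine ⟨scMap G f 0 a, scMap_mem G f ha, ?_⟩
  replace h := congrArg (scMap G f 1) h
  have h0 := isNilpotent_of_mem (coface_mem G 0 ha)
  have h1 := (isNilpotent_of_mem (coface_mem G 1 ha)).neg
  rw [map_mul, map_mul, map_nexp _ h0, map_nexp _ h1, map_nexp _ (isNilpotent_of_mem m.2.1),
    map_nexp _ (isNilpotent_of_mem m'.2.1), map_neg, scMap_coface, scMap_coface] at h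
  exact h

/-- The functor `H¹_sc(exp G)` of Artin rings of a semicosimplicial algebra `G`, viewed as a
semicosimplicial Lie algebra through the commutator bracket.  The group `exp(G_n ⊗ 𝔪_A)`, with the
Baker-Campbell-Hausdorff product, is realised by the exponentials in the algebra `G_n ⊗ A`. -/
def H1sc : ArtAlg k ⥤ Type u where
  obj A := Quot (relSc G A)
  map f := TypeCat.ofHom (Quot.map (Z1map G f) fun _ _ h => relSc_map G f h)
  map_id A := by
    ext x
    induction x using Quot.inductionOn with | h m => ?_
    refine congrArg (Quot.mk _) (Subtype.ext ?_)
    exact DFunLike.congr_fun (Algebra.TensorProduct.map_id (R := k)) m.1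
  map_comp {A B C} f g := by
    ext x
    induction x using Quot.inductionOn with | h m => ?_
    refine congrArg (Quot.mk _) (Subtype.ext ?_)
    change scMap G (f ≫ g) 1 m.1 = scMap G g 1 (scMap G f 1 m.1)
    generalize m.1 = y
    induction y using TensorProduct.induction_on with
    | zero => simp
    | tmul r a => simp [scMap]; rfl
    | add x y hx hy => simp only [map_add, hx, hy]

end Semicosimplicial

/-- A scheme over `k` as a locally ringed space over `k`. -/
def KSpace.ofScheme (X : Scheme.{u}) (p : X ⟶ Spec (CommRingCat.of k)) : KSpace k where
  X := X.toLocallyRingedSpace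
  str := ((Scheme.ΓSpecIso (CommRingCat.of k)).inv ≫ p.appTop).hom

/-- The constant functions on a complex manifold. -/
def constants (E M : Type) [NormedAddCommGroup E] [NormedSpace ℂ E] [TopologicalSpace M]
    [ChartedSpace E M] : ℂ →+* (ChartedSpace.locallyRingedSpace 𝓘(ℂ, E) M).presheaf.obj (op ⊤) :=
  (algebraMap ℂ C^∞⟮𝓘(ℂ, E), (⊤ : Opens M); 𝓘(ℂ), ℂ⟯ : ℂ →+* _)

/-- A complex manifold `M` modelled on `E`, with its sheaf of holomorphic functions (the functions
that are `C^∞` over `ℂ` in the charts), as a locally ringed space over `ℂ`. -/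
def KSpace.ofManifold (E M : Type) [NormedAddCommGroup E] [NormedSpace ℂ E] [TopologicalSpace M]
    [ChartedSpace E M] : KSpace ℂ where
  X := ChartedSpace.locallyRingedSpace 𝓘(ℂ, E) M
  str := constants E M

end

end TwistedDef

/-! Over each `U_i` every deformation of `E_i` is trivial, so that only the gluing data remain, and
these are cochains of `End(E)`.

Triviality (`exists_iso_tens`). Let `h : F → E_i` be the reduction of a flat deformation. Near a
point the elements of a frame of `E_i` lift to `F`, and prescribing these lifts gives an `O`-linear
section of `h`. Such a section extends `A`-linearly to a map `E_i ⊗ A → F`, which is an isomorphism: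
it is surjective by Nakayama's lemma, and injective because in a flat module a family that is
independent modulo `𝔪_A` is independent (`isExtension_of_section`). Hence `ker h` is locally `E_i ⊗
𝔪_A`, a locally free `O`-module. Two local sections differ by a section of `Hom(E_i, ker h)`, so the
obstruction to a global section lies in `H¹` of a locally free sheaf. This vanishes on a Stein open
set by definition, and on an affine one by the classical Čech argument on basic open sets
(`H1Vanishes_of_isAffineOpen`). The geometry of the `U_i` enters only here.

Gluing. After trivialisation the gluing isomorphisms are `g_ij ∘ y_ij`, where `y` is a 1-cochain of
`End(E)` with coefficients in `A` that reduces to `1` (`exists_act`). Cochains commute with the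
`g_ij`, which already compose to the invertible `α_ijl`; so `α` cancels and the condition on `y` is
`y_li y_jl y_ij = 1` (`twist_twist`). A deformation is not required to satisfy `g_ii = id`, but
`y_ii³ = 1` forces `y_ii = 1` in characteristic zero (`eq_one_of_cube`), and then the condition
reads `y_il = y_jl y_ij`. Isomorphisms of deformations are 0-cochains `b` that reduce to `1` and
satisfy `b_j y_ij = y'_ij b_i` (`deformation_equiv_iff`).

Exponentials. In characteristic zero the elements of `R ⊗ A` that reduce to `1` are exactly the
`e^x` with `x` in `R ⊗ 𝔪_A` (`reduction_nexp`, `exists_nexp_eq`). Substituting `y = e^{-m}` and `b =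
e^{-a}` turns the two conditions into those that define `H¹_sc`. The bijection is natural because
`E_i ⊗ A → E_i ⊗ B` is a pullback that respects the twisted gluing (`deformation_isPullbackOf`). -/

namespace TwistedDef

noncomputable section

variable {k : Type u} [Field k]

/-! ### Coordinates in a basis of a finite-dimensional algebra. -/

section Coordinates

variable (A : Type u) [AddCommGroup A] [Module k A] [Module.Finite k A]
variable {M N : Type u} [AddCommGroup M] [Module k M] [AddCommGroup N] [Module k N]

/-- The coordinates of an element of `M ⊗ A` in a fixed basis of the finite-dimensional space `A`. -/
def coords (M : Type u) [AddCommGroup M] [Module k M] :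
    M ⊗[k] A ≃ₗ[k] (Fin (Module.finrank k A) → M) :=
  TensorProduct.equivFinsuppOfBasisRight (Module.finBasis k A) ≪≫ₗ
    Finsupp.linearEquivFunOnFinite k M (Fin (Module.finrank k A))

theorem coords_tmul (m : M) (a : A) (l : Fin (Module.finrank k A)) :
    coords A M (m ⊗ₜ a) l = (Module.finBasis k A).repr a l • m := by
  simp [coords]

/-- Coordinates involve only the basis of `A`, hence are natural in the module. Applied to
restriction maps, this reduces the sheaf axiom for `E ⊗ A` to the one for `E`. -/
theorem coords_rTensor (f : M →ₗ[k] N) (t : M ⊗[k] A) (l : Fin (Module.finrank k A)) :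
    coords A N (f.rTensor A t) l = f (coords A M t l) := by
  induction t using TensorProduct.induction_on with
  | zero => simp
  | tmul m a => simp [coords_tmul]
  | add x y hx hy => simp only [map_add, Pi.add_apply, hx, hy]

theorem sum_coords (t : M ⊗[k] A) :
    ∑ l, coords A M t l ⊗ₜ[k] Module.finBasis k A l = t := by
  induction t using TensorProduct.induction_on with
  | zero => simp
  | tmul m a =>
    simp only [coords_tmul]
    conv_rhs => rw [← (Module.finBasis k A).sum_repr a, TensorProduct.tmul_sum]
    exact Finset.sum_congr rfl fun l _ => by rw [TensorProduct.smul_tmul]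
  | add x y hx hy =>
    conv_rhs => rw [← hx, ← hy]
    simp only [map_add, Pi.add_apply, TensorProduct.add_tmul, Finset.sum_add_distrib]

theorem coords_sum (m : Fin (Module.finrank k A) → M) :
    coords A M (∑ l, m l ⊗ₜ[k] Module.finBasis k A l) = m := by
  ext l
  rw [map_sum, Finset.sum_apply]
  simp only [coords_tmul, Module.Basis.repr_self]
  rw [Finset.sum_eq_single l]
  · simp
  · intro b _ hb
    rw [Finsupp.single_eq_of_ne (Ne.symm hb), zero_smul]
  · simp

end Coordinates

section IsExtension

variable (A : Type u) [CommRing A] [Algebra k A] [Module.Finite k A]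
variable {M : Type u} [AddCommGroup M] [Module k M]

/-- A `k`-linear map `ℓ : M → N` into an `A`-module is an extension of scalars as soon as every
element of `N` is uniquely of the form `∑ b_l • ℓ m_l`, for the fixed basis `b_l` of `A`. -/
theorem isExtension_of_basis {P : Type u} [AddCommGroup P] [Module A P] (ℓ : M →+ P)
    (hℓ : ∀ (c : k) m, ℓ (c • m) = (Algebra.ofId k A).toRingHom c • ℓ m)
    (hinj : ∀ m : Fin (Module.finrank k A) → M,
      ∑ l, Module.finBasis k A l • ℓ (m l) = 0 → m = 0)
    (hsurj : ∀ p, ∃ m : Fin (Module.finrank k A) → M,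
      ∑ l, Module.finBasis k A l • ℓ (m l) = p) :
    IsExtension (Algebra.ofId k A).toRingHom ℓ hℓ := by
  let : Module k P := Module.compHom P (algebraMap k A)
  have : IsScalarTower k A P := ⟨fun a b n => by
    rw [Algebra.smul_def, mul_smul]; rfl⟩
  let ℓ₁ : M →ₗ[k] P := { toFun := ℓ, map_add' := ℓ.map_add, map_smul' := hℓ }
  have key : IsBaseChange A ℓ₁ := by
    let θ : A ⊗[k] M →ₗ[A] P := TensorProduct.AlgebraTensorModule.lift
      ((LinearMap.toSpanSingleton A (M →ₗ[k] P) ℓ₁))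
    have hθ : ∀ a m, θ (a ⊗ₜ m) = a • ℓ m := fun a m => rfl
    -- Up to the swap of factors, `θ` is the coordinate sum, so that `hinj` and `hsurj` are its
    -- injectivity and surjectivity.
    have hc : ∀ t : M ⊗[k] A, θ (TensorProduct.comm k M A t) =
        ∑ l, Module.finBasis k A l • ℓ (coords A M t l) := by
      intro t
      conv_lhs => rw [← sum_coords A t]
      rw [map_sum, map_sum]
      exact Finset.sum_congr rfl fun l _ => by rw [TensorProduct.comm_tmul, hθ]
    refine IsBaseChange.of_equiv (LinearEquiv.ofBijective θ ⟨?_, ?_⟩) fun m => ?_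
    · rw [injective_iff_map_eq_zero]
      intro t ht
      obtain ⟨t, rfl⟩ := (TensorProduct.comm k M A).surjective t
      rw [hc] at ht
      rw [(coords A M).map_eq_zero_iff.1 (hinj _ ht), map_zero]
    · intro p
      obtain ⟨m, rfl⟩ := hsurj p
      exact ⟨TensorProduct.comm k M A ((coords A M).symm m), by
        rw [hc, LinearEquiv.apply_symm_apply]⟩
    · exact (hθ 1 m).trans (one_smul _ _)
  -- `IsExtension` rebuilds the `k`-algebra structure of `A` from the ring homomorphism; it has to
  -- be identified with the given one.
  unfold IsExtension
  convert! key
  exact Algebra.algebra_ext _ _ fun _ => rfl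

end IsExtension

/-! ### The trivial deformation `E ⊗ A`. -/

namespace ModSheaf

variable {S : KSpace k} {U U' : S.Op}

/-- The `A`-module structure of `M ⊗ A` given by the second factor. -/
abbrev rightModule (A M : Type u) [CommRing A] [Algebra k A] [AddCommGroup M] [Module k M] :
    Module A (M ⊗[k] A) :=
  Module.compHom (M ⊗[k] A)
    ((Module.End.lTensorAlgHom k A M).toRingHom.comp (Algebra.lmul k A).toRingHom)

variable (A : Type u) [CommRing A] [Algebra k A] [Module.Finite k A]

/-- The sheaf `E ⊗_k A` of `O ⊗_k A`-modules, for a finite-dimensional algebra `A`. -/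
def tens (E : ModSheaf S k U) : ModSheaf S A U where
  sec V hV := E.sec V hV ⊗[k] A
  modA V hV := rightModule A (E.sec V hV)
  comm V hV :=
    let := rightModule (k := k) A (E.sec V hV)
    ⟨fun r a t => by
      induction t using TensorProduct.induction_on with
      | zero => simp
      | tmul s b => rfl
      | add x y hx hy => simp only [smul_add, hx, hy]⟩
  smul_const V hV c t := by
    let := rightModule (k := k) A (E.sec V hV)
    induction t using TensorProduct.induction_on with
    | zero => simp
    | tmul s b =>
      change (algebraMap k (S.O V) c • s) ⊗ₜ[k] b = s ⊗ₜ[k] (algebraMap k A c * b)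
      rw [E.smul_const, ← Algebra.smul_def, TensorProduct.tmul_smul, TensorProduct.smul_tmul']
      rfl
    | add x y hx hy => simp only [smul_add, hx, hy]
  res hV h := ((E.resₗ hV h).rTensor A).toAddMonoidHom
  res_smulO {V W} hV h r t := by
    induction t using TensorProduct.induction_on with
    | zero => simp
    | tmul s b => exact congrArg (· ⊗ₜ[k] b) (E.res_smulO hV h r s)
    | add x y hx hy => simp only [smul_add, map_add, hx, hy]
  res_smulA {V W} hV h a t := by
    let := rightModule (k := k) A (E.sec V hV)
    let := rightModule (k := k) A (E.sec W (h.trans hV))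
    induction t using TensorProduct.induction_on with
    | zero => simp
    | tmul s b => rfl
    | add x y hx hy => simp only [smul_add, map_add, hx, hy]
  res_self {V} hV t := by
    induction t using TensorProduct.induction_on with
    | zero => simp
    | tmul s b => exact congrArg (· ⊗ₜ[k] b) (E.res_self hV s)
    | add x y hx hy => simp only [map_add, hx, hy]
  res_res hV h h' t := by
    induction t using TensorProduct.induction_on with
    | zero => simp
    | tmul s b => exact congrArg (· ⊗ₜ[k] b) (E.res_res hV h h' s)
    | add x y hx hy => simp only [map_add, hx, hy]
  exists_unique_glue {V} hV ι W hW hc s hs := by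
    -- As `A` is finite-dimensional, `E(V) ⊗ A` is a finite power of `E(V)`: no sheafification is
    -- needed, and sections glue coordinate by coordinate.
    have hs' : ∀ i j l, E.res ((hW i).trans hV) (inf_le_left : W i ⊓ W j ≤ W i)
        (coords A _ (s i) l) = E.res ((hW j).trans hV) (inf_le_right : W i ⊓ W j ≤ W j)
        (coords A _ (s j) l) := fun i j l => by
      have h1 := congrArg (fun t => coords A _ t l) (hs i j)
      exact ((coords_rTensor A (E.resₗ _ _) (s i) l).symm.trans h1).trans
        (coords_rTensor A (E.resₗ _ _) (s j) l)
    choose t ht htu using fun l => E.exists_unique_glue hV W hW hc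
      (fun i => coords A _ (s i) l) (fun i j => hs' i j l)
    refine ⟨(coords A _).symm t, fun i => (coords A _).injective (funext fun l => ?_),
      fun t' ht' => (coords A _).injective (funext fun l => ?_)⟩
    · refine (coords_rTensor A (E.resₗ hV (hW i)) _ l).trans ?_
      rw [LinearEquiv.apply_symm_apply]
      exact ht l i
    · rw [LinearEquiv.apply_symm_apply]
      refine htu l _ fun i => ?_
      rw [← ht' i]
      exact (coords_rTensor A (E.resₗ hV (hW i)) _ l).symm

variable {A}

section

variable (E : ModSheaf S k U) {V W : S.Op} (hV : V ≤ U)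

/-- The pure tensors among the sections of `E ⊗ A`. -/
def tensMk (s : E.sec V hV) (a : A) : (E.tens A).sec V hV := s ⊗ₜ[k] a

variable {E hV} in
-- There is no case for zero because `0` is the pure tensor `0 ⊗ 0`. The motive is stated for
-- sections of the sheaf, so that its restriction maps and actions remain recognisable.
theorem tens_induction {p : (E.tens A).sec V hV → Prop} (t : (E.tens A).sec V hV)
    (tmul : ∀ s a, p (E.tensMk hV s a)) (add : ∀ x y, p x → p y → p (x + y)) : p t :=
  TensorProduct.induction_on (motive := p) t
    (by have := tmul 0 0; rwa [tensMk, TensorProduct.tmul_zero] at this) tmul add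

theorem tensMk_smulO (r : S.O V) (s : E.sec V hV) (a : A) :
    r • E.tensMk hV s a = E.tensMk hV (r • s) a := rfl

theorem tensMk_smulA (b : A) (s : E.sec V hV) (a : A) :
    b • E.tensMk hV s a = E.tensMk hV s (b * a) := rfl

theorem tensMk_res (h : W ≤ V) (s : E.sec V hV) (a : A) :
    (E.tens A).res hV h (E.tensMk hV s a) = E.tensMk (h.trans hV) (E.res hV h s) a := rfl

theorem tensMk_add (s t : E.sec V hV) (a : A) :
    E.tensMk hV (s + t) a = E.tensMk hV s a + E.tensMk hV t a := TensorProduct.add_tmul _ _ _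

theorem tensMk_smul (c : k) (s : E.sec V hV) (a : A) :
    E.tensMk hV (c • s) a = E.tensMk hV s (c • a) := TensorProduct.smul_tmul _ _ _

theorem exists_sum_tensMk (t : (E.tens A).sec V hV) :
    ∃ s : Fin (Module.finrank k A) → E.sec V hV,
      t = ∑ l, E.tensMk hV (s l) (Module.finBasis k A l) := ⟨_, (sum_coords A t).symm⟩

theorem sum_tensMk_inj {s s' : Fin (Module.finrank k A) → E.sec V hV}
    (h : ∑ l, E.tensMk hV (s l) (Module.finBasis k A l) =
      ∑ l, E.tensMk hV (s' l) (Module.finBasis k A l)) : s = s' := by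
  rw [← coords_sum A s, ← coords_sum A s']
  exact congrArg (coords A _) h

end

/-- The canonical morphism `E → E ⊗ A`. -/
def tensUnit (E : ModSheaf S k U) : HomOn (Algebra.ofId k A) E (E.tens A) U le_rfl le_rfl where
  app V hV := AddMonoidHom.mk' (fun s => E.tensMk hV s 1) fun s t => E.tensMk_add hV s t 1
  app_smulO _ _ _ _ := rfl
  app_smulA V hV c s := by
    change E.tensMk hV (c • s) 1 = algebraMap k A c • E.tensMk hV s 1
    rw [tensMk_smul, tensMk_smulA, Algebra.smul_def]
  app_res _ _ _ := rfl

theorem tensUnit_app (E : ModSheaf S k U) {V : S.Op} (hV : V ≤ U) (s : E.sec V hV) :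
    (E.tensUnit (A := A)).app V hV s = E.tensMk hV s 1 := rfl

theorem smul_tensUnit (E : ModSheaf S k U) {V : S.Op} (hV : V ≤ U) (s : E.sec V hV) (a : A) :
    a • (E.tensUnit (A := A)).app V hV s = E.tensMk hV s a := by
  rw [tensUnit_app, tensMk_smulA, mul_one]

/-- Finitely many germs are represented on a common neighbourhood. -/
theorem exists_germ_fin {B : Type u} [CommRing B] [Algebra k B] (F : ModSheaf S B U) {x : S.X}
    {Y : S.Op} (hY : Y ≤ U) (hx : x ∈ Y) {n : ℕ} (t : Fin n → F.stalk x) :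
    ∃ (V : S.Op) (hV : V ≤ Y) (hxV : x ∈ V) (s : Fin n → F.sec V (hV.trans hY)),
      ∀ l, F.germ (hV.trans hY) x hxV (s l) = t l := by
  obtain ⟨V, hV, hxV, h⟩ := S.exists_common hx (fun l V hV =>
    ∃ s : F.sec V (hV.trans hY), ∀ hxV : x ∈ V, F.germ (hV.trans hY) x hxV s = t l)
    (by
      rintro l W hW W' h ⟨s, hs⟩
      exact ⟨F.res _ h s, fun hx => by rw [F.germ_res, hs]⟩)
    (fun l => by
      obtain ⟨V, hV, hxV, s, hs⟩ := F.exists_germ_le hY hx (t l)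
      exact ⟨V, hV, hxV, s, fun _ => hs⟩)
  choose s hs using h
  exact ⟨V, hV, hxV, s, fun l => hs l hxV⟩

/-- The stalk of `E ⊗ A` at `x` is `E_x ⊗ A`: finitely many germs live on a common neighbourhood,
and there a section of `E ⊗ A` has unique coordinates in the basis of `A`. This gives `E ⊗ A` its
universal property and its flatness. -/
theorem tensUnit_isPullback (E : ModSheaf S k U) : (E.tensUnit (A := A)).IsPullback := by
  intro x hx
  have hsum : ∀ {V : S.Op} (hV : V ≤ U) (hxV : x ∈ V)
      (s : Fin (Module.finrank k A) → E.sec V hV),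
      ∑ l, Module.finBasis k A l • (E.tensUnit (A := A)).stalkMap x hx (E.germ hV x hxV (s l)) =
        (E.tens A).germ hV x hxV (∑ l, E.tensMk hV (s l) (Module.finBasis k A l)) := by
    intro V hV hxV s
    rw [map_sum]
    refine Finset.sum_congr rfl fun l _ => ?_
    rw [HomOn.stalkMap_germ _ hV x hxV, ← map_smul, smul_tensUnit]
  refine isExtension_of_basis A _ _ (fun m hm => ?_) fun p => ?_
  · obtain ⟨V, hV, hxV, s, hs⟩ := E.exists_germ_fin le_rfl hx m
    simp only [← hs] at hm
    rw [hsum] at hm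
    obtain ⟨W, hW, hxW, h0⟩ := (E.tens A).germ_eq_zero _ _ hm
    -- A vanishing germ is a section that vanishes on a smaller `W`, where the coordinates can be
    -- compared with those of `0`.
    have h1 : (fun l => E.res hV hW (s l)) = 0 := by
      refine E.sum_tensMk_inj (A := A) (hW.trans hV) ?_
      rw [map_sum] at h0
      simp only [tensMk_res] at h0
      rw [h0]
      refine (Finset.sum_eq_zero fun l _ => ?_).symm
      exact TensorProduct.zero_tmul _ _
    funext l
    rw [← hs l, ← E.germ_res hV hW x hxW, show E.res hV hW (s l) = 0 from congrFun h1 l, map_zero]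
    rfl
  · obtain ⟨V, hV, hxV, s, rfl⟩ := (E.tens A).exists_germ hx p
    obtain ⟨s, rfl⟩ := E.exists_sum_tensMk hV s
    exact ⟨fun l => E.germ hV x hxV (s l), hsum hV hxV s⟩

/-- The map on sections of `E ⊗ A → E` induced by an augmentation of `A`. -/
def tensAugApp (ε : A →ₐ[k] k) (E : ModSheaf S k U) {V : S.Op} (hV : V ≤ U) :
    (E.tens A).sec V hV →+ E.sec V hV :=
  ((TensorProduct.rid k (E.sec V hV)).toLinearMap ∘ₗ
    ε.toLinearMap.lTensor (E.sec V hV)).toAddMonoidHom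

/-- The morphism `E ⊗ A → E` induced by an augmentation of `A`. -/
def tensAug (ε : A →ₐ[k] k) (E : ModSheaf S k U) : HomOn ε (E.tens A) E U le_rfl le_rfl where
  app V hV := E.tensAugApp ε hV
  app_smulO V hV r t := by
    induction t using tens_induction with
    | tmul s a => exact smul_comm (ε a) r s
    | add x y hx hy => rw [smul_add, map_add, hx, hy, map_add, smul_add]
  app_smulA V hV b t := by
    induction t using tens_induction with
    | tmul s a =>
      change ε (b * a) • s = ε b • ε a • s
      rw [map_mul, mul_smul]
    | add x y hx hy => rw [smul_add, map_add, hx, hy, map_add, smul_add]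
  app_res hV h t := by
    induction t using tens_induction with
    | tmul s a => exact (E.res_smulA hV h (ε a) s).symm
    | add x y hx hy => rw [map_add, map_add, hx, hy, map_add, map_add]

theorem tensAug_tensMk (ε : A →ₐ[k] k) (E : ModSheaf S k U) {V : S.Op} (hV : V ≤ U)
    (s : E.sec V hV) (a : A) : (E.tensAug ε).app V hV (E.tensMk hV s a) = ε a • s := rfl

/-- The composite `E → E ⊗ A → E` is the identity and its first factor is a pullback, hence so is
the second. -/
theorem tensAug_isPullback (ε : A →ₐ[k] k) (E : ModSheaf S k U) : (E.tensAug ε).IsPullback := by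
  have h1 : (HomOn.id E (le_refl U)).IsIso := fun V hV => Function.bijective_id
  refine E.tensUnit_isPullback.of_comp (h1.isPullback fun _ => rfl)
    (fun c => (ε.commutes c).symm) fun V hV s => ?_
  rw [tensUnit_app, tensAug_tensMk, map_one, one_smul]
  rfl

/-- The map on sections of `E ⊗ A → E' ⊗ B` induced by a linear map and a homomorphism `A → B`. -/
def tensMapApp {B : Type u} [CommRing B] [Algebra k B] [Module.Finite k B] (f : A →ₐ[k] B)
    {E : ModSheaf S k U} {E' : ModSheaf S k U'} {V : S.Op} {hE : V ≤ U} {hE' : V ≤ U'}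
    (φ : E.sec V hE →ₗ[k] E'.sec V hE') : (E.tens A).sec V hE →+ (E'.tens B).sec V hE' :=
  (TensorProduct.map φ f.toLinearMap).toAddMonoidHom

/-- A morphism of sheaves as a linear map on sections. -/
def HomOn.appₗ {B : Type u} [CommRing B] [Algebra k B] {F : ModSheaf S B U} {F' : ModSheaf S B U'}
    {W : S.Op} {hF : W ≤ U} {hF' : W ≤ U'} (φ : HomOn (AlgHom.id k B) F F' W hF hF') {V : S.Op}
    (hV : V ≤ W) : F.sec V (hV.trans hF) →ₗ[B] F'.sec V (hV.trans hF') :=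
  { φ.app V hV with map_smul' := φ.app_smulA V hV }

/-- The morphism `E ⊗ A → E' ⊗ B` induced by a morphism `E → E'` and a homomorphism `A → B`. -/
def tensMap {B : Type u} [CommRing B] [Algebra k B] [Module.Finite k B] (f : A →ₐ[k] B)
    {E : ModSheaf S k U} {E' : ModSheaf S k U'} {W : S.Op}
    {hE : W ≤ U} {hE' : W ≤ U'} (φ : HomOn (AlgHom.id k k) E E' W hE hE') :
    HomOn f (E.tens A) (E'.tens B) W hE hE' where
  app V hV := tensMapApp f (φ.appₗ hV)
  app_smulO V hV r t := by
    induction t using tens_induction with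
    | tmul s a => exact congrArg (· ⊗ₜ[k] f a) (φ.app_smulO V hV r s)
    | add x y hx hy => rw [smul_add, map_add, hx, hy, map_add, smul_add]
  app_smulA V hV b t := by
    induction t using tens_induction with
    | tmul s a => exact congrArg (φ.app V hV s ⊗ₜ[k] ·) (map_mul f b a)
    | add x y hx hy => rw [smul_add, map_add, hx, hy, map_add, smul_add]
  app_res hV h t := by
    induction t using tens_induction with
    | tmul s a => exact congrArg (· ⊗ₜ[k] f a) (φ.app_res hV h s)
    | add x y hx hy => rw [map_add, map_add, hx, hy, map_add, map_add]

theorem tensMap_tensMk {B : Type u} [CommRing B] [Algebra k B] [Module.Finite k B] (f : A →ₐ[k] B)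
    {E : ModSheaf S k U} {E' : ModSheaf S k U'} {W : S.Op}
    {hE : W ≤ U} {hE' : W ≤ U'} (φ : HomOn (AlgHom.id k k) E E' W hE hE') {V : S.Op} (hV : V ≤ W)
    (s : E.sec V (hV.trans hE)) (a : A) :
    (tensMap f φ).app V hV (E.tensMk _ s a) = E'.tensMk _ (φ.app V hV s) (f a) := rfl

/-- Cancellation in `E → E ⊗ A → E ⊗ B`, where the first map and the composite are pullbacks. It is
the source of the naturality in `A` of the final bijection. -/
theorem tensMap_id_isPullback {B : Type u} [CommRing B] [Algebra k B] [Module.Finite k B]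
    (f : A →ₐ[k] B) (E : ModSheaf S k U) :
    (tensMap f (HomOn.id E (le_refl U))).IsPullback := by
  refine E.tensUnit_isPullback.of_comp E.tensUnit_isPullback
    (fun c => (f.commutes c).symm) fun V hV s => ?_
  rw [tensUnit_app, tensMap_tensMk, map_one, tensUnit_app]
  rfl

end ModSheaf

end

end TwistedDef

/-! ### Flat modules over an Artin ring whose reduction has a section. -/

namespace TwistedDef

noncomputable section

variable {k : Type u} [Field k]

section SectionOfFlat

variable {A : ArtAlg k} {M N : Type u} [AddCommGroup M] [AddCommGroup N] [Module A.carrier M]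
variable [Module k N] {ℓ : M →+ N} {hℓ : ∀ a m, ℓ (a • m) = A.aug.toRingHom a • ℓ m}

theorem aug_sub_mem (A : ArtAlg k) (a : A.carrier) :
    a - algebraMap k A.carrier (A.aug a) ∈ IsLocalRing.maximalIdeal A.carrier := by
  rw [← A.aug_eq_zero_iff, map_sub, AlgHom.commutes, Algebra.algebraMap_self_apply, sub_self]

/-- The kernel of the reduction `M → M ⊗_A k` is contained in `𝔪 M`. -/
theorem mem_smul_top_of_isExtension_aug (h : IsExtension A.aug.toRingHom ℓ hℓ) {m : M}
    (hm : ℓ m = 0) : m ∈ IsLocalRing.maximalIdeal A.carrier • (⊤ : Submodule A.carrier M) := by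
  -- On `M/𝔪M` an element `a` acts as the constant `A.aug a`, because the two differ by an element
  -- of `𝔪`. So the projection `M → M/𝔪M` factors through `ℓ`.
  obtain ⟨θ, -, hθ⟩ := h.exists_lift (algebraMap k A.carrier)
    (IsLocalRing.maximalIdeal A.carrier • (⊤ : Submodule A.carrier M)).mkQ.toAddMonoidHom
    (fun a m => by
      change Submodule.Quotient.mk (a • m) = Submodule.Quotient.mk (algebraMap k A.carrier (A.aug a) • m)
      rw [Submodule.Quotient.eq, ← sub_smul]
      exact Submodule.smul_mem_smul (aug_sub_mem A a) trivial)
  have := hθ m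
  rw [hm, map_zero] at this
  exact (Submodule.Quotient.mk_eq_zero _).1 this.symm

theorem eq_zero_of_mem_smul_top {m : M}
    (hm : m ∈ IsLocalRing.maximalIdeal A.carrier • (⊤ : Submodule A.carrier M))
    (hℓ : ∀ a m, ℓ (a • m) = A.aug.toRingHom a • ℓ m) : ℓ m = 0 := by
  refine Submodule.smul_induction_on hm (fun a ha n _ => ?_) fun x y hx hy => by
    rw [map_add, hx, hy, add_zero]
  rw [hℓ, show A.aug.toRingHom a = 0 from (A.aug_eq_zero_iff a).2 ha, zero_smul]

/-- Nakayama's lemma for a nilpotent ideal. -/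
theorem eq_top_of_sup_smul_top {R P : Type u} [CommRing R] [AddCommGroup P] [Module R P]
    {J : Ideal R} (hJ : IsNilpotent J) (Q : Submodule R P) (h : Q ⊔ J • ⊤ = ⊤) : Q = ⊤ := by
  have key : ∀ n : ℕ, Q ⊔ J ^ n • (⊤ : Submodule R P) = ⊤ := by
    intro n
    induction n with
    | zero => simp
    | succ n ih =>
      refine eq_top_iff.2 (ih.ge.trans (sup_le le_sup_left ?_))
      calc J ^ n • (⊤ : Submodule R P) = J ^ n • (Q ⊔ J • ⊤) := by rw [h]
        _ = J ^ n • Q ⊔ J ^ (n + 1) • ⊤ := by rw [Submodule.smul_sup, ← mul_smul, ← pow_succ]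
        _ ≤ _ := sup_le_sup_right (Submodule.smul_le.2 fun a _ q hq => Q.smul_mem a hq) _
  obtain ⟨n, hn⟩ := hJ
  have h0 : J ^ n = ⊥ := hn
  have h1 := key n
  rwa [h0, Submodule.bot_smul, sup_bot_eq] at h1

/-- Over a local ring, a family in a flat module is independent if it is independent after tensoring
with the residue field. A relation there lifts to an element of `𝔪M`, which `ℓ` kills, so it gives a
relation between the reductions over `k`. -/
theorem linearIndependent_of_isExtension_aug [Module.Flat A.carrier M]
    (hℓ : ∀ a m, ℓ (a • m) = A.aug.toRingHom a • ℓ m) {ι : Type u} (v : ι → M)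
    (hv : LinearIndependent k (fun j => ℓ (v j))) : LinearIndependent A.carrier v := by
  refine Module.IsLocalRing.linearIndependent_of_flat v ?_
  rw [linearIndependent_iff'] at hv ⊢
  intro s c hc j hj
  choose a ha using fun j => IsLocalRing.residue_surjective (R := A.carrier) (c j)
  have h1 : TensorProduct.mk A.carrier (IsLocalRing.ResidueField A.carrier) M 1
      (∑ j ∈ s, a j • v j) = 0 := by
    rw [map_sum, ← hc]
    refine Finset.sum_congr rfl fun j _ => ?_
    rw [map_smul, ← ha j]
    exact TensorProduct.smul_tmul' _ _ _
  have h1' : ∑ j ∈ s, a j • v j ∈ LinearMap.ker (TensorProduct.mk A.carrier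
      (A.carrier ⧸ IsLocalRing.maximalIdeal A.carrier) M 1) := h1
  rw [LinearMap.ker_tensorProductMk] at h1'
  have h2 := eq_zero_of_mem_smul_top h1' hℓ
  rw [map_sum] at h2
  have h3 := hv s (fun j => A.aug (a j)) (by
    rw [← h2]
    exact Finset.sum_congr rfl fun j _ => (hℓ _ _).symm) j hj
  rw [← ha j, IsLocalRing.residue_eq_zero_iff, ← A.aug_eq_zero_iff]
  exact h3

/-- A `k`-linear section of the reduction of a flat module makes the module an extension of
scalars of its reduction. -/
theorem isExtension_of_section [Module.Flat A.carrier M] (h : IsExtension A.aug.toRingHom ℓ hℓ)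
    (σ : N →+ M) (hσ : ∀ c n, σ (c • n) = (Algebra.ofId k A.carrier).toRingHom c • σ n)
    (hs : ∀ n, ℓ (σ n) = n) : IsExtension (Algebra.ofId k A.carrier).toRingHom σ hσ := by
  have hσ' : ∀ (c : k) n, σ (c • n) = algebraMap k A.carrier c • σ n := hσ
  let b := Module.finBasis k A.carrier
  refine isExtension_of_basis A.carrier σ hσ (fun n hn => ?_) fun p => ?_
  · let e := Module.Basis.ofVectorSpace k N
    have hli : LinearIndependent A.carrier (fun j => σ (e j)) :=
      linearIndependent_of_isExtension_aug hℓ _ (by simpa only [hs] using e.linearIndependent)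
    let c : (Module.Basis.ofVectorSpaceIndex k N →₀ k) →+
        (Module.Basis.ofVectorSpaceIndex k N →₀ A.carrier) :=
      Finsupp.mapRange.addMonoidHom (algebraMap k A.carrier).toAddMonoidHom
    have hc : ∀ f : _ →₀ k, Finsupp.linearCombination A.carrier (fun j => σ (e j)) (c f) =
        σ (Finsupp.linearCombination k e f) := by
      intro f
      induction f using Finsupp.induction_linear with
      | zero => simp
      | add f g hf hg => simp only [map_add, hf, hg]
      | single j x => simp [c, hσ']
    have h0 : ∑ l, b l • c (e.repr (n l)) = 0 := by
      refine hli ?_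
      rw [map_zero, map_sum, ← hn]
      refine Finset.sum_congr rfl fun l _ => ?_
      rw [map_smul, hc, e.linearCombination_repr]
    funext l
    refine e.repr.map_eq_zero_iff.1 (Finsupp.ext fun j => ?_)
    have h1 := DFunLike.congr_fun h0 j
    have h2 : ∑ l, e.repr (n l) j • b l = 0 := by
      rw [Finsupp.finsetSum_apply] at h1
      refine Eq.trans (Finset.sum_congr rfl fun l _ => ?_) h1
      rw [Algebra.smul_def, mul_comm]
      rfl
    exact linearIndependent_iff'.1 b.linearIndependent Finset.univ _ h2 l (Finset.mem_univ l)
  · have hgen : ∀ (a : A.carrier) (n : N), ∃ m : _ → N, ∑ l, b l • σ (m l) = a • σ n := by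
      intro a n
      refine ⟨fun l => b.repr a l • n, ?_⟩
      conv_rhs => rw [← b.sum_repr a, Finset.sum_smul]
      refine Finset.sum_congr rfl fun l _ => ?_
      rw [hσ', smul_smul, Algebra.smul_def, mul_comm]
    have hadd : ∀ x y : M, (∃ m : _ → N, ∑ l, b l • σ (m l) = x) →
        (∃ m : _ → N, ∑ l, b l • σ (m l) = y) → ∃ m : _ → N, ∑ l, b l • σ (m l) = x + y := by
      rintro _ _ ⟨m, rfl⟩ ⟨m', rfl⟩
      exact ⟨m + m', by simp [smul_add, Finset.sum_add_distrib]⟩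
    have hzero : ∃ m : _ → N, ∑ l, b l • σ (m l) = 0 := ⟨0, by simp⟩
    -- Every `m` is `σ (ℓ m)` plus an element of `ker ℓ ⊆ 𝔪M`, so Nakayama's lemma applies to the
    -- span of the image of `σ`.
    have htop : Submodule.span A.carrier (Set.range σ) = ⊤ := by
      refine eq_top_of_sup_smul_top A.isNilpotent_maximalIdeal _ (eq_top_iff.2 fun m _ => ?_)
      rw [← add_sub_cancel (σ (ℓ m)) m]
      refine Submodule.add_mem_sup (Submodule.subset_span ⟨_, rfl⟩)
        (mem_smul_top_of_isExtension_aug h ?_)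
      rw [map_sub, hs, sub_self]
    have hp : p ∈ Submodule.span A.carrier (Set.range σ) := htop ▸ trivial
    induction hp using Submodule.span_induction with
    | mem x hx =>
      obtain ⟨n, rfl⟩ := hx
      simpa using hgen 1 n
    | zero => exact hzero
    | add x y _ _ hx hy => exact hadd x y hx hy
    | smul a x _ hx =>
      obtain ⟨m, rfl⟩ := hx
      rw [Finset.smul_sum]
      refine Finset.sum_induction _ (fun x => ∃ m : _ → N, ∑ l, b l • σ (m l) = x) hadd hzero
        fun l _ => ?_
      rw [smul_smul]
      exact hgen _ _

end SectionOfFlat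

namespace ModSheaf

variable {S : KSpace k} {U U' : S.Op}

/-- An `O`-linear section of the reduction of a flat deformation exhibits the deformation as a
pullback. -/
theorem isPullback_of_section {A : ArtAlg k} {E : ModSheaf S k U} {F : ModSheaf S A.carrier U'}
    {W : S.Op} {hE : W ≤ U} {hF : W ≤ U'} (hflat : ∀ x ∈ W, Module.Flat A.carrier (F.stalk x))
    {h : HomOn A.aug F E W hF hE} (hh : h.IsPullback)
    (σ : HomOn (Algebra.ofId k A.carrier) E F W hE hF)
    (hs : ∀ V hV s, h.app V hV (σ.app V hV s) = s) : σ.IsPullback := by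
  intro x hx
  have := hflat x hx
  refine isExtension_of_section (hh x hx) _ _ fun t => ?_
  obtain ⟨V, hV, hxV, s, rfl⟩ := E.exists_germ_le hE hx t
  rw [HomOn.stalkMap_germ _ hV x hxV, HomOn.stalkMap_germ _ hV x hxV, hs]

/-- A deformation whose reduction has an `O`-linear section is trivial. -/
theorem exists_iso_tens_of_section {A : ArtAlg k} {E : ModSheaf S k U}
    {F : ModSheaf S A.carrier U'} {W : S.Op} {hE : W ≤ U} {hF : W ≤ U'}
    (hflat : ∀ x ∈ W, Module.Flat A.carrier (F.stalk x))
    {h : HomOn A.aug F E W hF hE} (hh : h.IsPullback)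
    (σ : HomOn (Algebra.ofId k A.carrier) E F W hE hF)
    (hs : ∀ V hV s, h.app V hV (σ.app V hV s) = s) :
    ∃ φ : HomOn (AlgHom.id k A.carrier) (E.tens A.carrier) F W hE hF, φ.IsIso ∧
      (∀ V hV s, φ.app V hV (E.tensMk (hV.trans hE) s 1) = σ.app V hV s) ∧
      ∀ V hV t, h.app V hV (φ.app V hV t) = (E.tensAug A.aug).app V (hV.trans hE) t := by
  have hu := E.tensUnit_isPullback (A := A.carrier) |>.restrict hE
  -- `φ` is the `A`-linear extension of `σ`. Since `E → E ⊗ A` and `σ` are both pullbacks so is `φ`,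
  -- and a pullback along the identity of `A` is an isomorphism.
  obtain ⟨φ, hφ⟩ := hu.exists_desc (g := AlgHom.id k A.carrier) σ (fun _ => rfl)
  have hφ' : ∀ V hV s, φ.app V hV (E.tensMk (hV.trans hE) s 1) = σ.app V hV s := hφ
  have hp : φ.IsPullback := hu.of_comp (isPullback_of_section hflat hh σ hs)
    (fun _ => rfl) hφ
  refine ⟨φ, hp.isIso, hφ', fun V hV t => ?_⟩
  induction t using tens_induction with
  | tmul s a =>
    rw [← smul_tensUnit, φ.app_smulA, tensUnit_app, hφ', h.app_smulA, hs, tensMk_smulA, mul_one,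
      tensAug_tensMk, AlgHom.id_apply]
  | add x y hx hy => rw [map_add, map_add, hx, hy, map_add]

end ModSheaf

end

end TwistedDef

/-! ### Gluing of morphisms, Hom and kernel sheaves, frames. -/

namespace TwistedDef

noncomputable section

variable {k : Type u} [Field k]

namespace ModSheaf

variable {S : KSpace k} {A B : Type u} [CommRing A] [CommRing B] [Algebra k A] [Algebra k B]
variable {U U' : S.Op}

/-- Sections that agree on an open cover are equal. -/
theorem ext_cover (F : ModSheaf S A U) {V : S.Op} (hV : V ≤ U) {ι : Type u} (W : ι → S.Op)
    (hc : V ≤ ⨆ i, W i) {s t : F.sec V hV}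
    (h : ∀ i, F.res hV (inf_le_left : V ⊓ W i ≤ V) s = F.res hV (inf_le_left : V ⊓ W i ≤ V) t) :
    s = t := by
  refine F.ext_local hV fun x hx => ?_
  obtain ⟨i, hi⟩ := Opens.mem_iSup.1 (hc hx)
  exact ⟨V ⊓ W i, inf_le_left, S.mem_inf hx hi, h i⟩

namespace HomOn

variable {f : A →ₐ[k] B} {F : ModSheaf S A U} {G : ModSheaf S B U'} {W : S.Op}
variable {hF : W ≤ U} {hG : W ≤ U'}

/-- Morphisms of sheaves that are given on an open cover and agree on the overlaps glue. -/
theorem exists_glue {ι : Type u} (Y : ι → S.Op) (hY : ∀ a, Y a ≤ W) (hc : W ≤ ⨆ a, Y a)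
    (φ : ∀ a, HomOn f F G (Y a) ((hY a).trans hF) ((hY a).trans hG))
    (hφ : ∀ a b V (ha : V ≤ Y a) (hb : V ≤ Y b) s, (φ a).app V ha s = (φ b).app V hb s) :
    ∃ ψ : HomOn f F G W hF hG, ∀ a V (ha : V ≤ Y a) s,
      ψ.app V (ha.trans (hY a)) s = (φ a).app V ha s := by
  have hcV : ∀ V ≤ W, V ≤ ⨆ a, V ⊓ Y a := fun V hV => by
    rw [← inf_iSup_eq]; exact le_inf le_rfl (hV.trans hc)
  -- The value on `s` is glued from the values of the `φ a` on the restrictions of `s`. Every axiom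
  -- for `ψ` then follows from that for the `φ a`, by restricting to the cover.
  choose ψ hψ using fun (V : S.Op) (hV : V ≤ W) (s : F.sec V (hV.trans hF)) =>
    (G.exists_unique_glue (hV.trans hG) (fun a => V ⊓ Y a) (fun a => inf_le_left) (hcV V hV)
      (fun a => (φ a).app (V ⊓ Y a) inf_le_right (F.res (hV.trans hF) inf_le_left s))
      (fun a b => by
        rw [← (φ a).app_res, ← (φ b).app_res, F.res_res, F.res_res]
        exact hφ a b _ _ _ _)).exists
  have ext : ∀ (V : S.Op) (hV : V ≤ W) (s t : G.sec V (hV.trans hG)),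
      (∀ a, G.res (hV.trans hG) (inf_le_left : V ⊓ Y a ≤ V) s =
        G.res (hV.trans hG) (inf_le_left : V ⊓ Y a ≤ V) t) → s = t :=
    fun V hV s t h => G.ext_cover _ Y (hV.trans hc) h
  refine ⟨⟨fun V hV => AddMonoidHom.mk' (ψ V hV) fun s t => ?_, fun V hV r s => ?_,
    fun V hV a s => ?_, fun {V V'} hV h s => ?_⟩, fun a V ha s => ?_⟩
  · refine ext V hV _ _ fun a => ?_
    rw [map_add, hψ, hψ, hψ, map_add, map_add]
  · refine ext V hV _ _ fun a => ?_
    change G.res _ _ (ψ V hV (r • s)) = G.res _ _ (r • ψ V hV s)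
    rw [G.res_smulO, hψ, hψ, F.res_smulO, (φ a).app_smulO]
  · refine ext V hV _ _ fun b => ?_
    change G.res _ _ (ψ V hV (a • s)) = G.res _ _ (f a • ψ V hV s)
    rw [G.res_smulA, hψ, hψ, F.res_smulA, (φ b).app_smulA]
  · refine ext V' (h.trans hV) _ _ fun a => ?_
    change G.res _ _ (ψ V' _ (F.res _ h s)) = G.res _ _ (G.res _ h (ψ V hV s))
    rw [hψ, G.res_res, F.res_res,
      ← G.res_res (hV.trans hG) (inf_le_left : V ⊓ Y a ≤ V) (inf_le_inf_right (Y a) h), hψ,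
      ← (φ a).app_res, F.res_res]
  · refine ext V (ha.trans (hY a)) _ _ fun b => ?_
    change G.res _ _ (ψ V (ha.trans (hY a)) s) = _
    rw [hψ, ← (φ a).app_res]
    exact hφ b a _ _ _ _

instance : Zero (HomOn f F G W hF hG) where
  zero :=
    { app := fun _ _ => 0
      app_smulO := fun _ _ r _ => (smul_zero r).symm
      app_smulA := fun _ _ a _ => (smul_zero (f a)).symm
      app_res := fun _ _ _ => (map_zero _).symm }

instance : Add (HomOn f F G W hF hG) where
  add φ ψ :=
    { app := fun V hV => φ.app V hV + ψ.app V hV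
      app_smulO := fun V hV r s => by
        simp only [AddMonoidHom.add_apply, φ.app_smulO, ψ.app_smulO, smul_add]
      app_smulA := fun V hV a s => by
        simp only [AddMonoidHom.add_apply, φ.app_smulA, ψ.app_smulA, smul_add]
      app_res := fun hV h s => by
        rw [AddMonoidHom.add_apply, AddMonoidHom.add_apply, φ.app_res, ψ.app_res, map_add] }

instance : Neg (HomOn f F G W hF hG) where
  neg φ :=
    { app := fun V hV => -φ.app V hV
      app_smulO := fun V hV r s => by simp only [AddMonoidHom.neg_apply, φ.app_smulO, smul_neg]
      app_smulA := fun V hV a s => by simp only [AddMonoidHom.neg_apply, φ.app_smulA, smul_neg]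
      app_res := fun hV h s => by
        rw [AddMonoidHom.neg_apply, AddMonoidHom.neg_apply, φ.app_res, map_neg] }

theorem add_app (φ ψ : HomOn f F G W hF hG) (V : S.Op) (hV : V ≤ W) :
    (φ + ψ).app V hV = φ.app V hV + ψ.app V hV := rfl

theorem zero_app (V : S.Op) (hV : V ≤ W) : (0 : HomOn f F G W hF hG).app V hV = 0 := rfl

theorem neg_app (φ : HomOn f F G W hF hG) (V : S.Op) (hV : V ≤ W) :
    (-φ).app V hV = -φ.app V hV := rfl

instance : AddCommGroup (HomOn f F G W hF hG) :=
  { AddGroup.ofLeftAxioms (G := HomOn f F G W hF hG)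
      (fun φ ψ χ => by ext; simp only [add_app, add_assoc])
      (fun φ => by ext; simp only [add_app, zero_app, zero_add])
      (fun φ => by ext; simp only [add_app, neg_app, zero_app, neg_add_cancel]) with
    add_comm := fun φ ψ => by ext; simp only [add_app, add_comm] }

theorem sub_app (φ ψ : HomOn f F G W hF hG) (V : S.Op) (hV : V ≤ W) :
    (φ - ψ).app V hV = φ.app V hV - ψ.app V hV := by
  rw [sub_eq_add_neg, sub_eq_add_neg, add_app, neg_app]

/-- Evaluation of morphisms of sheaves at a section. -/
def evalAt {V : S.Op} (hV : V ≤ W) (s : F.sec V (hV.trans hF)) :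
    HomOn f F G W hF hG →+ G.sec V (hV.trans hG) where
  toFun φ := φ.app V hV s
  map_zero' := rfl
  map_add' _ _ := rfl

instance : Module (S.O W) (HomOn f F G W hF hG) where
  smul := HomOn.smul
  one_smul φ := by
    ext V hV s
    change S.res hV 1 • φ.app V hV s = φ.app V hV s
    rw [map_one, one_smul]
  mul_smul r r' φ := by
    ext V hV s
    change S.res hV (r * r') • φ.app V hV s = S.res hV r • S.res hV r' • φ.app V hV s
    rw [map_mul, mul_smul]
  smul_zero r := by
    ext V hV s
    exact smul_zero (S.res hV r)
  smul_add r φ ψ := by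
    ext V hV s
    exact smul_add (S.res hV r) _ _
  add_smul r r' φ := by
    ext V hV s
    change S.res hV (r + r') • φ.app V hV s = S.res hV r • φ.app V hV s + S.res hV r' • φ.app V hV s
    rw [map_add, add_smul]
  zero_smul φ := by
    ext V hV s
    change S.res hV 0 • φ.app V hV s = 0
    rw [map_zero, zero_smul]

end HomOn

/-- The sheaf of `O`-linear morphisms between two sheaves of `O`-modules. -/
def homSheaf (E K : ModSheaf S k U) : ModSheaf S k U where
  sec V hV := HomOn (AlgHom.id k k) E K V hV hV
  modA V hV := Module.compHom _ (algebraMap k (S.O V))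
  comm V hV :=
    letI : Module k (HomOn (AlgHom.id k k) E K V hV hV) := Module.compHom _ (algebraMap k (S.O V))
    ⟨fun r c φ => smul_comm r (algebraMap k (S.O V) c) φ⟩
  smul_const V hV c φ := rfl
  res hV h := AddMonoidHom.mk' (fun φ => φ.restrict h) fun _ _ => rfl
  res_smulO {V W} hV h r φ := by
    ext Y hY s
    change S.res (hY.trans h) r • φ.app Y (hY.trans h) s =
      S.res hY (S.res h r) • φ.app Y (hY.trans h) s
    rw [S.res_res]
  res_smulA {V W} hV h c φ := by
    ext Y hY s
    change S.res (hY.trans h) (algebraMap k (S.O V) c) • φ.app Y (hY.trans h) s =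
      S.res hY (algebraMap k (S.O W) c) • φ.app Y (hY.trans h) s
    rw [S.res_algebraMap, S.res_algebraMap]
  res_self _ _ := rfl
  res_res _ _ _ _ := rfl
  exists_unique_glue {V} hV ι W hW hc φ hφ := by
    obtain ⟨ψ, hψ⟩ := HomOn.exists_glue (hF := hV) (hG := hV) W hW hc φ
      fun a b Y ha hb s => DFunLike.congr_fun
        (congrFun (congrFun (congrArg HomOn.app (hφ a b)) Y) (le_inf ha hb)) s
    refine ⟨ψ, fun a => HomOn.ext (funext fun Y => funext fun hY => AddMonoidHom.ext fun s =>
      hψ a Y hY s), fun χ hχ => HomOn.ext (funext fun Y => funext fun hY =>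
      AddMonoidHom.ext fun s => ?_)⟩
    refine K.ext_cover _ W (hY.trans hc) fun a => ?_
    rw [← HomOn.app_res, ← HomOn.app_res, hψ a _ inf_le_right, ← hχ a]
    rfl

/-- A morphism of sheaves as an `O`-linear map on sections. -/
def HomOn.appO {f : A →ₐ[k] B} {F : ModSheaf S A U} {G : ModSheaf S B U'} {W : S.Op} {hF : W ≤ U}
    {hG : W ≤ U'} (φ : HomOn f F G W hF hG) {V : S.Op} (hV : V ≤ W) :
    F.sec V (hV.trans hF) →ₗ[S.O V] G.sec V (hV.trans hG) :=
  { φ.app V hV with map_smul' := φ.app_smulO V hV }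

/-- The kernel of a morphism of sheaves, as a sheaf of `O`-modules. -/
def kerSheaf {f : A →ₐ[k] B} {F : ModSheaf S A U} {G : ModSheaf S B U}
    (h : HomOn f F G U le_rfl le_rfl) : ModSheaf S k U where
  sec V hV := LinearMap.ker (h.appO hV)
  -- The action of `A` is dropped and only the constants act: the kernel serves as a sheaf of
  -- `O`-modules whose `H¹` is to vanish.
  modA V hV := Module.compHom _ (algebraMap k (S.O V))
  comm V hV :=
    letI : Module k (LinearMap.ker (h.appO hV)) := Module.compHom _ (algebraMap k (S.O V))
    ⟨fun r c s => smul_comm r (algebraMap k (S.O V) c) s⟩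
  smul_const V hV c s := rfl
  res hV hW := AddMonoidHom.mk' (fun s => ⟨F.res hV hW s.1, by
      have h1 : h.app _ hV s.1 = 0 := s.2
      change h.app _ (hW.trans hV) (F.res hV hW s.1) = 0
      rw [h.app_res hV hW, h1, map_zero]⟩) fun _ _ => Subtype.ext (map_add _ _ _)
  res_smulO hV hW r s := Subtype.ext (F.res_smulO hV hW r s.1)
  res_smulA {V W} hV hW c s := Subtype.ext (by
    change F.res hV hW (algebraMap k (S.O V) c • s.1) = algebraMap k (S.O W) c • F.res hV hW s.1
    rw [F.res_smulO, S.res_algebraMap])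
  res_self hV s := Subtype.ext (F.res_self hV s.1)
  res_res hV h1 h2 s := Subtype.ext (F.res_res hV h1 h2 s.1)
  exists_unique_glue {V} hV ι W hW hc s hs := by
    obtain ⟨t, ht, htu⟩ := F.exists_unique_glue hV W hW hc (fun i => (s i).1)
      fun i j => congrArg Subtype.val (hs i j)
    refine ⟨⟨t, ?_⟩, fun i => Subtype.ext (ht i), fun t' ht' =>
      Subtype.ext (htu t'.1 fun i => congrArg Subtype.val (ht' i))⟩
    refine G.ext_local hV fun x hx => ?_
    obtain ⟨i, hi⟩ := Opens.mem_iSup.1 (hc hx)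
    refine ⟨W i, hW i, hi, ?_⟩
    change G.res hV _ (h.app V hV t) = G.res hV _ 0
    rw [← h.app_res, ht i, map_zero]
    exact (s i).2

/-- The inclusion of the kernel. -/
def kerIncl {f : A →ₐ[k] B} {F : ModSheaf S A U} {G : ModSheaf S B U}
    (h : HomOn f F G U le_rfl le_rfl) :
    HomOn (Algebra.ofId k A) (kerSheaf h) F U le_rfl le_rfl where
  app _ hV := (LinearMap.ker (h.appO hV)).subtype.toAddMonoidHom
  app_smulO _ _ _ _ := rfl
  app_smulA V hV c s := F.smul_const V hV c s.1
  app_res _ _ _ := rfl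

/-- Sections `s_i` over `W` form a frame of `F` over `W` if they induce an isomorphism
from a free `O`-module to `F`. -/
def IsFrame {ι : Type*} [Fintype ι] (F : ModSheaf S k U) {W : S.Op} (hW : W ≤ U)
    (s : ι → F.sec W hW) : Prop :=
  ∀ (V : S.Op) (hV : V ≤ W), Function.Bijective
    (fun c : ι → S.O V => ∑ i, c i • F.res hW hV (s i))

namespace IsFrame

variable {ι ι' : Type*} [Fintype ι] [Fintype ι'] {E : ModSheaf S k U} {W : S.Op} {hW : W ≤ U}
variable {s : ι → E.sec W hW}

theorem restrict (hs : E.IsFrame hW s) {W' : S.Op} (h : W' ≤ W) :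
    E.IsFrame (h.trans hW) (fun i => E.res hW h (s i)) := fun V hV => by
  simpa only [E.res_res] using hs V (hV.trans h)

theorem reindex (hs : E.IsFrame hW s) (e : ι' ≃ ι) : E.IsFrame hW (s ∘ e) := fun V hV => by
  have h1 := (hs V hV).comp (Equiv.arrowCongr e (Equiv.refl (S.O V))).bijective
  refine cast (congrArg Function.Bijective (funext fun c => ?_)) h1
  refine (Fintype.sum_equiv e _ _ fun i => ?_).symm
  simp

/-- Morphisms out of a free sheaf are determined by their values on a frame. -/
theorem hom_ext (hs : E.IsFrame hW s) {f : k →ₐ[k] A} {G : ModSheaf S A U'} {V : S.Op}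
    (hV : V ≤ W) {hG : V ≤ U'} {φ ψ : HomOn f E G V (hV.trans hW) hG}
    (h : ∀ i, φ.app V le_rfl (E.res hW hV (s i)) = ψ.app V le_rfl (E.res hW hV (s i))) :
    φ = ψ := by
  ext Y hY t
  obtain ⟨c, rfl⟩ := (hs Y (hY.trans hV)).2 t
  simp only [map_sum, HomOn.app_smulO]
  refine Finset.sum_congr rfl fun i _ => ?_
  rw [← E.res_res hW hV hY]
  exact congrArg (c i • ·) ((φ.app_res le_rfl hY _).trans
    ((congrArg (G.res _ hY) (h i)).trans (ψ.app_res le_rfl hY _).symm))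

/-- A morphism out of a free sheaf can be prescribed on a frame. -/
theorem exists_hom (hs : E.IsFrame hW s) (f : k →ₐ[k] A) {G : ModSheaf S A U'} (hG : W ≤ U')
    (t : ι → G.sec W hG) :
    ∃ φ : HomOn f E G W hW hG, ∀ V hV i, φ.app V hV (E.res hW hV (s i)) = G.res hG hV (t i) := by
  choose c hc using fun V hV => (hs V hV).2
  have inj : ∀ V hV {c c' : ι → S.O V}, ∑ i, c i • E.res hW hV (s i) =
      ∑ i, c' i • E.res hW hV (s i) → c = c' := fun V hV _ _ h => (hs V hV).1 h
  have hc' : ∀ V hV (d : ι → S.O V), c V hV (∑ i, d i • E.res hW hV (s i)) = d :=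
    fun V hV d => inj V hV (hc V hV _)
  -- The value at `p` may be computed with any expression of `p` in the frame. Each axiom below
  -- amounts to exhibiting a suitable expression.
  have key : ∀ V (hV : V ≤ W) (d : ι → S.O V) (p : E.sec V (hV.trans hW)),
      p = ∑ i, d i • E.res hW hV (s i) →
      ∑ i, c V hV p i • G.res hG hV (t i) = ∑ i, d i • G.res hG hV (t i) := by
    rintro V hV d _ rfl
    rw [hc']
  refine ⟨⟨fun V hV => AddMonoidHom.mk' (fun p => ∑ i, c V hV p i • G.res hG hV (t i))
    fun p q => ?_, fun V hV r p => ?_, fun V hV a p => ?_, fun {V V'} hV h p => ?_⟩,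
    fun V hV i => ?_⟩
  · rw [key V hV (c V hV p + c V hV q) _ ?_, ← Finset.sum_add_distrib]
    · simp only [Pi.add_apply, add_smul]
    · simp only [Pi.add_apply, add_smul, Finset.sum_add_distrib]
      exact congrArg₂ (· + ·) (hc V hV p).symm (hc V hV q).symm
  · change ∑ i, c V hV (r • p) i • _ = r • ∑ i, c V hV p i • _
    rw [key V hV (r • c V hV p) _ ?_, Finset.smul_sum]
    · simp only [Pi.smul_apply, smul_assoc]
    · simp only [Pi.smul_apply, smul_assoc, ← Finset.smul_sum]
      exact congrArg (r • ·) (hc V hV p).symm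
  · change ∑ i, c V hV (a • p) i • _ = f a • ∑ i, c V hV p i • _
    -- Linearity over `k` is a case of linearity over `O`, since on both sides `k` acts through the
    -- constant functions.
    have e1 : a • p = algebraMap k (S.O V) a • p := (E.smul_const V _ a p).symm
    have e2 : f a = algebraMap k A a := f.commutes a
    rw [e1, key V hV (algebraMap k (S.O V) a • c V hV p) _ ?_, e2, ← G.smul_const,
      Finset.smul_sum]
    · simp only [Pi.smul_apply, smul_assoc]
    · simp only [Pi.smul_apply, smul_assoc, ← Finset.smul_sum]
      exact congrArg (algebraMap k (S.O V) a • ·) (hc V hV p).symm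
  · change ∑ i, c V' _ (E.res _ h p) i • _ = G.res _ h (∑ i, c V hV p i • _)
    rw [key V' (h.trans hV) (fun i => S.res h (c V hV p i)) _ ?_, map_sum]
    · simp only [G.res_smulO, G.res_res]
    · conv_lhs => rw [← hc V hV p]
      simp only [map_sum, E.res_smulO, E.res_res]
  · classical
    change ∑ j, c V hV (E.res hW hV (s i)) j • _ = _
    rw [key V hV (Pi.single i 1) _ ?_]
    · simp [Pi.single_apply, ite_smul]
    · simp [Pi.single_apply, ite_smul]

/-- The frame of the sheaf of morphisms between two free sheaves. -/
theorem exists_homSheaf {K : ModSheaf S k U} {κ : ι' → K.sec W hW} (hs : E.IsFrame hW s)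
    (hκ : K.IsFrame hW κ) :
    ∃ ψ : ι × ι' → (homSheaf E K).sec W hW, (homSheaf E K).IsFrame hW ψ := by
  classical
  -- The elementary matrices: `ψ (i, j)` sends `s i` to `κ j` and the other elements of the frame to
  -- `0`.
  choose ψ hψ using fun p : ι × ι' => hs.exists_hom (AlgHom.id k k) hW (G := K)
    (Pi.single p.1 (κ p.2))
  have hval : ∀ (V : S.Op) (hV : V ≤ W) (c : ι × ι' → S.O V) (i : ι),
      HomOn.app (∑ p, c p • (homSheaf E K).res hW hV (ψ p) : HomOn (AlgHom.id k k) E K V _ _) V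
        le_rfl (E.res hW hV (s i)) = ∑ j, c (i, j) • K.res hW hV (κ j) := by
    intro V hV c i
    refine (map_sum (HomOn.evalAt (f := AlgHom.id k k) (G := K) (hG := hV.trans hW)
      (le_refl V) (E.res hW hV (s i))) (fun p =>
      (c p • (homSheaf E K).res hW hV (ψ p) : HomOn (AlgHom.id k k) E K V _ _))
      Finset.univ).trans ?_
    rw [Fintype.sum_prod_type, Finset.sum_eq_single i]
    · refine Finset.sum_congr rfl fun j _ => ?_
      change S.res le_rfl (c (i, j)) • (ψ (i, j)).app V hV (E.res hW hV (s i)) = _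
      rw [S.res_self, hψ, Pi.single_eq_same]
    · intro i' _ hi'
      refine Finset.sum_eq_zero fun j _ => ?_
      change S.res le_rfl (c (i', j)) • (ψ (i', j)).app V hV (E.res hW hV (s i)) = _
      rw [hψ, Pi.single_eq_of_ne (Ne.symm hi'), map_zero, smul_zero]
    · simp
  refine ⟨ψ, fun V hV => ⟨fun c c' h => ?_, fun φ => ?_⟩⟩
  · funext ⟨i, j⟩
    have h1 := DFunLike.congr_fun (congrFun (congrFun (congrArg HomOn.app h) V) le_rfl)
      (E.res hW hV (s i))
    have h2 := ((hval V hV c i).symm.trans h1).trans (hval V hV c' i)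
    exact congrFun ((hκ V hV).1 h2) j
  · choose c hc using fun i => (hκ V hV).2 (HomOn.app φ V le_rfl (E.res hW hV (s i)))
    refine ⟨fun p => c p.1 p.2, hs.hom_ext hV fun i => ?_⟩
    exact (hval V hV _ i).trans (hc i)

end IsFrame

/-- The frames that occur for Hom sheaves and kernels are indexed by products, whereas
`IsLocallyFree` asks for an index set `Fin n`. -/
theorem isLocallyFree_of_frames {F : ModSheaf S k U}
    (h : ∀ x ∈ U, ∃ (W : S.Op) (hW : W ≤ U), x ∈ W ∧ ∃ (ι : Type) (_ : Fintype ι)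
      (s : ι → F.sec W hW), F.IsFrame hW s) : F.IsLocallyFree := fun x hx => by
  obtain ⟨W, hW, hxW, ι, _, s, hs⟩ := h x hx
  exact ⟨W, hW, hxW, Fintype.card ι, _, hs.reindex (Fintype.equivFin ι).symm⟩

end ModSheaf

end

end TwistedDef

/-! ### Deformations of a locally free sheaf are trivial when `H¹` vanishes. -/

namespace TwistedDef

noncomputable section

variable {k : Type u} [Field k]

section KernelCoordinates

variable {A M : Type u} [CommRing A] [Algebra k A] [Module.Finite k A] [AddCommGroup M] [Module k M]
variable (ε : A →ₐ[k] k)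

/-- By right exactness of `M ⊗ -`, the kernel of `M ⊗ A → M` is the image of `M ⊗ ker ε`; an element
of the latter is then expanded in a basis of `ker ε`. -/
theorem exists_coords_ker {t : M ⊗[k] A}
    (ht : TensorProduct.rid k M (ε.toLinearMap.lTensor M t) = 0) :
    ∃ m : Fin (Module.finrank k (LinearMap.ker ε.toLinearMap)) → M,
      ∑ l, m l ⊗ₜ[k] (Module.finBasis k (LinearMap.ker ε.toLinearMap) l : A) = t := by
  have hsurj : Function.Surjective ε.toLinearMap := fun c => ⟨algebraMap k A c, ε.commutes c⟩
  have hex := lTensor_exact M (LinearMap.exact_subtype_ker_map ε.toLinearMap) hsurj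
  obtain ⟨w, rfl⟩ := (hex t).1 ((TensorProduct.rid k M).map_eq_zero_iff.1 ht)
  refine ⟨coords _ M w, ?_⟩
  conv_rhs => rw [← sum_coords _ w, map_sum]
  rfl

/-- `M` is flat over the field `k`, so `M ⊗ ker ε → M ⊗ A` is injective, and coordinates in `M ⊗ ker
ε` are unique. -/
theorem coords_ker_unique {m m' : Fin (Module.finrank k (LinearMap.ker ε.toLinearMap)) → M}
    (h : ∑ l, m l ⊗ₜ[k] (Module.finBasis k (LinearMap.ker ε.toLinearMap) l : A) =
      ∑ l, m' l ⊗ₜ[k] (Module.finBasis k (LinearMap.ker ε.toLinearMap) l : A)) : m = m' := by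
  have hinj := Module.Flat.lTensor_preserves_injective_linearMap (M := M)
    (LinearMap.ker ε.toLinearMap).subtype Subtype.val_injective
  rw [← coords_sum (LinearMap.ker ε.toLinearMap) m, ← coords_sum (LinearMap.ker ε.toLinearMap) m']
  refine congrArg (coords _ M) (hinj ?_)
  rw [map_sum, map_sum]
  exact h

end KernelCoordinates

/-- `N` is spanned over `k` by the image of `ℓ`, and scalars of `k` lift to `A`. -/
theorem surjective_of_isExtension_aug {A : ArtAlg k} {M N : Type u} [AddCommGroup M]
    [AddCommGroup N] [Module A.carrier M] [Module k N] {ℓ : M →+ N}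
    {hℓ : ∀ a m, ℓ (a • m) = A.aug.toRingHom a • ℓ m} (h : IsExtension A.aug.toRingHom ℓ hℓ) :
    Function.Surjective ℓ := by
  refine h.induct (fun n => ∃ m, ℓ m = n) ⟨0, map_zero _⟩ (fun c m => ?_) ?_
  · refine ⟨algebraMap k A.carrier c • m, ?_⟩
    rw [hℓ]
    congr 1
    exact A.aug.commutes c
  · rintro _ _ ⟨m, rfl⟩ ⟨m', rfl⟩
    exact ⟨m + m', map_add _ _ _⟩

namespace ModSheaf

variable {S : KSpace k} {U : S.Op} {A : ArtAlg k} {E : ModSheaf S k U}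
variable {F : ModSheaf S A.carrier U} {h : HomOn A.aug F E U le_rfl le_rfl}

/-- Locally, a deformation of a locally free sheaf has an `O`-linear section. -/
theorem exists_local_section (hE : E.IsLocallyFree) (hh : h.IsPullback) {x : S.X} (hx : x ∈ U) :
    ∃ (W : S.Op) (hW : W ≤ U), x ∈ W ∧ ∃ (n : ℕ) (s : Fin n → E.sec W hW), E.IsFrame hW s ∧
      ∃ σ : HomOn (Algebra.ofId k A.carrier) E F W hW hW, ∀ V (hV : V ≤ W) s,
        h.app V (hV.trans hW) (σ.app V hV s) = s := by
  obtain ⟨W₀, hW₀, hx₀, n, s, hs⟩ := hE x hx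
  obtain ⟨W, hW, hxW, hl⟩ := S.exists_common hx₀ (fun i W hW => ∃ t : F.sec W (hW.trans hW₀),
      h.app W (hW.trans hW₀) t = E.res hW₀ hW (s i))
    (by
      rintro i W hW W' h' ⟨t, ht⟩
      exact ⟨F.res _ h' t, by rw [h.app_res (hW.trans hW₀) h', ht, E.res_res]⟩)
    (fun i => by
      -- The reduction is onto on stalks, so each element of the frame lifts near `x`; a frame is
      -- finite, so one neighbourhood serves for all of them.
      obtain ⟨τ, hτ⟩ := surjective_of_isExtension_aug (hh x hx) (E.germ hW₀ x hx₀ (s i))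
      obtain ⟨V, hV, hxV, t, rfl⟩ := F.exists_germ_le hW₀ hx₀ τ
      rw [h.stalkMap_germ (hV.trans hW₀) x hxV, ← E.germ_res hW₀ hV x hxV] at hτ
      obtain ⟨Y, hY, hxY, e⟩ := E.germ_eq _ _ hτ
      refine ⟨Y, hY.trans hV, hxY, F.res _ hY t, ?_⟩
      rw [h.app_res (hV.trans hW₀) hY, e, E.res_res])
  choose t ht using hl
  have hs' : E.IsFrame (hW.trans hW₀) (fun i => E.res hW₀ hW (s i)) :=
    IsFrame.restrict (s := s) hs hW
  obtain ⟨σ, hσ⟩ := hs'.exists_hom (Algebra.ofId k A.carrier) (hW.trans hW₀) t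
  refine ⟨W, hW.trans hW₀, hxW, n, _, hs', σ, fun V hV p => ?_⟩
  obtain ⟨c, rfl⟩ := (hs' V hV).2 p
  simp only [map_sum, HomOn.app_smulO, hσ, h.app_res (hW.trans hW₀) hV, ht]

/-- The kernel of the reduction of a flat deformation of a locally free sheaf is a locally free
`O`-module. -/
theorem isLocallyFree_kerSheaf (hE : E.IsLocallyFree)
    (hflat : ∀ x ∈ U, Module.Flat A.carrier (F.stalk x)) (hh : h.IsPullback) :
    (kerSheaf h).IsLocallyFree := by
  refine isLocallyFree_of_frames fun x hx => ?_
  obtain ⟨W, hW, hxW, n, s, hs, σ, hσ⟩ := exists_local_section hE hh hx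
  obtain ⟨φ, hφ, hφσ, hφh⟩ := exists_iso_tens_of_section (fun x hx => hflat x (hW hx))
    (hh.restrict hW) σ hσ
  let b := Module.finBasis k (LinearMap.ker A.aug.toLinearMap)
  have hb : ∀ l, A.aug (b l : A.carrier) = 0 := fun l => (b l).2
  have hφm : ∀ (V : S.Op) (hV : V ≤ W) (p : E.sec V (hV.trans hW)) (a : A.carrier),
      φ.app V hV (E.tensMk _ p a) = a • σ.app V hV p := by
    intro V hV p a
    rw [← hφσ, ← AlgHom.id_apply (R := k) a, ← φ.app_smulA, tensMk_smulA, mul_one]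
    rfl
  -- Under the trivialisation `φ` the kernel of `h` is `E ⊗ ker ε`. Its frame consists of the
  -- elements `b_l • σ(s_j)`, for a frame `s_j` of `E` and a basis `b_l` of `ker ε`.
  let κ : Fin n × Fin _ → (kerSheaf h).sec W hW := fun p =>
    ⟨(b p.2 : A.carrier) • σ.app W le_rfl (s p.1), by
      change h.app W hW _ = 0
      rw [h.app_smulA, hb, zero_smul]⟩
  have hval : ∀ (V : S.Op) (hV : V ≤ W) (c : Fin n × Fin _ → S.O V),
      (∑ p, c p • (kerSheaf h).res hW hV (κ p)).1 =
        φ.app V hV (∑ l, E.tensMk (hV.trans hW) (∑ j, c (j, l) • E.res hW hV (s j)) (b l)) := by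
    intro V hV c
    refine (map_sum ((kerIncl h).app V (hV.trans hW)) _ _).trans ?_
    rw [map_sum, Fintype.sum_prod_type, Finset.sum_comm]
    refine Finset.sum_congr rfl fun l _ => ?_
    rw [hφm, map_sum, Finset.smul_sum]
    refine Finset.sum_congr rfl fun j _ => ?_
    change c (j, l) • F.res hW hV ((b l : A.carrier) • σ.app W le_rfl (s j)) = _
    rw [F.res_smulA, σ.app_smulO, smul_comm]
    refine congrArg (fun t => (b l : A.carrier) • c (j, l) • t) ?_
    exact (σ.app_res le_rfl hV (s j)).symm
  refine ⟨W, hW, hxW, Fin n × Fin _, inferInstance, κ, fun V hV => ⟨fun c c' he => ?_, fun p => ?_⟩⟩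
  · have h1 := (hφ V hV).1 (((hval V hV c).symm.trans (congrArg Subtype.val he)).trans
      (hval V hV c'))
    have h2 := coords_ker_unique A.aug h1
    funext ⟨j, l⟩
    exact congrFun ((hs V hV).1 (congrFun h2 l)) j
  · obtain ⟨t, ht⟩ := (hφ V hV).2 p.1
    have h0 : h.app V (hV.trans hW) p.1 = 0 := p.2
    have h1 := hφh V hV t
    rw [ht, HomOn.restrict_app, h0] at h1
    obtain ⟨m, hm⟩ := exists_coords_ker A.aug h1.symm
    choose c hc using fun l => (hs V hV).2 (m l)
    refine ⟨fun p => c p.2 p.1, Subtype.ext ((hval V hV _).trans ?_)⟩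
    rw [← ht, ← hm]
    refine congrArg (φ.app V hV) (Finset.sum_congr rfl fun l _ => ?_)
    exact congrArg (fun m => E.tensMk _ m _) (hc l)

/-- A morphism to `F` that is killed by `h` factors through the kernel of `h`. -/
def liftKer {W : S.Op} {hW : W ≤ U} (φ : HomOn (Algebra.ofId k A.carrier) E F W hW hW)
    (hφ : ∀ V (hV : V ≤ W) s, h.app V (hV.trans hW) (φ.app V hV s) = 0) :
    HomOn (AlgHom.id k k) E (kerSheaf h) W hW hW where
  app V hV := AddMonoidHom.mk' (fun s => ⟨φ.app V hV s, hφ V hV s⟩)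
    fun _ _ => Subtype.ext (map_add _ _ _)
  app_smulO V hV r s := Subtype.ext (φ.app_smulO V hV r s)
  app_smulA V hV c s := Subtype.ext
    ((φ.app_smulA V hV c s).trans (F.smul_const V (hV.trans hW) c (φ.app V hV s)).symm)
  app_res hV h' s := Subtype.ext (φ.app_res hV h' s)

/-- A deformation of a locally free sheaf has a global `O`-linear section as soon as the
obstruction space `H¹(U, Hom(E, ker h))` vanishes. -/
theorem exists_section (hE : E.IsLocallyFree) (hh : h.IsPullback)
    (hH : (homSheaf E (kerSheaf h)).H1Vanishes) :
    ∃ σ : HomOn (Algebra.ofId k A.carrier) E F U le_rfl le_rfl,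
      ∀ V hV s, h.app V hV (σ.app V hV s) = s := by
  choose W hW hxW n s hs σ hσ using fun x : U => exists_local_section hE hh x.2
  -- The difference of two local sections is killed by `h`. These differences form a 1-cocycle of
  -- `Hom(E, ker h)`.
  let d : ∀ a b, HomOn (Algebra.ofId k A.carrier) E F (W a ⊓ W b) (inf_le_left.trans (hW a))
      (inf_le_left.trans (hW a)) := fun a b =>
    (σ b).restrict (inf_le_right : W a ⊓ W b ≤ W b) -
      (σ a).restrict (inf_le_left : W a ⊓ W b ≤ W a)
  have hd : ∀ a b V (hV : V ≤ W a ⊓ W b) p, (d a b).app V hV p =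
      (σ b).app V (hV.trans inf_le_right) p - (σ a).app V (hV.trans inf_le_left) p :=
    fun a b V hV p => by
      rw [HomOn.sub_app]
      rfl
  let z : ∀ a b, (homSheaf E (kerSheaf h)).sec (W a ⊓ W b) (inf_le_left.trans (hW a)) :=
    fun a b => liftKer (d a b) fun V hV p => by
      rw [hd, map_sub, hσ a V (hV.trans inf_le_left)]
      exact sub_eq_zero.2 (hσ b V (hV.trans inf_le_right) p)
  obtain ⟨y, hy⟩ := hH U W hW (fun x hx => Opens.mem_iSup.2 ⟨⟨x, hx⟩, hxW ⟨x, hx⟩⟩) z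
    (fun a b c V ha hb hc => by
      refine HomOn.ext (funext fun Y => funext fun hY => AddMonoidHom.ext fun p =>
        Subtype.ext ?_)
      change (d b c).app Y _ p + -(d a c).app Y _ p + (d a b).app Y _ p = 0
      rw [hd b c Y (le_inf (hY.trans hb) (hY.trans hc)),
        hd a c Y (le_inf (hY.trans ha) (hY.trans hc)),
        hd a b Y (le_inf (hY.trans ha) (hY.trans hb))]
      abel)
  have hy' : ∀ a b V (ha : V ≤ W a) (hb : V ≤ W b) p, (σ b).app V hb p - (σ a).app V ha p =
      (HomOn.app (y b) V hb p).1 - (HomOn.app (y a) V ha p).1 := by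
    intro a b V ha hb p
    have h1 := congrArg Subtype.val (DFunLike.congr_fun (congrFun (congrFun
      (congrArg HomOn.app (hy a b)) V) (le_inf ha hb)) p)
    refine ((hd a b V (le_inf ha hb) p).symm.trans h1).trans ?_
    exact (sub_eq_add_neg _ _).symm
  have hyk : ∀ a V (ha : V ≤ W a) p, h.app V (ha.trans (hW a)) (HomOn.app (y a) V ha p).1 = 0 :=
    fun a V ha p => (HomOn.app (y a) V ha p).2
  -- If `σ_b - σ_a = y_b - y_a` on overlaps, then the `σ_a - y_a` agree there. They are still
  -- sections of `h`, because `y_a` takes values in its kernel.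
  obtain ⟨τ, hτ⟩ := HomOn.exists_glue (hF := le_refl U) (hG := le_refl U) W hW
    (fun x hx => Opens.mem_iSup.2 ⟨⟨x, hx⟩, hxW ⟨x, hx⟩⟩)
    (fun a => σ a - ((kerIncl h).restrict (hW a)).comp (y a) (fun _ => rfl))
    (fun a b V ha hb p => by
      rw [HomOn.sub_app, HomOn.sub_app]
      change (σ a).app V ha p - (HomOn.app (y a) V ha p).1 =
        (σ b).app V hb p - (HomOn.app (y b) V hb p).1
      have := hy' a b V ha hb p
      rw [sub_eq_sub_iff_add_eq_add] at this ⊢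
      rw [add_comm, this, add_comm])
  refine ⟨τ, fun V hV p => E.ext_local hV fun x hx => ?_⟩
  have hle : V ⊓ W ⟨x, hV hx⟩ ≤ W ⟨x, hV hx⟩ := inf_le_right
  refine ⟨V ⊓ W ⟨x, hV hx⟩, inf_le_left, S.mem_inf hx (hxW ⟨x, hV hx⟩), ?_⟩
  rw [← h.app_res, ← τ.app_res, hτ ⟨x, hV hx⟩ _ hle, HomOn.sub_app]
  change h.app _ _ (_ - (HomOn.app (y ⟨x, hV hx⟩) _ hle _).1) = _
  rw [map_sub, hyk, sub_zero, hσ ⟨x, hV hx⟩ _ hle]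

/-- A flat deformation of a locally free sheaf `E` on an open set on which `H¹` of locally free
sheaves vanishes is isomorphic to `E ⊗ A`. -/
theorem exists_iso_tens (hE : E.IsLocallyFree)
    (hflat : ∀ x ∈ U, Module.Flat A.carrier (F.stalk x)) (hh : h.IsPullback)
    (hU : ∀ G : ModSheaf S k U, G.IsLocallyFree → G.H1Vanishes) :
    ∃ φ : HomOn (AlgHom.id k A.carrier) (E.tens A.carrier) F U le_rfl le_rfl, φ.IsIso ∧
      ∀ V hV t, h.app V hV (φ.app V hV t) = (E.tensAug A.aug).app V hV t := by
  have hK := isLocallyFree_kerSheaf hE hflat hh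
  -- Vanishing is assumed for locally free sheaves only, the common ground of the affine and the
  -- Stein case, so the coefficient sheaf has to be shown locally free.
  have hHom : (homSheaf E (kerSheaf h)).IsLocallyFree := by
    refine isLocallyFree_of_frames fun x hx => ?_
    obtain ⟨W, hW, hxW, n, s, hs⟩ := hE x hx
    obtain ⟨W', hW', hxW', n', s', hs'⟩ := hK x hx
    obtain ⟨ψ, hψ⟩ := (IsFrame.restrict (s := s) hs (inf_le_left : W ⊓ W' ≤ W)).exists_homSheaf
      (IsFrame.restrict (s := s') hs' (inf_le_right : W ⊓ W' ≤ W'))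
    exact ⟨W ⊓ W', _, S.mem_inf hxW hxW', _, inferInstance, ψ, hψ⟩
  obtain ⟨σ, hσ⟩ := exists_section hE hh (hU _ hHom)
  obtain ⟨φ, hφ, -, hφh⟩ := exists_iso_tens_of_section hflat hh σ hσ
  exact ⟨φ, hφ, hφh⟩

end ModSheaf

end

end TwistedDef

/-! ### Coherence of locally free sheaves; the Čech argument for `H¹ = 0`. -/

namespace TwistedDef

noncomputable section

variable {k : Type u} [Field k]

namespace ModSheaf

variable {S : KSpace k} {A : Type u} [CommRing A] [Algebra k A] {U : S.Op}

/-- Locally free `O ⊗ A`-modules of finite rank are coherent. -/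
theorem isCoherent_of_frames {F : ModSheaf S A U}
    (h : ∀ x ∈ U, ∃ (W : S.Op) (hW : W ≤ U), x ∈ W ∧ ∃ (q : ℕ) (s : Fin q → F.sec W hW),
      ∀ (V : S.Op) (hV : V ≤ W), Function.Bijective (fun c : Fin q → S.O V ⊗[k] A =>
        ∑ i, F.tact (hV.trans hW) (c i) (F.res hW hV (s i)))) : F.IsCoherent := by
  intro x hx
  obtain ⟨W, hW, hxW, q, s, hs⟩ := h x hx
  -- A frame satisfies no relations, hence the `0`.
  refine ⟨W, hW, hxW, q, 0, s, fun j => j.elim0, fun j => j.elim0, fun V hV t y hy => ?_,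
    fun V hV c hc y hy => ⟨V, le_rfl, hy, 0, fun i => ?_⟩⟩
  · obtain ⟨c, hc⟩ := (hs V hV).2 t
    refine ⟨V, le_rfl, hy, c, ?_⟩
    rw [F.res_self]
    exact hc.symm
  · have h0 : c = 0 := (hs V hV).1 (hc.trans (by simp))
    rw [h0]
    simp

/-- As `O ⊗_k k = O`, a frame over `O` is one over `O ⊗_k k`. The Stein condition, which speaks of
coherent sheaves, thereby applies to locally free ones. -/
theorem IsLocallyFree.isCoherent {F : ModSheaf S k U} (hF : F.IsLocallyFree) : F.IsCoherent := by
  refine isCoherent_of_frames fun x hx => ?_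
  obtain ⟨W, hW, hxW, q, s, hs⟩ := hF x hx
  refine ⟨W, hW, hxW, q, s, fun V hV => ?_⟩
  have ht : ∀ (c : S.O V ⊗[k] k) (p : F.sec V (hV.trans hW)),
      F.tact (hV.trans hW) c p = TensorProduct.rid k (S.O V) c • p := by
    intro c p
    induction c using TensorProduct.induction_on with
    | zero => simp
    | tmul r a => rw [tact_tmul, TensorProduct.rid_tmul, smul_comm, smul_assoc]
    | add x y hx hy => rw [map_add, AddMonoidHom.add_apply, hx, hy, map_add, add_smul]
  simp only [ht]
  exact (hs V hV).comp (Equiv.arrowCongr (Equiv.refl _)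
    (TensorProduct.rid k (S.O V)).toEquiv).bijective

/-- A frame `s_i` of `E` gives the frame `s_i ⊗ 1` over `O ⊗ A`: the coordinates in `A` of a
combination have as coefficients the coordinates in `A` of its coefficients. -/
theorem IsLocallyFree.isCoherent_tens [Module.Finite k A] {E : ModSheaf S k U}
    (hE : E.IsLocallyFree) : (E.tens A).IsCoherent := by
  refine isCoherent_of_frames fun x hx => ?_
  obtain ⟨W, hW, hxW, q, s, hs⟩ := hE x hx
  refine ⟨W, hW, hxW, q, fun i => E.tensMk hW (s i) 1, fun V hV => ?_⟩
  have ht : ∀ (o : Fin (Module.finrank k A) → S.O V) (p : E.sec V (hV.trans hW)),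
      (E.tens A).tact (hV.trans hW) (∑ l, o l ⊗ₜ Module.finBasis k A l)
        (E.tensMk (hV.trans hW) p 1) =
        ∑ l, E.tensMk (hV.trans hW) (o l • p) (Module.finBasis k A l) := by
    intro o p
    rw [map_sum, AddMonoidHom.finsetSum_apply]
    refine Finset.sum_congr rfl fun l _ => ?_
    rw [tact_tmul, tensMk_smulA, mul_one, tensMk_smulO]
  have hsum : ∀ c : Fin q → S.O V ⊗[k] A,
      ∑ i, (E.tens A).tact (hV.trans hW) (c i)
        ((E.tens A).res hW hV (E.tensMk hW (s i) 1)) =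
      ∑ l, E.tensMk (hV.trans hW) (∑ i, coords A _ (c i) l • E.res hW hV (s i))
        (Module.finBasis k A l) := by
    intro c
    have h1 : ∀ l, E.tensMk (hV.trans hW) (∑ i, coords A _ (c i) l • E.res hW hV (s i))
        (Module.finBasis k A l) = ∑ i, E.tensMk (hV.trans hW)
          (coords A _ (c i) l • E.res hW hV (s i)) (Module.finBasis k A l) :=
      fun l => TensorProduct.sum_tmul _ _ _
    simp only [h1]
    rw [Finset.sum_comm]
    refine Finset.sum_congr rfl fun i _ => ?_
    conv_lhs => rw [← sum_coords A (c i)]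
    rw [tensMk_res, ht]
  simp only [hsum]
  constructor
  · intro c c' h
    have h1 := E.sum_tensMk_inj (A := A) _ h
    funext i
    refine (coords A _).injective (funext fun l => ?_)
    exact congrFun ((hs V hV).1 (congrFun h1 l)) i
  · intro t
    obtain ⟨m, rfl⟩ := E.exists_sum_tensMk _ t
    choose c hc using fun l => (hs V hV).2 (m l)
    refine ⟨fun i => (coords A _).symm fun l => c l i, ?_⟩
    refine Finset.sum_congr rfl fun l _ => ?_
    refine congrArg (fun m => E.tensMk _ m _) (Eq.trans ?_ (hc l))
    simp only [LinearEquiv.apply_symm_apply]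

/-- The stalk is the extension of scalars of a vector space over `k`. -/
theorem tens_flat [Module.Finite k A] (E : ModSheaf S k U) {x : S.X} (hx : x ∈ U) :
    Module.Flat A ((E.tens A).stalk x) :=
  (E.tensUnit_isPullback x hx).flat

section CechVanishing

variable (F : ModSheaf S k U) {ι : Type u} [Finite ι] (D : ι → S.Op) (hD : ∀ c, D c ≤ U)
variable (f : ι → S.O U)

/-- The classical argument for the vanishing of `H¹`: if sections over `D_c ∩ D_d` extend to `D_d`
after multiplication by a power of `f_c`, sections over `D_d ∩ D_e` that vanish on `D_c` are
killed by a power of `f_c`, and the powers of the `f_c` generate the unit ideal, then every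
1-cocycle on the `D_c` is a coboundary. -/
theorem exists_cobounding
    (hker : ∀ (c d e : ι) (s : F.sec (D d ⊓ D e) (inf_le_left.trans (hD d))),
      F.res _ (inf_le_left : D d ⊓ D e ⊓ D c ≤ D d ⊓ D e) s = 0 →
      ∃ N : ℕ, S.res (inf_le_left.trans (hD d) : D d ⊓ D e ≤ U) (f c) ^ N • s = 0)
    (hext : ∀ (c d : ι) (s : F.sec (D c ⊓ D d) (inf_le_left.trans (hD c))),
      ∃ (N : ℕ) (t : F.sec (D d) (hD d)), F.res (hD d) (inf_le_right : D c ⊓ D d ≤ D d) t =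
        S.res (inf_le_left.trans (hD c) : D c ⊓ D d ≤ U) (f c) ^ N • s)
    (hunit : ∀ N : ℕ, ∃ q : ι → S.O U, ∑ᶠ c, q c * f c ^ N = 1)
    (z : ∀ c d, F.sec (D c ⊓ D d) (inf_le_left.trans (hD c)))
    (hz : ∀ (a b c : ι) (V : S.Op) (ha : V ≤ D a) (hb : V ≤ D b) (hc : V ≤ D c),
        F.res (inf_le_left.trans (hD b)) (le_inf hb hc) (z b c) -
          F.res (inf_le_left.trans (hD a)) (le_inf ha hc) (z a c) +
          F.res (inf_le_left.trans (hD a)) (le_inf ha hb) (z a b) = 0) :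
    ∃ y : ∀ c, F.sec (D c) (hD c), ∀ c d,
      z c d = F.res (hD d) inf_le_right (y d) - F.res (hD c) inf_le_left (y c) := by
  have := Fintype.ofFinite ι
  choose n t ht using fun c d => hext c d (z c d)
  -- A common exponent; the sum serves as an upper bound for all the `n c d`.
  let N : ℕ := ∑ c, ∑ d, n c d
  have hN : ∀ c d, n c d ≤ N := fun c d =>
    (Finset.single_le_sum (f := fun d => n c d) (fun _ _ => Nat.zero_le _) (Finset.mem_univ d)).trans
      (Finset.single_le_sum (f := fun c => ∑ d, n c d) (fun _ _ => Nat.zero_le _)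
        (Finset.mem_univ c))
  have ht₁ : ∀ c d, ∃ t₁ : F.sec (D d) (hD d),
      F.res (hD d) (inf_le_right : D c ⊓ D d ≤ D d) t₁ =
        S.res (inf_le_left.trans (hD c) : D c ⊓ D d ≤ U) (f c) ^ N • z c d := by
    intro c d
    refine ⟨S.res (hD d) (f c) ^ (N - n c d) • t c d, ?_⟩
    rw [F.res_smulO, ht, map_pow, S.res_res, smul_smul, ← pow_add, Nat.sub_add_cancel (hN c d)]
  choose t₁ ht₁ using ht₁
  -- On `D c` the extensions restrict to `f_c^N z_ce` and `f_c^N z_cd`, so there the bracket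
  -- vanishes by the cocycle relation, and by `hker` a power of `f_c` kills it on all of `D d ⊓ D
  -- e`.
  have hw : ∀ c d e, ∃ M : ℕ, S.res (inf_le_left.trans (hD d) : D d ⊓ D e ≤ U) (f c) ^ M •
      (F.res (hD e) (inf_le_right : D d ⊓ D e ≤ D e) (t₁ c e) -
        F.res (hD d) (inf_le_left : D d ⊓ D e ≤ D d) (t₁ c d) -
        S.res (inf_le_left.trans (hD d) : D d ⊓ D e ≤ U) (f c) ^ N • z d e) = 0 := by
    intro c d e
    refine hker c d e _ ?_
    have hd : D d ⊓ D e ⊓ D c ≤ D d := inf_le_left.trans inf_le_left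
    have he : D d ⊓ D e ⊓ D c ≤ D e := inf_le_left.trans inf_le_right
    have hc : D d ⊓ D e ⊓ D c ≤ D c := inf_le_right
    have e1 := congrArg (F.res _ (le_inf hc he)) (ht₁ c e)
    have e2 := congrArg (F.res _ (le_inf hc hd)) (ht₁ c d)
    rw [F.res_res, F.res_smulO, map_pow, S.res_res] at e1 e2
    rw [map_sub, map_sub, F.res_res, F.res_res, e1, e2, F.res_smulO, map_pow, S.res_res,
      ← smul_sub, ← smul_sub]
    have e3 := hz c d e _ hc hd he
    rw [show F.res (inf_le_left.trans (hD c)) (le_inf hc he) (z c e) -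
      F.res (inf_le_left.trans (hD c)) (le_inf hc hd) (z c d) -
      F.res (inf_le_left.trans (hD d)) (inf_le_left : D d ⊓ D e ⊓ D c ≤ D d ⊓ D e) (z d e) =
      -(F.res (inf_le_left.trans (hD d)) (le_inf hd he) (z d e) -
        F.res (inf_le_left.trans (hD c)) (le_inf hc he) (z c e) +
        F.res (inf_le_left.trans (hD c)) (le_inf hc hd) (z c d)) by abel, e3, neg_zero, smul_zero]
  choose m hm using hw
  let M : ℕ := ∑ c, ∑ d, ∑ e, m c d e
  have hM : ∀ c d e, m c d e ≤ M := fun c d e =>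
    ((Finset.single_le_sum (f := fun e => m c d e) (fun _ _ => Nat.zero_le _)
      (Finset.mem_univ e)).trans
      (Finset.single_le_sum (f := fun d => ∑ e, m c d e) (fun _ _ => Nat.zero_le _)
        (Finset.mem_univ d))).trans
      (Finset.single_le_sum (f := fun c => ∑ d, ∑ e, m c d e) (fun _ _ => Nat.zero_le _)
        (Finset.mem_univ c))
  have hm' : ∀ c d e, S.res (inf_le_left.trans (hD d) : D d ⊓ D e ≤ U) (f c) ^ M •
      (F.res (hD e) (inf_le_right : D d ⊓ D e ≤ D e) (t₁ c e) -
        F.res (hD d) (inf_le_left : D d ⊓ D e ≤ D d) (t₁ c d)) =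
      S.res (inf_le_left.trans (hD d) : D d ⊓ D e ≤ U) (f c) ^ (M + N) • z d e := by
    intro c d e
    have h1 := congrArg (S.res (inf_le_left.trans (hD d) : D d ⊓ D e ≤ U) (f c) ^ (M - m c d e) • ·) (hm c d e)
    simp only [smul_smul, ← pow_add, Nat.sub_add_cancel (hM c d e), smul_zero] at h1
    rw [smul_sub, sub_eq_zero, smul_smul, ← pow_add] at h1
    exact h1
  obtain ⟨q, hq⟩ := hunit (M + N)
  rw [finsum_eq_sum_of_fintype] at hq
  -- An algebraic partition of unity: the coboundary of this cochain at `(d, e)` is `∑ q_c f_c^(M+N)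
  -- z_de = z_de`.
  refine ⟨fun d => ∑ c, S.res (hD d) (q c * f c ^ M) • t₁ c d, fun d e => ?_⟩
  have h2 := congrArg (fun r => S.res (inf_le_left.trans (hD d) : D d ⊓ D e ≤ U) r • z d e) hq
  simp only [map_one, one_smul] at h2
  rw [← h2, map_sum, map_sum, map_sum, Finset.sum_smul, ← Finset.sum_sub_distrib]
  refine Finset.sum_congr rfl fun c _ => ?_
  rw [F.res_smulO, F.res_smulO, S.res_res, S.res_res, ← smul_sub, map_mul, map_mul, map_pow,
    map_pow, mul_smul, mul_smul, ← hm']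

variable {F} in
/-- A cocycle is a coboundary if its restriction to a refinement of the cover is one. -/
theorem exists_cobounding_of_refinement {κ : Type u} (W : κ → S.Op) (hW : ∀ a, W a ≤ U)
    {ι : Type u} (D : ι → S.Op) (hDU : U ≤ ⨆ c, D c)
    (τ : ι → κ) (hτ : ∀ c, D c ≤ W (τ c))
    (z : ∀ a b, F.sec (W a ⊓ W b) (inf_le_left.trans (hW a)))
    (hz : ∀ (a b c : κ) (V : S.Op) (ha : V ≤ W a) (hb : V ≤ W b) (hc : V ≤ W c),
        F.res (inf_le_left.trans (hW b)) (le_inf hb hc) (z b c) -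
          F.res (inf_le_left.trans (hW a)) (le_inf ha hc) (z a c) +
          F.res (inf_le_left.trans (hW a)) (le_inf ha hb) (z a b) = 0)
    (y : ∀ c, F.sec (D c) ((hτ c).trans (hW _)))
    (hy : ∀ c d, F.res (inf_le_left.trans (hW _)) (inf_le_inf (hτ c) (hτ d)) (z (τ c) (τ d)) =
      F.res ((hτ d).trans (hW _)) (inf_le_right : D c ⊓ D d ≤ D d) (y d) -
        F.res ((hτ c).trans (hW _)) (inf_le_left : D c ⊓ D d ≤ D c) (y c)) :
    ∃ y : ∀ a, F.sec (W a) (hW a), ∀ a b,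
        z a b = F.res (hW b) inf_le_right (y b) - F.res (hW a) inf_le_left (y a) := by
  have hcov : ∀ V ≤ U, V ≤ ⨆ c, V ⊓ D c := fun V hV => by
    rw [← inf_iSup_eq]; exact le_inf le_rfl (hV.trans hDU)
  have hy' : ∀ c d (V : S.Op) (hc : V ≤ D c) (hd : V ≤ D d),
      F.res (inf_le_left.trans (hW _)) (le_inf (hc.trans (hτ c)) (hd.trans (hτ d)))
        (z (τ c) (τ d)) = F.res ((hτ d).trans (hW _)) hd (y d) -
        F.res ((hτ c).trans (hW _)) hc (y c) := by
    intro c d V hc hd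
    have h1 := congrArg (F.res _ (le_inf hc hd)) (hy c d)
    rwa [map_sub, F.res_res, F.res_res, F.res_res] at h1
  -- On `W a ⊓ D c` the section `w a` is `y_c - z_{a,τ(c)}`. The cocycle relation makes these agree
  -- for different `c`, and then gives `w_b - w_a = z_{aτ(c)} - z_{bτ(c)} = z_ab`.
  choose w hw using fun a => (F.exists_unique_glue (hW a) (fun c => W a ⊓ D c)
    (fun c => inf_le_left) (hcov _ (hW a))
    (fun c => F.res ((hτ c).trans (hW _)) (inf_le_right : W a ⊓ D c ≤ D c) (y c) -
      F.res (inf_le_left.trans (hW a)) (inf_le_inf_left (W a) (hτ c)) (z a (τ c)))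
    (fun c d => by
      have ha : W a ⊓ D c ⊓ (W a ⊓ D d) ≤ W a := inf_le_left.trans inf_le_left
      have hc : W a ⊓ D c ⊓ (W a ⊓ D d) ≤ D c := inf_le_left.trans inf_le_right
      have hd : W a ⊓ D c ⊓ (W a ⊓ D d) ≤ D d := inf_le_right.trans inf_le_right
      have h1 := hz a (τ c) (τ d) _ ha (hc.trans (hτ c)) (hd.trans (hτ d))
      rw [hy' c d _ hc hd] at h1
      rw [map_sub, map_sub, F.res_res, F.res_res, F.res_res, F.res_res, ← sub_eq_zero, ← neg_eq_zero]
      rw [← h1]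
      abel)).exists
  refine ⟨w, fun a b => F.ext_cover _ D ((inf_le_left.trans (hW a)).trans hDU) fun c => ?_⟩
  have ha : W a ⊓ W b ⊓ D c ≤ W a := inf_le_left.trans inf_le_left
  have hb : W a ⊓ W b ⊓ D c ≤ W b := inf_le_left.trans inf_le_right
  have hc : W a ⊓ W b ⊓ D c ≤ D c := inf_le_right
  have e1 := congrArg (F.res _ (le_inf ha hc)) (hw a c)
  have e2 := congrArg (F.res _ (le_inf hb hc)) (hw b c)
  rw [map_sub, F.res_res, F.res_res, F.res_res] at e1 e2
  rw [map_sub, F.res_res, F.res_res, e1, e2]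
  have h1 := hz a b (τ c) _ ha hb (hc.trans (hτ c))
  rw [← sub_eq_zero, ← h1]
  abel

end CechVanishing

end ModSheaf

end

end TwistedDef

/-! ### Vanishing of `H¹` on affine open sets. -/

namespace TwistedDef

noncomputable section

variable {k : Type u} [Field k]

section Affine

variable {X : Scheme.{u}} {p : X ⟶ Spec (CommRingCat.of k)}

/-- On an affine open set, restriction to a basic open subset is a localization. The set `Y` is tied
to the intersection by an equation because the overlaps `D c ⊓ D d` occur with either factor in the
role of `V`. -/
theorem isLocalization_res {U V Y : (KSpace.ofScheme X p).Op} (hV : IsAffineOpen (X := X) V)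
    (hVU : V ≤ U) (f : (KSpace.ofScheme X p).O U) (hY : Y ≤ V)
    (e : Y = V ⊓ X.basicOpen (U := U) f) :
    @IsLocalization.Away _ _ ((KSpace.ofScheme X p).res hVU f) ((KSpace.ofScheme X p).O Y) _
      ((KSpace.ofScheme X p).res hY).toAlgebra := by
  refine hV.isLocalization_of_eq_basicOpen (X := X) ((KSpace.ofScheme X p).res hVU f)
    (homOfLE hY) (e.trans ?_)
  exact (X.basicOpen_res f (homOfLE hVU).op).symm

/-- If every point of an affine open set has a basic neighbourhood with a given property, then
finitely many such basic open sets cover, and all powers of the functions that define them generate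
the unit ideal. -/
theorem exists_finite_basicOpen {U : X.Opens} (hU : IsAffineOpen U) {P : Γ(X, U) → Prop}
    (h : ∀ x ∈ U, ∃ f : Γ(X, U), x ∈ X.basicOpen f ∧ P f) :
    ∃ (ι : Type u) (_ : Finite ι) (f : ι → Γ(X, U)), (∀ c, P (f c)) ∧ U ≤ ⨆ c, X.basicOpen (f c) ∧
      ∀ N : ℕ, ∃ q : ι → Γ(X, U), ∑ᶠ c, q c * f c ^ N = 1 := by
  have hspan : Ideal.span {f : Γ(X, U) | P f} = ⊤ := by
    rw [← hU.self_le_iSup_basicOpen_iff]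
    intro x hx
    obtain ⟨f, hxf, hf⟩ := h x hx
    exact Opens.mem_iSup.2 ⟨⟨f, hf⟩, hxf⟩
  obtain ⟨T, hT, hTspan⟩ := (Ideal.span_eq_top_iff_finite _).1 hspan
  refine ⟨(T : Set Γ(X, U)), inferInstance, Subtype.val, fun c => hT c.2,
    hU.self_le_iSup_basicOpen_iff.2 hTspan, fun N => ?_⟩
  have h1 := Ideal.span_range_pow_eq_top _ hTspan fun _ => N
  have h2 : (1 : Γ(X, U)) ∈ Ideal.span (Set.range fun x : (T : Set Γ(X, U)) => x.1 ^ N) :=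
    h1 ▸ Submodule.mem_top
  have := Fintype.ofFinite (T : Set Γ(X, U))
  obtain ⟨q, hq⟩ := Ideal.mem_span_range_iff_exists_fun.1 h2
  exact ⟨q, (finsum_eq_sum_of_fintype _).trans hq⟩

/-- `D(f) ∩ D(g) = D(fg)`, so no separatedness of `X` is needed for these overlaps to be affine. -/
theorem isAffineOpen_basicOpen_inf {U : X.Opens} (hU : IsAffineOpen U) (f g : Γ(X, U)) :
    IsAffineOpen (X.basicOpen f ⊓ X.basicOpen g) := by
  rw [← X.basicOpen_mul]
  exact hU.basicOpen _

namespace ModSheaf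

variable {U V Y : (KSpace.ofScheme X p).Op} {F : ModSheaf (KSpace.ofScheme X p) k U} {n : ℕ}

/-- On an affine open set on which `F` is free, a section that vanishes where `f ≠ 0` is killed by
a power of `f`. -/
theorem exists_pow_smul_eq_zero (hV : IsAffineOpen (X := X) V) (hVU : V ≤ U)
    {s : Fin n → F.sec V hVU} (hs : F.IsFrame hVU s) (f : (KSpace.ofScheme X p).O U) (hY : Y ≤ V)
    (e : Y = V ⊓ X.basicOpen (U := U) f) (t : F.sec V hVU) (ht : F.res hVU hY t = 0) :
    ∃ N : ℕ, (KSpace.ofScheme X p).res hVU f ^ N • t = 0 := by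
  let := ((KSpace.ofScheme X p).res hY).toAlgebra
  have hloc := isLocalization_res hV hVU f hY e
  obtain ⟨c, rfl⟩ := (hs V le_rfl).2 t
  simp only [map_sum, F.res_smulO, F.res_res] at ht
  have h0 : (fun i => (KSpace.ofScheme X p).res hY (c i)) = 0 :=
    (hs Y hY).1 (ht.trans (by simp))
  have h1 : ∀ i, ∃ N : ℕ, (KSpace.ofScheme X p).res hVU f ^ N * c i = 0 := by
    intro i
    obtain ⟨⟨_, N, rfl⟩, hN⟩ := (IsLocalization.map_eq_zero_iff
      (Submonoid.powers ((KSpace.ofScheme X p).res hVU f)) ((KSpace.ofScheme X p).O Y) (c i)).1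
      (congrFun h0 i)
    exact ⟨N, hN⟩
  choose N hN using h1
  -- One exponent for all the coefficients: the sum of the exponents that serve for each of them.
  refine ⟨∑ i, N i, ?_⟩
  rw [Finset.smul_sum]
  refine Finset.sum_eq_zero fun i _ => ?_
  rw [smul_smul, ← Finset.sum_erase_add _ _ (Finset.mem_univ i), pow_add, mul_assoc, hN, mul_zero,
    zero_smul]

/-- On an affine open set on which `F` is free, a section defined where `f ≠ 0` extends after
multiplication by a power of `f`. -/
theorem exists_res_eq_pow_smul (hV : IsAffineOpen (X := X) V) (hVU : V ≤ U)
    {s : Fin n → F.sec V hVU} (hs : F.IsFrame hVU s) (f : (KSpace.ofScheme X p).O U) (hY : Y ≤ V)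
    (e : Y = V ⊓ X.basicOpen (U := U) f) (t : F.sec Y (hY.trans hVU)) :
    ∃ (N : ℕ) (t' : F.sec V hVU),
      F.res hVU hY t' = (KSpace.ofScheme X p).res (hY.trans hVU) f ^ N • t := by
  let := ((KSpace.ofScheme X p).res hY).toAlgebra
  have hloc := isLocalization_res hV hVU f hY e
  obtain ⟨c, rfl⟩ := (hs Y hY).2 t
  have h1 : ∀ i, ∃ (N : ℕ) (r : (KSpace.ofScheme X p).O V), (KSpace.ofScheme X p).res hY r =
      (KSpace.ofScheme X p).res (hY.trans hVU) f ^ N * c i := by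
    intro i
    obtain ⟨⟨r, ⟨_, N, rfl⟩⟩, hr⟩ := IsLocalization.surj
      (Submonoid.powers ((KSpace.ofScheme X p).res hVU f)) (c i)
    refine ⟨N, r, Eq.trans hr.symm ?_⟩
    change c i * (KSpace.ofScheme X p).res hY ((KSpace.ofScheme X p).res hVU f ^ N) = _
    rw [map_pow, KSpace.res_res, mul_comm]
  choose N r hr using h1
  refine ⟨∑ i, N i, ∑ i, ((KSpace.ofScheme X p).res hVU f ^ (∑ j ∈ Finset.univ.erase i, N j) * r i) •
    s i, ?_⟩
  rw [map_sum, Finset.smul_sum]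
  refine Finset.sum_congr rfl fun i _ => ?_
  rw [F.res_smulO, map_mul, hr, map_pow, KSpace.res_res, smul_smul, ← mul_assoc, ← pow_add,
    Finset.sum_erase_add _ _ (Finset.mem_univ i)]

/-- `H¹` of a locally free sheaf on an affine open subset of a scheme vanishes. -/
theorem H1Vanishes_of_isAffineOpen (hU : IsAffineOpen (X := X) U) (hF : F.IsLocallyFree) :
    F.H1Vanishes := by
  intro κ W hW hcov z hz
  -- The given cover is refined by finitely many basic open sets on which `F` is free. With frames,
  -- the two properties needed of sections reduce to the same properties of functions.
  obtain ⟨T, _, f, hf, hcovD, hunit⟩ := exists_finite_basicOpen (X := X) hU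
    (P := fun f => ∃ (a : κ) (hfU : X.basicOpen f ≤ U), X.basicOpen f ≤ W a ∧
      ∃ (n : ℕ) (s : Fin n → F.sec (X.basicOpen f) hfU), F.IsFrame hfU s) fun x hx => by
    obtain ⟨a, ha⟩ := Opens.mem_iSup.1 (hcov hx)
    obtain ⟨Y, hY, hxY, n, s, hs⟩ := hF x hx
    obtain ⟨f, hf, hxf⟩ := hU.exists_basicOpen_le (V := W a ⊓ Y) ⟨x, ⟨ha, hxY⟩⟩ hx
    exact ⟨f, hxf, a, X.basicOpen_le f, hf.trans inf_le_left, n, _,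
      IsFrame.restrict (s := s) hs (hf.trans inf_le_right)⟩
  choose a hD hDW n s hs using hf
  let D : T → (KSpace.ofScheme X p).Op := fun c => X.basicOpen (U := U) (f c)
  have hker : ∀ (c d e : T) (t : F.sec (D d ⊓ D e) (inf_le_left.trans (hD d))),
      F.res _ (inf_le_left : D d ⊓ D e ⊓ D c ≤ D d ⊓ D e) t = 0 →
      ∃ N : ℕ, (KSpace.ofScheme X p).res (inf_le_left.trans (hD d) : D d ⊓ D e ≤ U) (f c) ^ N •
        t = 0 := by
    intro c d e t ht
    have haff : IsAffineOpen (X := X) (D d ⊓ D e) := isAffineOpen_basicOpen_inf hU (f d) (f e)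
    exact exists_pow_smul_eq_zero haff _ ((hs d).restrict inf_le_left) (f c) inf_le_left
      rfl t ht
  have hext : ∀ (c d : T) (t : F.sec (D c ⊓ D d) (inf_le_left.trans (hD c))),
      ∃ (N : ℕ) (t' : F.sec (D d) (hD d)), F.res (hD d) (inf_le_right : D c ⊓ D d ≤ D d) t' =
        (KSpace.ofScheme X p).res (inf_le_left.trans (hD c) : D c ⊓ D d ≤ U) (f c) ^ N • t :=
    fun c d t => exists_res_eq_pow_smul (hU.basicOpen (f d)) (hD d) (hs d) (f c) inf_le_right
      (inf_comm _ _) t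
  obtain ⟨y, hy⟩ := F.exists_cobounding D hD f hker hext hunit
    (fun c d => F.res (inf_le_left.trans (hW _)) (inf_le_inf (hDW c) (hDW d))
      (z (a c) (a d)))
    (fun c d e V hc hd he => by
      rw [F.res_res, F.res_res, F.res_res]
      exact hz _ _ _ V (hc.trans (hDW c)) (hd.trans (hDW d)) (he.trans (hDW e)))
  exact exists_cobounding_of_refinement W hW D hcovD a hDW z hz y hy

end ModSheaf

end Affine

end

end TwistedDef

/-! ### Exponentials of nilpotent elements and unipotent elements of `R ⊗ A`. -/

namespace TwistedDef

noncomputable section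

variable {k : Type u} [Field k]

section Exponential

variable [CharZero k] {R : Type u} [Ring R] [Algebra k R]

theorem nexp_zero : nexp k (0 : R) = 1 := by
  let : Module ℚ R := Module.compHom R (algebraMap ℚ k)
  exact IsNilpotent.exp_zero

theorem nexp_add_of_commute {x y : R} (h : Commute x y) (hx : IsNilpotent x) (hy : IsNilpotent y) :
    nexp k (x + y) = nexp k x * nexp k y := by
  let : Module ℚ R := Module.compHom R (algebraMap ℚ k)
  exact IsNilpotent.exp_add_of_commute h hx hy

theorem nexp_mul_nexp_neg {x : R} (hx : IsNilpotent x) : nexp k x * nexp k (-x) = 1 := by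
  let : Module ℚ R := Module.compHom R (algebraMap ℚ k)
  exact IsNilpotent.exp_mul_exp_neg_self hx

theorem nexp_neg_mul_nexp {x : R} (hx : IsNilpotent x) : nexp k (-x) * nexp k x = 1 := by
  let : Module ℚ R := Module.compHom R (algebraMap ℚ k)
  exact IsNilpotent.exp_neg_mul_exp_self hx

/-- The exponential to first order, with a remainder divisible by `x ^ 2`: what successive
approximation of the logarithm requires. -/
theorem nexp_eq_one_add {x : R} (hx : IsNilpotent x) : ∃ r, nexp k x = 1 + x + x ^ 2 * r := by
  let : Module ℚ R := Module.compHom R (algebraMap ℚ k)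
  obtain ⟨n, hn⟩ := hx
  -- The exponent `n + 2` makes sure that the sum has the two terms that are split off.
  have hn' : x ^ (n + 2) = 0 := by rw [pow_add, hn, zero_mul]
  refine ⟨∑ i ∈ Finset.range n, algebraMap ℚ k ((i + 2).factorial : ℚ)⁻¹ • x ^ i, ?_⟩
  change IsNilpotent.exp x = _
  rw [IsNilpotent.exp_eq_sum hn', Finset.sum_range_succ', Finset.sum_range_succ', Finset.mul_sum]
  have h0 : ((Nat.factorial 0 : ℚ)⁻¹) • x ^ 0 = 1 := by simp
  have h1 : ((Nat.factorial (0 + 1) : ℚ)⁻¹) • x ^ (0 + 1) = x := by simp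
  have h2 : ∀ i, (((i + 1 + 1).factorial : ℚ)⁻¹) • x ^ (i + 1 + 1) =
      x ^ 2 * algebraMap ℚ k ((i + 2).factorial : ℚ)⁻¹ • x ^ i := by
    intro i
    rw [mul_smul_comm, ← pow_add, add_comm 2 i]
    rfl
  rw [h0, h1, Finset.sum_congr rfl fun i _ => h2 i]
  abel

/-- The logarithm by successive approximation, without its series: if `e^{xv} = 1 + x + x^{n+1} w`,
then multiplying by the exponential of `-x^{n+1} w` leaves an error divisible by `x^{n+2}`. -/
theorem exists_nexp_eq_one_add_of_comm {R : Type u} [CommRing R] [Algebra k R] {x : R}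
    (hx : IsNilpotent x) : ∃ w, nexp k (x * w) = 1 + x := by
  have key : ∀ n, ∃ v w, nexp k (x * v) = 1 + x + x ^ (n + 1) * w := by
    intro n
    induction n with
    | zero => exact ⟨0, -1, by rw [mul_zero, nexp_zero]; ring⟩
    | succ n ih =>
      obtain ⟨v, w, h⟩ := ih
      have hu : IsNilpotent (x * (-(x ^ n * w))) := (Commute.all _ _).isNilpotent_mul_right hx
      obtain ⟨r, hr⟩ := nexp_eq_one_add (k := k) hu
      refine ⟨v + -(x ^ n * w), -w - x ^ n * w ^ 2 + (1 + x + x ^ (n + 1) * w) * x ^ n * w ^ 2 * r,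
        ?_⟩
      rw [mul_add, nexp_add_of_commute (Commute.all _ _)
        ((Commute.all _ _).isNilpotent_mul_right hx) hu, h, hr]
      ring
  obtain ⟨n, hn⟩ := hx
  obtain ⟨v, w, h⟩ := key n
  exact ⟨v, by rw [h, pow_succ, hn]; ring⟩

/-- Only powers of `x` matter, so the commutative case in `k[X]/(X^n)` suffices; its solution is
carried to `R` by `X ↦ x`. -/
theorem exists_nexp_eq_one_add {x : R} (hx : IsNilpotent x) : ∃ w, IsNilpotent (x * w) ∧
    nexp k (x * w) = 1 + x := by
  obtain ⟨n, hn⟩ := hx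
  let J : Ideal (Polynomial k) := Ideal.span {Polynomial.X ^ n}
  let f : Polynomial k ⧸ J →ₐ[k] R := Ideal.Quotient.liftₐ J (Polynomial.aeval x) fun p hp => by
    obtain ⟨q, rfl⟩ := Ideal.mem_span_singleton'.1 hp
    rw [map_mul, map_pow, Polynomial.aeval_X, hn, mul_zero]
  have hX : IsNilpotent (Ideal.Quotient.mk J Polynomial.X) := ⟨n, by
    rw [← map_pow]
    exact Ideal.Quotient.eq_zero_iff_mem.2 (Ideal.mem_span_singleton_self _)⟩
  have hf : f (Ideal.Quotient.mk J Polynomial.X) = x := Polynomial.aeval_X x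
  obtain ⟨w, hw⟩ := exists_nexp_eq_one_add_of_comm (k := k) hX
  have hXw := (Commute.all _ w).isNilpotent_mul_right hX
  refine ⟨f w, ?_, ?_⟩
  · rw [← hf, ← map_mul]
    exact hXw.map f
  · rw [← hf, ← map_mul, ← map_nexp f hXw, hw, map_add, map_one]

end Exponential

section Nilp

variable (R : Type u) [Ring R] [Algebra k R] (A : ArtAlg k)

/-- The reduction `R ⊗ A → R` modulo the maximal ideal. -/
def reduction : R ⊗[k] A.carrier →ₐ[k] R :=
  (Algebra.TensorProduct.rid k k R).toAlgHom.comp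
    (Algebra.TensorProduct.map (AlgHom.id k R) A.aug)

variable {R A}

theorem reduction_tmul (r : R) (a : A.carrier) : reduction R A (r ⊗ₜ a) = A.aug a • r := by
  simp [reduction]

/-- Since `a - A.aug a` lies in `𝔪` for every `a`, every `x` is congruent to `reduction x ⊗ 1`
modulo `R ⊗ 𝔪`. -/
theorem mem_nilp_iff {x : R ⊗[k] A.carrier} : x ∈ nilp R A ↔ reduction R A x = 0 := by
  constructor
  · intro hx
    induction hx using Submodule.span_induction with
    | zero => exact map_zero _
    | add x x' _ _ h h' => rw [map_add, h, h', add_zero]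
    | smul c x _ h => rw [map_smul, h, smul_zero]
    | mem x hx =>
      obtain ⟨r, a, ha, rfl⟩ := hx
      rw [reduction_tmul, (A.aug_eq_zero_iff a).2 ha, zero_smul]
  · intro hx
    have h : ∀ x : R ⊗[k] A.carrier, x - reduction R A x ⊗ₜ 1 ∈ nilp R A := by
      intro x
      induction x using TensorProduct.induction_on with
      | zero => rw [map_zero, TensorProduct.zero_tmul, sub_zero]; exact Submodule.zero_mem _
      | tmul r a =>
        refine Submodule.subset_span ⟨r, _, aug_sub_mem A a, ?_⟩
        rw [reduction_tmul, TensorProduct.tmul_sub, TensorProduct.smul_tmul, Algebra.smul_def,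
          mul_one]
      | add x y hx hy =>
        rw [map_add, TensorProduct.add_tmul, add_sub_add_comm]
        exact Submodule.add_mem _ hx hy
    have := h x
    rwa [hx, TensorProduct.zero_tmul, sub_zero] at this

variable [CharZero k]

theorem reduction_nexp {x : R ⊗[k] A.carrier} (hx : x ∈ nilp R A) :
    reduction R A (nexp k x) = 1 := by
  rw [map_nexp _ (isNilpotent_of_mem hx), mem_nilp_iff.1 hx, nexp_zero]

/-- The logarithm of `x` found above is a multiple of `x - 1`, hence again reduces to `0`. Together
with `reduction_nexp` this identifies the group of exponentials with the unipotent elements, and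
allows arguing with the latter. -/
theorem exists_nexp_eq {x : R ⊗[k] A.carrier} (hx : reduction R A x = 1) :
    ∃ y ∈ nilp R A, nexp k y = x := by
  have hx' : x - 1 ∈ nilp R A := mem_nilp_iff.2 (by rw [map_sub, hx, map_one, sub_self])
  obtain ⟨w, -, hw⟩ := exists_nexp_eq_one_add (k := k) (isNilpotent_of_mem hx')
  refine ⟨(x - 1) * w, mem_nilp_iff.2 ?_, ?_⟩
  · rw [map_mul, mem_nilp_iff.1 hx', zero_mul]
  · rw [hw, add_sub_cancel]

/-- In characteristic zero a unipotent element is determined to be trivial by its cube. -/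
theorem eq_one_of_cube {x : R ⊗[k] A.carrier} (hx : reduction R A x = 1)
    (h : x * x * x = 1) : x = 1 := by
  have hn : IsNilpotent (x - 1) := isNilpotent_of_mem (mem_nilp_iff.2 (by
    rw [map_sub, hx, map_one, sub_self]))
  set n := x - 1 with hn'
  have hxn : x = 1 + n := by rw [hn']; abel
  have h3 : (3 : k) ≠ 0 := by exact_mod_cast (show (3 : ℕ) ≠ 0 by decide)
  -- This is `(1 + n)³ - 1`. The second factor is `3` plus a nilpotent element that commutes with
  -- it, hence a unit in characteristic zero.
  have hz : n * (3 + n * (3 + n)) = 0 := by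
    have : n * (3 + n * (3 + n)) = x * x * x - 1 := by
      rw [hxn]; noncomm_ring
    rw [this, h, sub_self]
  have hu : IsUnit (3 + n * (3 + n)) := by
    have h3' : IsUnit (3 : R ⊗[k] A.carrier) := by
      have := (IsUnit.mk0 (3 : k) h3).map (algebraMap k (R ⊗[k] A.carrier))
      rwa [map_ofNat] at this
    have hc : Commute n (3 + n) := by
      simp only [Commute, SemiconjBy]; noncomm_ring
    refine IsNilpotent.isUnit_add_left_of_commute (hc.isNilpotent_mul_right hn) h3' ?_
    simp only [Commute, SemiconjBy]; noncomm_ring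
  rw [hu.mul_left_eq_zero] at hz
  rw [hxn, hz, add_zero]

end Nilp

end

end TwistedDef

/-! ### Cochains of `End(E)` and their action on the sheaves `E_i ⊗ A`. -/

namespace TwistedDef

noncomputable section

variable {k : Type u} [Field k] {S : KSpace k} {I : Type u} {U : I → S.Op} {α : Cocycle2 S U}

namespace TwistedSheaf

variable (E : TwistedSheaf S U α)

/-- The component of a Čech cochain of `End(E)` at `idx`, as an endomorphism of the sections of
`E_i` over an open subset of `U_i` and of all the `U_{idx a}`. -/
def compEnd {n : ℕ} (idx : Fin (n + 1) → I) {V : S.Op} (hV : ∀ a, V ≤ U (idx a)) {i : I}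
    (hi : V ≤ U i) :
    E.cech.obj (SemiSimplexCategory.mk n) →ₐ[k] Module.End k ((E.sheaf i).sec V hi) where
  toFun x := ((x idx).1 i ⟨V, le_inf (le_iInf hV) hi⟩).restrictScalars k
  map_one' := rfl
  map_mul' _ _ := rfl
  map_zero' := rfl
  map_add' _ _ := rfl
  commutes' _ := rfl

section compEnd

variable {n : ℕ} (idx : Fin (n + 1) → I) {V V' : S.Op} (hV : ∀ a, V ≤ U (idx a)) {i j : I}
  (hi : V ≤ U i) (hj : V ≤ U j) (x : E.cech.obj (SemiSimplexCategory.mk n))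
  (s : (E.sheaf i).sec V hi)

theorem compEnd_smulO (r : S.O V) : E.compEnd idx hV hi x (r • s) = r • E.compEnd idx hV hi x s :=
  map_smul ((x idx).1 i ⟨V, le_inf (le_iInf hV) hi⟩) r s

theorem compEnd_res (h : V' ≤ V) :
    (E.sheaf i).res hi h (E.compEnd idx hV hi x s) =
      E.compEnd idx (fun a => h.trans (hV a)) (h.trans hi) x ((E.sheaf i).res hi h s) :=
  (x idx).2.1 i V V' (le_inf (le_iInf hV) hi) h s

theorem compEnd_g :
    (E.g i j).app V (le_inf hi hj) (E.compEnd idx hV hi x s) =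
      E.compEnd idx hV hj x ((E.g i j).app V (le_inf hi hj) s) :=
  (x idx).2.2 i j V (le_inf (le_iInf hV) hi) (le_inf (le_iInf hV) hj) s

variable {E} in
/-- A Čech cochain of `End(E)` is determined by its actions on the first of the sheaves. -/
theorem cech_ext {x y : E.cech.obj (SemiSimplexCategory.mk n)}
    (h : ∀ (idx : Fin (n + 1) → I) (V : S.Op) (hV : ∀ a, V ≤ U (idx a))
      (s : (E.sheaf (idx 0)).sec V (hV 0)),
      E.compEnd idx hV (hV 0) x s = E.compEnd idx hV (hV 0) y s) : x = y := by
  funext idx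
  refine Subtype.ext (funext fun i => funext fun V => LinearMap.ext fun s => ?_)
  have hV : ∀ a, V.1 ≤ U (idx a) := fun a => (V.2.trans KSpace.infl).trans (iInf_le _ a)
  have hi : V.1 ≤ U i := V.2.trans KSpace.infr
  change E.compEnd idx hV hi x s = E.compEnd idx hV hi y s
  -- The component on `E_i` is conjugate, under the gluing isomorphism to `E_{idx 0}`, to the
  -- component on the first sheaf.
  rw [← E.g_symm i (idx 0) V.1 hi (hV 0) (E.compEnd idx hV hi x s), 
    E.compEnd_g idx hV hi (hV 0), h, ← E.compEnd_g idx hV hi (hV 0),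
    E.g_symm i (idx 0) V.1 hi (hV 0)]

end compEnd

/-- The gluing isomorphisms compose up to an invertible function. Functions commute with `O`-linear
endomorphisms, so conjugation by the `g_ij` satisfies the untwisted cocycle condition and `End(E)`
is an ordinary sheaf. -/
theorem g_g (i j l : I) {V : S.Op} (hi : V ≤ U i) (hj : V ≤ U j) (hl : V ≤ U l)
    (s : (E.sheaf i).sec V hi) :
    (E.g j l).app V (le_inf hj hl) ((E.g i j).app V (le_inf hi hj) s) =
      S.res (le_inf (le_inf hi hj) hl) (α.val i j l).1 • (E.g i l).app V (le_inf hi hl) s := by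
  rw [← (E.g i l).app_smulO, ← E.g_cocycle i j l V hi hj hl,
    E.g_symm l i V hl hi]

/-- A family of endomorphisms of the first sheaves is a Čech cochain of `End(E)`. -/
theorem exists_cech {n : ℕ}
    (φ : ∀ (idx : Fin (n + 1) → I) (V : S.Op) (hV : ∀ a, V ≤ U (idx a)),
      (E.sheaf (idx 0)).sec V (hV 0) →ₗ[S.O V] (E.sheaf (idx 0)).sec V (hV 0))
    (hφ : ∀ (idx : Fin (n + 1) → I) (V V' : S.Op) (hV : ∀ a, V ≤ U (idx a)) (h : V' ≤ V)
      (s : (E.sheaf (idx 0)).sec V (hV 0)), (E.sheaf (idx 0)).res (hV 0) h (φ idx V hV s) =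
        φ idx V' (fun a => h.trans (hV a)) ((E.sheaf (idx 0)).res (hV 0) h s)) :
    ∃ x : E.cech.obj (SemiSimplexCategory.mk n), ∀ idx V hV s,
      E.compEnd idx hV (hV 0) x s = φ idx V hV s := by
  have hV : ∀ {idx : Fin (n + 1) → I} {V W : S.Op}, V ≤ (⨅ a, U (idx a)) ⊓ W →
      ∀ a, V ≤ U (idx a) := fun h a => (h.trans KSpace.infl).trans (iInf_le _ a)
  have hi : ∀ {V W W' : S.Op}, V ≤ W' ⊓ W → V ≤ W := fun h => h.trans KSpace.infr
  -- The endomorphism of `E_{idx 0}` is carried to every other `E_i` by conjugation with the gluing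
  -- isomorphisms.
  refine ⟨fun idx => ⟨fun i W =>
    { toFun := fun s => (E.g (idx 0) i).app W.1 (le_inf (hV W.2 0) (hi W.2))
        (φ idx W.1 (hV W.2) ((E.g i (idx 0)).app W.1 (le_inf (hi W.2) (hV W.2 0)) s))
      map_add' := fun s t => by simp only [map_add]
      map_smul' := fun r s => by
        rw [(E.g i (idx 0)).app_smulO, map_smul, (E.g (idx 0) i).app_smulO, RingHom.id_apply] },
    ?_, ?_⟩, ?_⟩
  · intro i W W' hW h s
    have h0 := hV hW 0
    have h1 := hi hW
    change (E.sheaf i).res h1 h ((E.g (idx 0) i).app W (le_inf h0 h1)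
        (φ idx W (hV hW) ((E.g i (idx 0)).app W (le_inf h1 h0) s))) =
      (E.g (idx 0) i).app W' (h.trans (le_inf h0 h1)) (φ idx W' (fun a => h.trans (hV hW a))
        ((E.g i (idx 0)).app W' (h.trans (le_inf h1 h0)) ((E.sheaf i).res h1 h s)))
    rw [← (E.g (idx 0) i).app_res (le_inf (hV hW 0) (hi hW)) h,
      (E.g i (idx 0)).app_res (le_inf (hi hW) (hV hW 0)) h, hφ idx W W' (hV hW) h]
  · intro i j W hWi hWj s
    have h0 := hV hWi 0
    have h1 := hi hWi
    have h2 := hi hWj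
    change (E.g i j).app W (le_inf h1 h2) ((E.g (idx 0) i).app W (le_inf h0 h1)
        (φ idx W (hV hWi) ((E.g i (idx 0)).app W (le_inf h1 h0) s))) =
      (E.g (idx 0) j).app W (le_inf h0 h2) (φ idx W (hV hWi) ((E.g j (idx 0)).app W (le_inf h2 h0)
        ((E.g i j).app W (le_inf h1 h2) s)))
    -- The factor `α` passes through the `O`-linear `φ` and is absorbed by the triple composite on
    -- its other side.
    rw [E.g_g (idx 0) i j (hV hWi 0) (hi hWi) (hi hWj), ← (E.g (idx 0) j).app_smulO, ← map_smul,
      ← E.g_cocycle (idx 0) i j W (hV hWi 0) (hi hWi) (hi hWj), E.g_symm i (idx 0) W h1 h0]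
  · intro idx V hV s
    change (E.g (idx 0) (idx 0)).app V (le_inf (hV 0) (hV 0)) (φ idx V hV
      ((E.g (idx 0) (idx 0)).app V (le_inf (hV 0) (hV 0)) s)) = _
    rw [E.g_self, E.g_self]

variable (A : ArtAlg k)

/-- The action of the cochains with coefficients in `A` on the sections of `E_i ⊗ A`. -/
def act {n : ℕ} (idx : Fin (n + 1) → I) {V : S.Op} (hV : ∀ a, V ≤ U (idx a)) {i : I}
    (hi : V ≤ U i) :
    E.cech.obj (SemiSimplexCategory.mk n) ⊗[k] A.carrier →+*
      AddMonoid.End (((E.sheaf i).tens A.carrier).sec V hi) :=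
  (Module.toAddMonoidEnd (Module.End k ((E.sheaf i).sec V hi ⊗[k] A.carrier))
    ((E.sheaf i).sec V hi ⊗[k] A.carrier)).comp
    (Module.endTensorEndAlgHom.comp (Algebra.TensorProduct.map (E.compEnd idx hV hi)
      (Algebra.lmul k A.carrier))).toRingHom

variable {A}

section act

variable {n : ℕ} (idx : Fin (n + 1) → I) {V V' : S.Op} (hV : ∀ a, V ≤ U (idx a)) {i j : I}
  (hi : V ≤ U i) (hj : V ≤ U j) (y : E.cech.obj (SemiSimplexCategory.mk n) ⊗[k] A.carrier)
  (t : ((E.sheaf i).tens A.carrier).sec V hi)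

theorem act_tmul (x : E.cech.obj (SemiSimplexCategory.mk n)) (a b : A.carrier)
    (s : (E.sheaf i).sec V hi) :
    E.act A idx hV hi (x ⊗ₜ a) ((E.sheaf i).tensMk hi s b) =
      (E.sheaf i).tensMk hi (E.compEnd idx hV hi x s) (a * b) := rfl

theorem act_add_apply (y' : E.cech.obj (SemiSimplexCategory.mk n) ⊗[k] A.carrier) :
    E.act A idx hV hi (y + y') t = E.act A idx hV hi y t + E.act A idx hV hi y' t := by
  rw [map_add]; rfl

theorem act_mul_apply (y' : E.cech.obj (SemiSimplexCategory.mk n) ⊗[k] A.carrier) :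
    E.act A idx hV hi (y * y') t = E.act A idx hV hi y (E.act A idx hV hi y' t) := by
  rw [map_mul]; rfl

theorem act_one_apply : E.act A idx hV hi 1 t = t := by
  rw [map_one]; rfl

theorem act_zero_apply : E.act A idx hV hi 0 t = 0 := by
  rw [map_zero]; rfl

theorem act_smulO (r : S.O V) : E.act A idx hV hi y (r • t) = r • E.act A idx hV hi y t := by
  induction y using TensorProduct.induction_on with
  | zero => rw [act_zero_apply, act_zero_apply, smul_zero]
  | add x y hx hy => rw [act_add_apply, act_add_apply, hx, hy, smul_add]
  | tmul x a =>
    induction t using ModSheaf.tens_induction with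
    | tmul s b => rw [ModSheaf.tensMk_smulO, act_tmul, act_tmul, compEnd_smulO,
        ModSheaf.tensMk_smulO]
    | add t t' h h' => rw [smul_add, map_add, map_add, h, h', smul_add]

theorem act_smulA (c : A.carrier) : E.act A idx hV hi y (c • t) = c • E.act A idx hV hi y t := by
  induction y using TensorProduct.induction_on with
  | zero => rw [act_zero_apply, act_zero_apply, smul_zero]
  | add x y hx hy => rw [act_add_apply, act_add_apply, hx, hy, smul_add]
  | tmul x a =>
    induction t using ModSheaf.tens_induction with
    | tmul s b => rw [ModSheaf.tensMk_smulA, act_tmul, act_tmul, ModSheaf.tensMk_smulA,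
        mul_left_comm]
    | add t t' h h' => rw [smul_add, map_add, map_add, h, h', smul_add]

theorem act_res (h : V' ≤ V) :
    E.act A idx (fun a => h.trans (hV a)) (h.trans hi) y
      (((E.sheaf i).tens A.carrier).res hi h t) =
      ((E.sheaf i).tens A.carrier).res hi h (E.act A idx hV hi y t) := by
  induction y using TensorProduct.induction_on with
  | zero => rw [act_zero_apply, act_zero_apply, map_zero]
  | add x y hx hy => rw [act_add_apply, act_add_apply, hx, hy, map_add]
  | tmul x a =>
    induction t using ModSheaf.tens_induction with
    | tmul s b => rw [ModSheaf.tensMk_res, act_tmul, act_tmul, ModSheaf.tensMk_res, compEnd_res]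
    | add t t' h h' => rw [map_add, map_add, h, h', map_add, map_add]

/-- The isomorphism `E_i ⊗ A → E_j ⊗ A` induced by `g_ij`. -/
abbrev gT (A : ArtAlg k) (i j : I) :
    ModSheaf.HomOn (AlgHom.id k A.carrier) ((E.sheaf i).tens A.carrier)
      ((E.sheaf j).tens A.carrier) (U i ⊓ U j) KSpace.infl KSpace.infr :=
  ModSheaf.tensMap (AlgHom.id k A.carrier) (E.g i j)

theorem act_gT :
    (E.gT A i j).app V (le_inf hi hj) (E.act A idx hV hi y t) =
      E.act A idx hV hj y ((E.gT A i j).app V (le_inf hi hj) t) := by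
  induction y using TensorProduct.induction_on with
  | zero => rw [act_zero_apply, act_zero_apply, map_zero]
  | add x y hx hy => rw [act_add_apply, act_add_apply, ← hx, ← hy, map_add]
  | tmul x a =>
    induction t using ModSheaf.tens_induction with
    | tmul s b => rw [act_tmul, ModSheaf.tensMap_tensMk, ModSheaf.tensMap_tensMk, act_tmul,
        compEnd_g, map_mul]; rfl
    | add t t' h h' => rw [map_add, map_add, h, h', map_add, map_add]

/-- The indices are related by an equation so that explicit tuples such as `![i, j]`, which are not
syntactically of the form `idx' ∘ l.succAbove`, can be used. -/
theorem act_coface {idx' : Fin (n + 2) → I} (l : Fin (n + 2)) (hV' : ∀ a, V ≤ U (idx' a))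
    (h : ∀ a, idx a = idx' (l.succAbove a)) :
    E.act A idx' hV' hi (coface E.cech A n l y) t = E.act A idx hV hi y t := by
  obtain rfl : idx = fun a => idx' (l.succAbove a) := funext h
  induction y using TensorProduct.induction_on with
  | zero => rw [map_zero, act_zero_apply, act_zero_apply]
  | add x y hx hy => rw [map_add, act_add_apply, act_add_apply, hx, hy]
  | tmul x a =>
    induction t using ModSheaf.tens_induction with
    | tmul s b => rfl
    | add t t' h h' => rw [map_add, map_add, h, h']

theorem act_scMap {B : ArtAlg k} (f : A ⟶ B) :
    E.act B idx hV hi (scMap E.cech f n y)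
        ((ModSheaf.tensMap (f : A.carrier →ₐ[k] B.carrier)
          (ModSheaf.HomOn.id (E.sheaf i) (le_refl (U i)))).app V hi t) =
      (ModSheaf.tensMap (f : A.carrier →ₐ[k] B.carrier)
        (ModSheaf.HomOn.id (E.sheaf i) (le_refl (U i)))).app V hi (E.act A idx hV hi y t) := by
  induction y using TensorProduct.induction_on with
  | zero => rw [map_zero, act_zero_apply, act_zero_apply, map_zero]
  | add x y hx hy => rw [map_add, act_add_apply, act_add_apply, hx, hy, map_add]
  | tmul x a =>
    induction t using ModSheaf.tens_induction with
    | tmul s b =>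
      rw [act_tmul, ModSheaf.tensMap_tensMk, ModSheaf.tensMap_tensMk, map_mul]; rfl
    | add t t' h h' => rw [map_add, map_add, h, h', map_add, map_add]

/-- Modulo `𝔪_A` a cochain acts through its reduction. In particular, if it reduces to `1`, its
action respects the morphisms to the `E_i`. -/
theorem tensAug_act :
    ((E.sheaf i).tensAug A.aug).app V hi (E.act A idx hV hi y t) =
      E.compEnd idx hV hi (reduction _ A y) (((E.sheaf i).tensAug A.aug).app V hi t) := by
  induction y using TensorProduct.induction_on with
  | zero => rw [act_zero_apply, map_zero, map_zero, map_zero]; rfl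
  | add x y hx hy => rw [act_add_apply, map_add, map_add, hx, hy, map_add]; rfl
  | tmul x a =>
    induction t using ModSheaf.tens_induction with
    | tmul s b =>
      rw [act_tmul, ModSheaf.tensAug_tensMk, ModSheaf.tensAug_tensMk, reduction_tmul, map_smul,
        map_mul, mul_comm, mul_smul]
      rfl
    | add t t' h h' => rw [map_add, map_add, h, h', map_add, map_add]

/-- The action on `s ⊗ 1` displays the coordinates of the cochain, which makes the action faithful
and shows which cochain induces a given endomorphism. -/
theorem act_eq_sum (s : (E.sheaf i).sec V hi) :
    E.act A idx hV hi y ((E.sheaf i).tensMk hi s 1) = ∑ l, (E.sheaf i).tensMk hi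
      (E.compEnd idx hV hi (coords A.carrier _ y l) s) (Module.finBasis k A.carrier l) := by
  conv_lhs => rw [← sum_coords A.carrier y, map_sum]
  refine (AddMonoidHom.finsetSum_apply _ _ _).trans ?_
  exact Finset.sum_congr rfl fun l _ =>
    (E.act_tmul idx hV hi _ _ 1 s).trans (by rw [mul_one])

variable {E} in
/-- The action on the sections of the first sheaves is faithful. -/
theorem eq_of_act {y y' : E.cech.obj (SemiSimplexCategory.mk n) ⊗[k] A.carrier}
    (h : ∀ (idx : Fin (n + 1) → I) (V : S.Op) (hV : ∀ a, V ≤ U (idx a))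
      (t : ((E.sheaf (idx 0)).tens A.carrier).sec V (hV 0)),
      E.act A idx hV (hV 0) y t = E.act A idx hV (hV 0) y' t) : y = y' := by
  refine (coords A.carrier _).injective (funext fun l => cech_ext fun idx V hV s => ?_)
  have h1 := h idx V hV ((E.sheaf (idx 0)).tensMk (hV 0) s 1)
  rw [act_eq_sum, act_eq_sum] at h1
  exact congrFun (ModSheaf.sum_tensMk_inj _ _ h1) l

/-- The endomorphism of `E_i ⊗ A` given by a cochain. -/
def actHom (i : I) {W : S.Op} (hW : ∀ a, W ≤ U (idx a)) (hi : W ≤ U i) :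
    ModSheaf.HomOn (AlgHom.id k A.carrier) ((E.sheaf i).tens A.carrier)
      ((E.sheaf i).tens A.carrier) W hi hi where
  app _ h := E.act A idx (fun a => h.trans (hW a)) (h.trans hi) y
  app_smulO _ _ r t := E.act_smulO _ _ _ y t r
  app_smulA _ _ c t := E.act_smulA _ _ _ y t c
  app_res _ h t := E.act_res _ _ _ y t h

end act

/-- A family of endomorphisms of the sheaves `E_{idx 0} ⊗ A` that reduce to the identity is given
by a cochain that reduces to `1`. -/
theorem exists_act {n : ℕ}
    (φ : ∀ (idx : Fin (n + 1) → I) (V : S.Op) (hV : ∀ a, V ≤ U (idx a)),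
      ((E.sheaf (idx 0)).tens A.carrier).sec V (hV 0) →+
        ((E.sheaf (idx 0)).tens A.carrier).sec V (hV 0))
    (hO : ∀ idx V hV (r : S.O V) t, φ idx V hV (r • t) = r • φ idx V hV t)
    (hA : ∀ idx V hV (c : A.carrier) t, φ idx V hV (c • t) = c • φ idx V hV t)
    (hr : ∀ (idx : Fin (n + 1) → I) (V V' : S.Op) (hV : ∀ a, V ≤ U (idx a)) (h : V' ≤ V) t,
      ((E.sheaf (idx 0)).tens A.carrier).res (hV 0) h (φ idx V hV t) =
        φ idx V' (fun a => h.trans (hV a)) (((E.sheaf (idx 0)).tens A.carrier).res (hV 0) h t))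
    (hε : ∀ (idx : Fin (n + 1) → I) (V : S.Op) (hV : ∀ a, V ≤ U (idx a)) t,
      ((E.sheaf (idx 0)).tensAug A.aug).app V (hV 0) (φ idx V hV t) =
        ((E.sheaf (idx 0)).tensAug A.aug).app V (hV 0) t) :
    ∃ y : E.cech.obj (SemiSimplexCategory.mk n) ⊗[k] A.carrier, reduction _ A y = 1 ∧
      ∀ idx V hV t, E.act A idx hV (hV 0) y t = φ idx V hV t := by
  -- The coordinates of `φ(s ⊗ 1)` in the basis of `A`. By uniqueness each of them is `O`-linear in
  -- `s` and compatible with restriction, hence a cochain `x l`; the cochain sought is `∑ x_l ⊗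
  -- b_l`.
  choose c hc using fun (idx : Fin (n + 1) → I) (V : S.Op) (hV : ∀ a, V ≤ U (idx a))
    (s : (E.sheaf (idx 0)).sec V (hV 0)) =>
      (E.sheaf (idx 0)).exists_sum_tensMk (hV 0) (φ idx V hV ((E.sheaf (idx 0)).tensMk (hV 0) s 1))
  have hadd : ∀ idx V hV s s', c idx V hV (s + s') = c idx V hV s + c idx V hV s' := by
    intro idx V hV s s'
    refine (E.sheaf (idx 0)).sum_tensMk_inj (A := A.carrier) (hV 0) ?_
    rw [← hc, ModSheaf.tensMk_add, map_add, hc, hc, ← Finset.sum_add_distrib]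
    exact Finset.sum_congr rfl fun l _ => ((E.sheaf (idx 0)).tensMk_add _ _ _ _).symm
  have hsmul : ∀ idx V hV (r : S.O V) s, c idx V hV (r • s) = fun l => r • c idx V hV s l := by
    intro idx V hV r s
    refine (E.sheaf (idx 0)).sum_tensMk_inj (A := A.carrier) (hV 0) ?_
    rw [← hc, ← ModSheaf.tensMk_smulO, hO, hc, Finset.smul_sum]
    rfl
  have hres : ∀ (idx : Fin (n + 1) → I) (V V' : S.Op) (hV : ∀ a, V ≤ U (idx a)) (h : V' ≤ V) s,
      (fun l => (E.sheaf (idx 0)).res (hV 0) h (c idx V hV s l)) =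
        c idx V' (fun a => h.trans (hV a)) ((E.sheaf (idx 0)).res (hV 0) h s) := by
    intro idx V V' hV h s
    refine (E.sheaf (idx 0)).sum_tensMk_inj (A := A.carrier) (h.trans (hV 0)) ?_
    rw [← hc idx V' fun a => h.trans (hV a), ← ModSheaf.tensMk_res, ← hr, hc, map_sum]
    rfl
  choose x hx using fun l => E.exists_cech (n := n)
    (fun idx V hV => { toFun := fun s => c idx V hV s l
                       map_add' := fun s s' => congrFun (hadd idx V hV s s') l
                       map_smul' := fun r s => congrFun (hsmul idx V hV r s) l })
    (fun idx V V' hV h s => congrFun (hres idx V V' hV h s) l)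
  have hact : ∀ (idx : Fin (n + 1) → I) V hV t, E.act A idx hV (hV 0)
      (∑ l, x l ⊗ₜ[k] Module.finBasis k A.carrier l) t = φ idx V hV t := by
    intro idx V hV t
    induction t using ModSheaf.tens_induction with
    | tmul s b =>
      have h1 : E.act A idx hV (hV 0) (∑ l, x l ⊗ₜ[k] Module.finBasis k A.carrier l)
          ((E.sheaf (idx 0)).tensMk (hV 0) s 1) =
          φ idx V hV ((E.sheaf (idx 0)).tensMk (hV 0) s 1) := by
        rw [act_eq_sum, coords_sum, hc]
        exact Finset.sum_congr rfl fun l _ => by rw [hx]; rfl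
      have h2 : (E.sheaf (idx 0)).tensMk (hV 0) s b =
          b • (E.sheaf (idx 0)).tensMk (hV 0) s (1 : A.carrier) := by
        rw [ModSheaf.tensMk_smulA, mul_one]
      rw [h2, act_smulA, h1, hA]
    | add t t' h h' => rw [map_add, map_add, h, h']
  refine ⟨_, cech_ext fun idx V hV s => ?_, hact⟩
  have h1 := E.tensAug_act idx hV (hV 0) (∑ l, x l ⊗ₜ[k] Module.finBasis k A.carrier l)
    ((E.sheaf (idx 0)).tensMk (hV 0) s 1)
  rw [hact, hε, ModSheaf.tensAug_tensMk, map_one, one_smul] at h1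
  rw [← h1, map_one]
  rfl

end TwistedSheaf

end

end TwistedDef

/-! ### Deformations as twists of the trivial one by multiplicative cocycles. -/

namespace TwistedDef

noncomputable section

variable {k : Type u} [Field k] {S : KSpace k} {I : Type u} {U : I → S.Op} {α : Cocycle2 S U}

theorem isUnit_of_reduction_eq_one {R : Type u} [Ring R] [Algebra k R] {A : ArtAlg k}
    {x : R ⊗[k] A.carrier} (hx : reduction R A x = 1) : IsUnit x := by
  have h : IsNilpotent (x - 1) := isNilpotent_of_mem (mem_nilp_iff.2 (by
    rw [map_sub, hx, map_one, sub_self]))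
  simpa using h.isUnit_one_add

namespace TwistedSheaf

variable {E : TwistedSheaf S U α} {A : ArtAlg k}

theorem le_single {V : S.Op} {i : I} (hi : V ≤ U i) : ∀ a, V ≤ U ((![i] : Fin 1 → I) a) := by
  intro a; fin_cases a; exact hi

theorem le_pair {V : S.Op} {i j : I} (hi : V ≤ U i) (hj : V ≤ U j) :
    ∀ a, V ≤ U ((![i, j] : Fin 2 → I) a) := by
  intro a; fin_cases a; exacts [hi, hj]

theorem le_triple {V : S.Op} {i j l : I} (hi : V ≤ U i) (hj : V ≤ U j) (hl : V ≤ U l) :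
    ∀ a, V ≤ U ((![i, j, l] : Fin 3 → I) a) := by
  intro a; fin_cases a; exacts [hi, hj, hl]

variable (E A) in
/-- The action of the component `a_i` of a `0`-cochain on `E_p ⊗ A`. -/
def act₀ {V : S.Op} {i p : I} (hi : V ≤ U i) (hp : V ≤ U p) :
    E.cech.obj (SemiSimplexCategory.mk 0) ⊗[k] A.carrier →+*
      AddMonoid.End (((E.sheaf p).tens A.carrier).sec V hp) := E.act A ![i] (le_single hi) hp

variable (E A) in
/-- The action of the component `m_ij` of a `1`-cochain on `E_p ⊗ A`. -/
def act₁ {V : S.Op} {i j p : I} (hi : V ≤ U i) (hj : V ≤ U j) (hp : V ≤ U p) :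
    E.cech.obj (SemiSimplexCategory.mk 1) ⊗[k] A.carrier →+*
      AddMonoid.End (((E.sheaf p).tens A.carrier).sec V hp) := E.act A ![i, j] (le_pair hi hj) hp

section

variable {V : S.Op} {i j l p q : I} (hi : V ≤ U i) (hj : V ≤ U j) (hl : V ≤ U l) (hp : V ≤ U p)
  (hq : V ≤ U q) (b : E.cech.obj (SemiSimplexCategory.mk 0) ⊗[k] A.carrier)
  (y : E.cech.obj (SemiSimplexCategory.mk 1) ⊗[k] A.carrier)
  (t : ((E.sheaf p).tens A.carrier).sec V hp)

theorem act₀_gT : (E.gT A p q).app V (le_inf hp hq) (E.act₀ A hi hp b t) =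
    E.act₀ A hi hq b ((E.gT A p q).app V (le_inf hp hq) t) := E.act_gT _ _ hp hq b t

theorem act₁_gT : (E.gT A p q).app V (le_inf hp hq) (E.act₁ A hi hj hp y t) =
    E.act₁ A hi hj hq y ((E.gT A p q).app V (le_inf hp hq) t) := E.act_gT _ _ hp hq y t

theorem act₁_coface_zero :
    E.act₁ A hi hj hp (coface E.cech A 0 0 b) t = E.act₀ A hj hp b t :=
  E.act_coface _ _ hp b t 0 _ fun a => by fin_cases a; rfl

theorem act₁_coface_one :
    E.act₁ A hi hj hp (coface E.cech A 0 1 b) t = E.act₀ A hi hp b t :=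
  E.act_coface _ _ hp b t 1 _ fun a => by fin_cases a; rfl

theorem act_coface_zero : E.act A ![i, j, l] (le_triple hi hj hl) hp (coface E.cech A 1 0 y) t =
    E.act₁ A hj hl hp y t :=
  E.act_coface _ _ hp y t 0 _ fun a => by fin_cases a <;> rfl

theorem act_coface_one : E.act A ![i, j, l] (le_triple hi hj hl) hp (coface E.cech A 1 1 y) t =
    E.act₁ A hi hl hp y t :=
  E.act_coface _ _ hp y t 1 _ fun a => by fin_cases a <;> rfl

theorem act_coface_two : E.act A ![i, j, l] (le_triple hi hj hl) hp (coface E.cech A 1 2 y) t =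
    E.act₁ A hi hj hp y t :=
  E.act_coface _ _ hp y t 2 _ fun a => by fin_cases a <;> rfl

theorem act₀_mul_apply (b' : E.cech.obj (SemiSimplexCategory.mk 0) ⊗[k] A.carrier) :
    E.act₀ A hi hp (b * b') t = E.act₀ A hi hp b (E.act₀ A hi hp b' t) :=
  E.act_mul_apply _ _ _ _ _ _

theorem act₁_mul_apply (y' : E.cech.obj (SemiSimplexCategory.mk 1) ⊗[k] A.carrier) :
    E.act₁ A hi hj hp (y * y') t = E.act₁ A hi hj hp y (E.act₁ A hi hj hp y' t) :=
  E.act_mul_apply _ _ _ _ _ _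

variable {y} in
theorem act₁_injective (hy : reduction _ A y = 1) :
    Function.Injective (E.act₁ A hi hj hp y) := by
  obtain ⟨y', hy'⟩ := (isUnit_of_reduction_eq_one hy).exists_left_inv
  refine Function.LeftInverse.injective (g := E.act₁ A hi hj hp y') fun t => ?_
  rw [← act₁_mul_apply, hy']
  exact E.act_one_apply _ _ _ t

variable {b} in
theorem act₀_bijective (hb : reduction _ A b = 1) :
    Function.Bijective (E.act₀ A hi hp b) := by
  obtain ⟨b', hb'⟩ := (isUnit_of_reduction_eq_one hb).exists_left_inv
  obtain ⟨b'', hb''⟩ := (isUnit_of_reduction_eq_one hb).exists_right_inv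
  refine ⟨Function.LeftInverse.injective (g := E.act₀ A hi hp b') fun t => ?_,
    Function.RightInverse.surjective (g := E.act₀ A hi hp b'') fun t => ?_⟩
  · rw [← act₀_mul_apply, hb']
    exact E.act_one_apply _ _ _ t
  · rw [← act₀_mul_apply, hb'']
    exact E.act_one_apply _ _ _ t

variable {b} in
theorem tensAug_act₀ (hb : reduction _ A b = 1) :
    ((E.sheaf p).tensAug A.aug).app V hp (E.act₀ A hi hp b t) =
      ((E.sheaf p).tensAug A.aug).app V hp t := by
  refine (E.tensAug_act _ _ hp b t).trans ?_
  rw [hb, map_one]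
  rfl

variable {y} in
theorem tensAug_act₁ (hy : reduction _ A y = 1) :
    ((E.sheaf p).tensAug A.aug).app V hp (E.act₁ A hi hj hp y t) =
      ((E.sheaf p).tensAug A.aug).app V hp t := by
  refine (E.tensAug_act _ _ hp y t).trans ?_
  rw [hy, map_one]
  rfl

theorem gT_symm (t : ((E.sheaf i).tens A.carrier).sec V hi) :
    (E.gT A j i).app V (le_inf hj hi) ((E.gT A i j).app V (le_inf hi hj) t) = t := by
  induction t using ModSheaf.tens_induction with
  | tmul s a =>
    rw [ModSheaf.tensMap_tensMk, ModSheaf.tensMap_tensMk, E.g_symm i j V hi hj]; rfl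
  | add t t' h h' => rw [map_add, map_add, h, h']

theorem gT_cocycle (t : ((E.sheaf i).tens A.carrier).sec V hi) :
    (E.gT A l i).app V (le_inf hl hi) ((E.gT A j l).app V (le_inf hj hl)
      ((E.gT A i j).app V (le_inf hi hj) t)) =
      S.res (le_inf (le_inf hi hj) hl) (α.val i j l).1 • t := by
  induction t using ModSheaf.tens_induction with
  | tmul s a =>
    rw [ModSheaf.tensMap_tensMk, ModSheaf.tensMap_tensMk, ModSheaf.tensMap_tensMk,
      E.g_cocycle i j l V hi hj hl]; rfl
  | add t t' h h' => rw [map_add, map_add, map_add, h, h', smul_add]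

theorem tensAug_gT (t : ((E.sheaf i).tens A.carrier).sec V hi) :
    ((E.sheaf j).tensAug A.aug).app V hj ((E.gT A i j).app V (le_inf hi hj) t) =
      (E.g i j).app V (le_inf hi hj) (((E.sheaf i).tensAug A.aug).app V hi t) := by
  induction t using ModSheaf.tens_induction with
  | tmul s a =>
    rw [ModSheaf.tensMap_tensMk, ModSheaf.tensAug_tensMk, ModSheaf.tensAug_tensMk,
      (E.g i j).app_smulA]; rfl
  | add t t' h h' => rw [map_add, map_add, map_add, map_add, h, h']

end

theorem eq_of_act₀ {b b' : E.cech.obj (SemiSimplexCategory.mk 0) ⊗[k] A.carrier}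
    (h : ∀ (i : I) (V : S.Op) (hi : V ≤ U i) (t : ((E.sheaf i).tens A.carrier).sec V hi),
      E.act₀ A hi hi b t = E.act₀ A hi hi b' t) : b = b' := by
  refine eq_of_act fun idx V hV t => ?_
  obtain ⟨i, rfl⟩ : ∃ i, idx = ![i] := ⟨idx 0, by funext a; fin_cases a; rfl⟩
  exact h i V (hV 0) t

theorem eq_of_act₁ {y y' : E.cech.obj (SemiSimplexCategory.mk 1) ⊗[k] A.carrier}
    (h : ∀ (i j : I) (V : S.Op) (hi : V ≤ U i) (hj : V ≤ U j)
      (t : ((E.sheaf i).tens A.carrier).sec V hi),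
      E.act₁ A hi hj hi y t = E.act₁ A hi hj hi y' t) : y = y' := by
  refine eq_of_act fun idx V hV t => ?_
  obtain ⟨i, j, rfl⟩ : ∃ i j, idx = ![i, j] := ⟨idx 0, idx 1, by funext a; fin_cases a <;> rfl⟩
  exact h i j V (hV 0) (hV 1) t

/-- The cocycle condition `∂₁ y = ∂₀ y · ∂₂ y`. -/
def IsMulCocycle (y : E.cech.obj (SemiSimplexCategory.mk 1) ⊗[k] A.carrier) : Prop :=
  coface E.cech A 1 1 y = coface E.cech A 1 0 y * coface E.cech A 1 2 y

/-- The faces that omit `0`, `1`, `2` of `(i, j, l)` are `(j, l)`, `(i, l)`, `(i, j)`, so the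
condition is `y_il = y_jl y_ij`. By faithfulness it can be tested on `E_i ⊗ A` alone. -/
theorem isMulCocycle_iff {y : E.cech.obj (SemiSimplexCategory.mk 1) ⊗[k] A.carrier} :
    IsMulCocycle y ↔ ∀ (i j l : I) (V : S.Op) (hi : V ≤ U i) (hj : V ≤ U j) (hl : V ≤ U l)
      (t : ((E.sheaf i).tens A.carrier).sec V hi),
      E.act₁ A hi hl hi y t = E.act₁ A hj hl hi y (E.act₁ A hi hj hi y t) := by
  constructor
  · intro h i j l V hi hj hl t
    rw [← act_coface_one hi hj hl, h, act_mul_apply, act_coface_two hi hj hl,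
      act_coface_zero hi hj hl]
  · intro h
    refine eq_of_act fun idx V hV t => ?_
    obtain ⟨i, j, l, rfl⟩ : ∃ i j l, idx = ![i, j, l] :=
      ⟨idx 0, idx 1, idx 2, by funext a; fin_cases a <;> rfl⟩
    have hi : V ≤ U i := hV 0
    have hj : V ≤ U j := hV 1
    have hl : V ≤ U l := hV 2
    change ((E.sheaf i).tens A.carrier).sec V hi at t
    change E.act A ![i, j, l] (le_triple hi hj hl) hi (coface E.cech A 1 1 y) t =
      E.act A ![i, j, l] (le_triple hi hj hl) hi (coface E.cech A 1 0 y * coface E.cech A 1 2 y) t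
    rw [act_mul_apply, act_coface_one hi hj hl, act_coface_two hi hj hl, act_coface_zero hi hj hl,
      h i j l V hi hj hl]

section

variable {y : E.cech.obj (SemiSimplexCategory.mk 1) ⊗[k] A.carrier}

/-- `y_ii = y_ii y_ii`, and `y_ii` is invertible. -/
theorem IsMulCocycle.act_self (hc : IsMulCocycle y) (hy : reduction _ A y = 1) {i : I}
    {V : S.Op} (hi : V ≤ U i) (t : ((E.sheaf i).tens A.carrier).sec V hi) :
    E.act₁ A hi hi hi y t = t :=
  act₁_injective hi hi hi hy (isMulCocycle_iff.1 hc i i i V hi hi hi t).symm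

theorem IsMulCocycle.act_symm (hc : IsMulCocycle y) (hy : reduction _ A y = 1) {i j : I}
    {V : S.Op} (hi : V ≤ U i) (hj : V ≤ U j) (t : ((E.sheaf i).tens A.carrier).sec V hi) :
    E.act₁ A hj hi hi y (E.act₁ A hi hj hi y t) = t := by
  rw [← isMulCocycle_iff.1 hc i j i V hi hj hi, hc.act_self hy]

variable (y) in
/-- The isomorphism `g_ij` twisted by the component `y_ij` of a cochain. -/
def twist (i j : I) : ModSheaf.HomOn (AlgHom.id k A.carrier) ((E.sheaf i).tens A.carrier)
    ((E.sheaf j).tens A.carrier) (U i ⊓ U j) KSpace.infl KSpace.infr :=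
  (E.gT A i j).comp (E.actHom ![i, j] y i (le_pair KSpace.infl KSpace.infr) KSpace.infl)
    fun _ => rfl

theorem twist_app {i j : I} {V : S.Op} (hi : V ≤ U i) (hj : V ≤ U j)
    (t : ((E.sheaf i).tens A.carrier).sec V hi) :
    (twist y i j).app V (le_inf hi hj) t =
      (E.gT A i j).app V (le_inf hi hj) (E.act₁ A hi hj hi y t) := rfl

/-- Cochains commute with the `g`, so all three components of `y` can be moved to `E_i` while the
three `g` compose to `α`. This separates the twist `α` from the deformation. -/
theorem twist_twist {i j l : I} {V : S.Op} (hi : V ≤ U i) (hj : V ≤ U j) (hl : V ≤ U l)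
    (t : ((E.sheaf i).tens A.carrier).sec V hi) :
    (twist y l i).app V (le_inf hl hi) ((twist y j l).app V (le_inf hj hl)
      ((twist y i j).app V (le_inf hi hj) t)) =
      S.res (le_inf (le_inf hi hj) hl) (α.val i j l).1 •
        E.act₁ A hl hi hi y (E.act₁ A hj hl hi y (E.act₁ A hi hj hi y t)) := by
  rw [twist_app hl hi, twist_app hj hl, twist_app hi hj, ← act₁_gT hj hl hi hj,
    ← act₁_gT hl hi hj hl, ← act₁_gT hl hi hi hj, gT_cocycle hi hj hl]

theorem twist_symm (hc : IsMulCocycle y) (hy : reduction _ A y = 1) {i j : I} {V : S.Op}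
    (hi : V ≤ U i) (hj : V ≤ U j) (t : ((E.sheaf i).tens A.carrier).sec V hi) :
    (twist y j i).app V (le_inf hj hi) ((twist y i j).app V (le_inf hi hj) t) = t := by
  rw [twist_app hi hj, twist_app hj hi, ← act₁_gT hj hi hi hj, hc.act_symm hy hi hj,
    gT_symm hi hj]

/-- The deformation of `E` obtained by twisting the trivial one by a multiplicative cocycle. -/
def deformation (hE : ∀ i, (E.sheaf i).IsLocallyFree) (hy : reduction _ A y = 1)
    (hc : IsMulCocycle y) : Deformation E A where
  F i := (E.sheaf i).tens A.carrier
  coherent i := (hE i).isCoherent_tens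
  flat i _ hx := (E.sheaf i).tens_flat hx
  h i := (E.sheaf i).tensAug A.aug
  h_isPullback i := (E.sheaf i).tensAug_isPullback A.aug
  g i j := twist y i j
  g_isIso i j V hV := by
    have hi : V ≤ U i := hV.trans KSpace.infl
    have hj : V ≤ U j := hV.trans KSpace.infr
    exact ⟨Function.LeftInverse.injective (g := (twist y j i).app V (le_inf hj hi))
      fun t => twist_symm hc hy hi hj t,
      Function.RightInverse.surjective (g := (twist y j i).app V (le_inf hj hi))
      fun t => twist_symm hc hy hj hi t⟩
  comm i j V hi hj t := by
    rw [twist_app hi hj, tensAug_gT hi hj, tensAug_act₁ hi hj hi t hy]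
  cocycle i j l V hi hj hl t := by
    rw [twist_twist hi hj hl, ← isMulCocycle_iff.1 hc i j l V hi hj hl, hc.act_symm hy hi hl]

end

/-- An isomorphism is a family of automorphisms of the `E_i ⊗ A` over the identity of `E_i`, that
is, a 0-cochain `b` with reduction `1`. Compatibility with the gluings says `b_j y_ij = y'_ij b_i`,
since the `g_ij` can be cancelled. -/
theorem deformation_equiv_iff (hE : ∀ i, (E.sheaf i).IsLocallyFree)
    {y y' : E.cech.obj (SemiSimplexCategory.mk 1) ⊗[k] A.carrier} (hy : reduction _ A y = 1)
    (hc : IsMulCocycle y) (hy' : reduction _ A y' = 1) (hc' : IsMulCocycle y') :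
    (deformation hE hy hc).Equiv (deformation hE hy' hc') ↔
      ∃ b : E.cech.obj (SemiSimplexCategory.mk 0) ⊗[k] A.carrier, reduction _ A b = 1 ∧
        coface E.cech A 0 0 b * y = y' * coface E.cech A 0 1 b := by
  constructor
  · rintro ⟨φ, -, hg, hh⟩
    obtain ⟨b, hb, h⟩ := E.exists_act (A := A) (n := 0)
      (fun idx V hV => (φ (idx 0)).app V (hV 0)) (fun idx V hV => (φ (idx 0)).app_smulO V (hV 0))
      (fun idx V hV => (φ (idx 0)).app_smulA V (hV 0))
      (fun idx V V' hV h t => ((φ (idx 0)).app_res (hV 0) h t).symm)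
      (fun idx V hV t => hh (idx 0) V (hV 0) t)
    have h' : ∀ (i : I) (V : S.Op) (hi : V ≤ U i) (t : ((E.sheaf i).tens A.carrier).sec V hi),
        (φ i).app V hi t = E.act₀ A hi hi b t :=
      fun i V hi t => (h ![i] V (le_single hi) t).symm
    refine ⟨b, hb, eq_of_act₁ fun i j V hi hj t => ?_⟩
    have h1 : (φ j).app V hj ((twist y i j).app V (le_inf hi hj) t) =
      (twist y' i j).app V (le_inf hi hj) ((φ i).app V hi t) := hg i j V hi hj t
    rw [h' j V hj, h' i V hi, twist_app hi hj, twist_app hi hj, ← act₀_gT hj hi hj] at h1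
    -- Applying the inverse of `g_ij` brings the equation back to `E_i ⊗ A`.
    replace h1 := congrArg ((E.gT A j i).app V (le_inf hj hi)) h1
    rw [gT_symm hi hj, gT_symm hi hj] at h1
    rw [act₁_mul_apply, act₁_mul_apply, act₁_coface_zero, act₁_coface_one, h1]
  · rintro ⟨b, hb, h⟩
    refine ⟨fun i => E.actHom ![i] b i (le_single le_rfl) le_rfl,
      fun i V hi => act₀_bijective hi hi hb, fun i j V hi hj t => ?_,
      fun i V hi t => tensAug_act₀ hi hi t hb⟩
    change ((E.sheaf i).tens A.carrier).sec V hi at t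
    change E.act₀ A hj hj b ((twist y i j).app V (le_inf hi hj) t) =
      (twist y' i j).app V (le_inf hi hj) (E.act₀ A hi hi b t)
    rw [twist_app hi hj, twist_app hi hj, ← act₀_gT hj hi hj, ← act₁_coface_zero hi hj hi,
      ← act₁_mul_apply, h, act₁_mul_apply, act₁_coface_one]

/-- In trivialisations `φ_i` of the sheaves of `D`, the cochain `y_ij = g_ij⁻¹ φ_j⁻¹ g_ij,A φ_i`
measures how the gluing of `D` differs from that of `E`; it reduces to `1` because the `φ_i` respect
the morphisms to `E_i`. -/
theorem exists_equiv_deformation [CharZero k] (hE : ∀ i, (E.sheaf i).IsLocallyFree)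
    (hU : ∀ i, ∀ G : ModSheaf S k (U i), G.IsLocallyFree → G.H1Vanishes) (D : Deformation E A) :
    ∃ (y : E.cech.obj (SemiSimplexCategory.mk 1) ⊗[k] A.carrier) (hy : reduction _ A y = 1)
      (hc : IsMulCocycle y), (deformation hE hy hc).Equiv D := by
  choose φ hφ hh using fun i =>
    ModSheaf.exists_iso_tens (hE i) (D.flat i) (D.h_isPullback i) (hU i)
  -- `θ i` is the inverse of `φ i` as a morphism of sheaves.
  choose θ hθ using fun i => ((hφ i).isPullback fun _ => rfl).exists_desc
    (g := AlgHom.id k A.carrier) (ModSheaf.HomOn.id _ (le_refl (U i))) (fun _ => rfl)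
  replace hθ : ∀ i V hi t, (θ i).app V hi ((φ i).app V hi t) = t := fun i V hi t => hθ i V hi t
  have hθ' : ∀ i V hi t, (φ i).app V hi ((θ i).app V hi t) = t := fun i V hi t => by
    obtain ⟨s, rfl⟩ := (hφ i V hi).2 t
    rw [hθ]
  obtain ⟨y, hy, h⟩ := E.exists_act (A := A) (n := 1)
    (fun idx V hV => ((E.gT A (idx 1) (idx 0)).app V (le_inf (hV 1) (hV 0))).comp
      (((θ (idx 1)).app V (hV 1)).comp (((D.g (idx 0) (idx 1)).app V (le_inf (hV 0) (hV 1))).comp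
        ((φ (idx 0)).app V (hV 0)))))
    (fun idx V hV r t => by
      simp only [AddMonoidHom.comp_apply]
      rw [(φ _).app_smulO, (D.g _ _).app_smulO, (θ _).app_smulO, ModSheaf.HomOn.app_smulO])
    (fun idx V hV r t => by
      simp only [AddMonoidHom.comp_apply]
      rw [(φ _).app_smulA, AlgHom.id_apply, (D.g _ _).app_smulA, AlgHom.id_apply,
        (θ _).app_smulA, AlgHom.id_apply, ModSheaf.HomOn.app_smulA, AlgHom.id_apply])
    (fun idx V V' hV h t => by
      simp only [AddMonoidHom.comp_apply]
      rw [(φ (idx 0)).app_res (hV 0) h, (D.g (idx 0) (idx 1)).app_res (le_inf (hV 0) (hV 1)) h,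
        (θ (idx 1)).app_res (hV 1) h,
        (E.gT A (idx 1) (idx 0)).app_res (le_inf (hV 1) (hV 0)) h])
    (fun idx V hV t => by
      simp only [AddMonoidHom.comp_apply]
      rw [tensAug_gT (hV 1) (hV 0), ← hh, hθ', D.comm _ _ V (hV 0) (hV 1), hh,
        E.g_symm _ _ V (hV 0) (hV 1)])
  have hg : ∀ (i j : I) (V : S.Op) (hi : V ≤ U i) (hj : V ≤ U j)
      (t : ((E.sheaf i).tens A.carrier).sec V hi),
      (φ j).app V hj ((twist y i j).app V (le_inf hi hj) t) =
        (D.g i j).app V (le_inf hi hj) ((φ i).app V hi t) := by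
    intro i j V hi hj t
    have h1 : E.act₁ A hi hj hi y t = (E.gT A j i).app V (le_inf hj hi) ((θ j).app V hj
      ((D.g i j).app V (le_inf hi hj) ((φ i).app V hi t))) := h ![i, j] V (le_pair hi hj) t
    rw [twist_app hi hj, h1, gT_symm hj hi, hθ']
  -- The cocycle condition of `D` in terms of `y`; the invertible function `α_ijl` stands on both
  -- sides and cancels.
  have h3 : ∀ (i j l : I) (V : S.Op) (hi : V ≤ U i) (hj : V ≤ U j) (hl : V ≤ U l)
      (t : ((E.sheaf i).tens A.carrier).sec V hi),
      E.act₁ A hl hi hi y (E.act₁ A hj hl hi y (E.act₁ A hi hj hi y t)) = t := by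
    intro i j l V hi hj hl t
    have h1 := twist_twist (y := y) hi hj hl t
    replace h1 := congrArg ((φ i).app V hi) h1
    rw [hg l i V hl hi, hg j l V hj hl, hg i j V hi hj, D.cocycle i j l V hi hj hl,
      ← (φ i).app_smulO] at h1
    replace h1 := (hφ i V hi).1 h1
    exact ((((α.val i j l).isUnit.map (S.res (le_inf (le_inf hi hj) hl))).smul_left_cancel).1
      h1).symm
  -- A deformation does not include `g_ii = id`. The case `i = j = l` of `h3` says that the
  -- 0-cochain with components `y_ii` has cube `1`, so it is `1` in characteristic zero.
  have h0 : ∀ (i : I) (V : S.Op) (hi : V ≤ U i) (t : ((E.sheaf i).tens A.carrier).sec V hi),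
      E.act₁ A hi hi hi y t = t := by
    obtain ⟨z, hz, hz'⟩ := E.exists_act (A := A) (n := 0)
      (fun idx V hV => E.act₁ A (hV 0) (hV 0) (hV 0) y)
      (fun idx V hV r t => E.act_smulO _ _ _ y t r) (fun idx V hV r t => E.act_smulA _ _ _ y t r)
      (fun idx V V' hV h t => (E.act_res _ _ _ y t h).symm)
      (fun idx V hV t => tensAug_act₁ (hV 0) (hV 0) (hV 0) t hy)
    have hz'' : ∀ (i : I) (V : S.Op) (hi : V ≤ U i) (t : ((E.sheaf i).tens A.carrier).sec V hi),
        E.act₀ A hi hi z t = E.act₁ A hi hi hi y t := fun i V hi t => hz' ![i] V (le_single hi) t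
    have hz1 : z = 1 := eq_one_of_cube hz (eq_of_act₀ fun i V hi t => by
      rw [act₀_mul_apply, act₀_mul_apply, hz'', hz'', hz'', h3]
      exact (E.act_one_apply _ _ _ t).symm)
    intro i V hi t
    rw [← hz'', hz1]
    exact E.act_one_apply _ _ _ t
  have hc : IsMulCocycle y := isMulCocycle_iff.2 fun i j l V hi hj hl t => by
    -- After applying `y_li` both sides equal `t`: one by `h3` for `(i, j, l)`, the other by `h3`
    -- for `(i, l, i)` and `y_ii = 1`.
    refine act₁_injective hl hi hi hy ?_
    rw [h3 i j l V hi hj hl]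
    have := h3 i l i V hi hl hi t
    rwa [h0] at this
  exact ⟨y, hy, hc, φ, hφ, hg, hh⟩

/-- The maps `E_i ⊗ A → E_i ⊗ B` are pullbacks, and they intertwine the action of `y` with that of
its image in coefficients `B`. -/
theorem deformation_isPullbackOf {B : ArtAlg k} (f : A ⟶ B)
    (hE : ∀ i, (E.sheaf i).IsLocallyFree)
    {y : E.cech.obj (SemiSimplexCategory.mk 1) ⊗[k] A.carrier} (hy : reduction _ A y = 1)
    (hc : IsMulCocycle y) (hy' : reduction _ B (scMap E.cech f 1 y) = 1)
    (hc' : IsMulCocycle (scMap E.cech f 1 y)) :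
    (deformation hE hy hc).IsPullbackOf f (deformation hE hy' hc') := by
  refine ⟨fun i => ModSheaf.tensMap (f : A.carrier →ₐ[k] B.carrier)
    (ModSheaf.HomOn.id (E.sheaf i) (le_refl (U i))),
    fun i => ModSheaf.tensMap_id_isPullback _ (E.sheaf i), fun i j V hi hj t => ?_,
    fun i V hi t => ?_⟩
  · change ((E.sheaf i).tens A.carrier).sec V hi at t
    change (ModSheaf.tensMap (f : A.carrier →ₐ[k] B.carrier)
      (ModSheaf.HomOn.id (E.sheaf j) (le_refl (U j)))).app V hj
        ((E.gT A i j).app V (le_inf hi hj) (E.act A ![i, j] (le_pair hi hj) hi y t)) =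
      (E.gT B i j).app V (le_inf hi hj) (E.act B ![i, j] (le_pair hi hj) hi (scMap E.cech f 1 y)
        ((ModSheaf.tensMap (f : A.carrier →ₐ[k] B.carrier)
          (ModSheaf.HomOn.id (E.sheaf i) (le_refl (U i)))).app V hi t))
    rw [act_scMap]
    generalize E.act A ![i, j] (le_pair hi hj) hi y t = t'
    induction t' using ModSheaf.tens_induction with
    | tmul s a => rfl
    | add t t' h h' => rw [map_add, map_add, h, h', map_add, map_add]
  · change ((E.sheaf i).tens A.carrier).sec V hi at t
    change ((E.sheaf i).tensAug B.aug).app V hi ((ModSheaf.tensMap (f : A.carrier →ₐ[k] B.carrier)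
      (ModSheaf.HomOn.id (E.sheaf i) (le_refl (U i)))).app V hi t) =
        ((E.sheaf i).tensAug A.aug).app V hi t
    induction t using ModSheaf.tens_induction with
    | tmul s a =>
      rw [ModSheaf.tensMap_tensMk, ModSheaf.tensAug_tensMk, ModSheaf.tensAug_tensMk,
        ← ArtAlg.aug_map]
      rfl
    | add t t' h h' => rw [map_add, map_add, h, h', map_add]

end TwistedSheaf

end

end TwistedDef

/-! ### From multiplicative cocycles to `H¹_sc`, and the comparison isomorphism. -/

namespace TwistedDef

noncomputable section

variable {k : Type u} [Field k] [CharZero k]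

theorem reduction_nexp_neg {R : Type u} [Ring R] [Algebra k R] {A : ArtAlg k}
    {m : R ⊗[k] A.carrier} (hm : m ∈ nilp R A) : reduction R A (nexp k (-m)) = 1 :=
  reduction_nexp (Submodule.neg_mem _ hm)

theorem coface_nexp_neg (G : SemiSimplexCategory ⥤ AlgCat.{u} k) {A : ArtAlg k} {n : ℕ}
    (j : Fin (n + 2)) {m : G.obj (SemiSimplexCategory.mk n) ⊗[k] A.carrier} (hm : m ∈ nilp _ A) :
    coface G A n j (nexp k (-m)) = nexp k (-(coface G A n j m)) := by
  rw [map_nexp _ (isNilpotent_of_mem hm).neg, map_neg]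

/-- Solving for `c` on the other side turns the gauge relation for `e^m` into the one for `e^{-m}`.
-/
theorem mul_mul_eq_iff_of_inverses {M : Type*} [Monoid M] (c : M) {x x' y y' z z' : M}
    (hx : x * x' = 1) (hx' : x' * x = 1) (hy : y * y' = 1) (hy' : y' * y = 1) (hz : z * z' = 1)
    (hz' : z' * z = 1) : c * x * z = y ↔ z' * x' = y' * c :=
  ⟨fun h => by
    calc z' * x' = y' * y * (z' * x') := by rw [hy', one_mul]
      _ = y' * (c * (x * (z * z') * x')) := by simp only [← h, mul_assoc]
      _ = y' * c := by rw [hz, mul_one, hx, mul_one],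
  fun h => by
    calc c * x * z = y * (y' * c) * x * z := by rw [← mul_assoc, hy, one_mul]
      _ = y * (z' * (x' * x) * z) := by simp only [← h, mul_assoc]
      _ = y := by rw [hx', mul_one, hz', mul_one]⟩

/-- With `y = e^{-m}` and `b = e^{-a}` the relation is `∂₀b · y = y' · ∂₁b`. Every `b` that reduces
to `1` is such an exponential, so `a` may be traded for `b`. -/
theorem relSc_iff (G : SemiSimplexCategory ⥤ AlgCat.{u} k) {A : ArtAlg k} {m m' : Z1sc G A} : relSc G A m m' ↔
    ∃ b : G.obj (SemiSimplexCategory.mk 0) ⊗[k] A.carrier, reduction _ A b = 1 ∧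
      coface G A 0 0 b * nexp k (-m.1) = nexp k (-m'.1) * coface G A 0 1 b := by
  have hm := isNilpotent_of_mem m.2.1
  have hm' := isNilpotent_of_mem m'.2.1
  have key : ∀ a ∈ nilp (G.obj (SemiSimplexCategory.mk 0)) A,
      (nexp k (-(coface G A 0 1 a)) * nexp k m.1 * nexp k (coface G A 0 0 a) =
        nexp k m'.1) ↔ nexp k (-(coface G A 0 0 a)) * nexp k (-m.1) =
        nexp k (-m'.1) * nexp k (-(coface G A 0 1 a)) := by
    intro a ha
    have h0 := isNilpotent_of_mem (coface_mem G 0 ha)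
    exact mul_mul_eq_iff_of_inverses _ (nexp_mul_nexp_neg hm) (nexp_neg_mul_nexp hm)
      (nexp_mul_nexp_neg hm') (nexp_neg_mul_nexp hm') (nexp_mul_nexp_neg h0) (nexp_neg_mul_nexp h0)
  constructor
  · rintro ⟨a, ha, h⟩
    refine ⟨nexp k (-a), reduction_nexp_neg ha, ?_⟩
    rw [coface_nexp_neg _ 0 ha, coface_nexp_neg _ 1 ha]
    exact (key a ha).1 h
  · rintro ⟨b, hb, h⟩
    obtain ⟨a, ha, rfl⟩ := exists_nexp_eq hb
    obtain ⟨a, rfl⟩ : ∃ a', a = -a' := ⟨-a, (neg_neg a).symm⟩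
    replace ha : a ∈ nilp _ A := by simpa using Submodule.neg_mem _ ha
    rw [coface_nexp_neg _ 0 ha, coface_nexp_neg _ 1 ha] at h
    exact ⟨a, ha, (key a ha).2 h⟩

variable {S : KSpace k} {I : Type u} {U : I → S.Op} {α : Cocycle2 S U}

namespace TwistedSheaf

variable {E : TwistedSheaf S U α} {A B : ArtAlg k}

/-- The sign accounts for the order of composition: for `e^m` the condition defining `Z¹_sc` would
read `∂₁ = ∂₂ · ∂₀`, whereas for `e^{-m}` it is `∂₁ = ∂₀ · ∂₂`. -/
theorem isMulCocycle_nexp_neg_iff {m : E.cech.obj (SemiSimplexCategory.mk 1) ⊗[k] A.carrier}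
    (hm : m ∈ nilp _ A) : IsMulCocycle (nexp k (-m)) ↔ nexp k (coface E.cech A 1 0 m) *
      nexp k (-(coface E.cech A 1 1 m)) * nexp k (coface E.cech A 1 2 m) = 1 := by
  have h0 := isNilpotent_of_mem (coface_mem E.cech 0 hm)
  have h2 := isNilpotent_of_mem (coface_mem E.cech 2 hm)
  rw [IsMulCocycle, coface_nexp_neg _ 0 hm, coface_nexp_neg _ 1 hm, coface_nexp_neg _ 2 hm]
  constructor
  · intro h
    rw [h, ← mul_assoc, nexp_mul_nexp_neg h0, one_mul, nexp_neg_mul_nexp h2]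
  · intro h
    have h' : nexp k (-(coface E.cech A 1 0 m)) * (nexp k (coface E.cech A 1 0 m) *
      nexp k (-(coface E.cech A 1 1 m)) * nexp k (coface E.cech A 1 2 m)) *
        nexp k (-(coface E.cech A 1 2 m)) =
        nexp k (-(coface E.cech A 1 0 m)) * nexp k (-(coface E.cech A 1 2 m)) := by
      rw [h, mul_one]
    rw [← h', mul_assoc, mul_assoc (nexp k (coface E.cech A 1 0 m) * _), nexp_mul_nexp_neg h2,
      mul_one, ← mul_assoc, nexp_neg_mul_nexp h0, one_mul]

/-- The deformation defined by an element of `Z¹_sc(exp g)`. -/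
def deformationOf (hE : ∀ i, (E.sheaf i).IsLocallyFree) (m : Z1sc E.cech A) : Deformation E A :=
  deformation hE (reduction_nexp_neg m.2.1) ((isMulCocycle_nexp_neg_iff m.2.1).2 m.2.2)

theorem deformationOf_equiv_iff (hE : ∀ i, (E.sheaf i).IsLocallyFree) {m m' : Z1sc E.cech A} :
    (deformationOf hE m).Equiv (deformationOf hE m') ↔ relSc E.cech A m m' := by
  rw [relSc_iff]
  exact deformation_equiv_iff hE _ _ _ _

theorem exists_equiv_deformationOf (hE : ∀ i, (E.sheaf i).IsLocallyFree)
    (hU : ∀ i, ∀ G : ModSheaf S k (U i), G.IsLocallyFree → G.H1Vanishes) (D : Deformation E A) :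
    ∃ m : Z1sc E.cech A, (deformationOf hE m).Equiv D := by
  obtain ⟨y, hy, hc, h⟩ := exists_equiv_deformation hE hU D
  obtain ⟨m, hm, rfl⟩ := exists_nexp_eq hy
  obtain ⟨m, rfl⟩ : ∃ m', m = -m' := ⟨-m, (neg_neg m).symm⟩
  replace hm : m ∈ nilp _ A := by simpa using Submodule.neg_mem _ hm
  exact ⟨⟨m, hm, (isMulCocycle_nexp_neg_iff hm).1 hc⟩, h⟩

theorem deformationOf_isPullbackOf (hE : ∀ i, (E.sheaf i).IsLocallyFree) (f : A ⟶ B)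
    (m : Z1sc E.cech A) :
    (deformationOf hE m).IsPullbackOf f (deformationOf hE (Z1map E.cech f m)) := by
  have h : nexp k (-(Z1map E.cech f m).1) = scMap E.cech f 1 (nexp k (-m.1)) := by
    rw [map_nexp _ (isNilpotent_of_mem m.2.1).neg, map_neg]
    rfl
  -- The proofs inside the deformation depend on `y`, so `h` cannot be rewritten directly; `y` is
  -- first made a variable.
  have key : ∀ (y : E.cech.obj (SemiSimplexCategory.mk 1) ⊗[k] B.carrier) (hy : reduction _ B y = 1)
      (hc : IsMulCocycle y), y = scMap E.cech f 1 (nexp k (-m.1)) →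
      (deformationOf hE m).IsPullbackOf f (deformation hE hy hc) := by
    rintro _ hy hc rfl
    exact deformation_isPullbackOf f hE _ _ hy hc
  exact key _ _ _ h

/-- The comparison map from `H¹_sc(exp g)` to the isomorphism classes of deformations. -/
def comparison (hE : ∀ i, (E.sheaf i).IsLocallyFree) (A : ArtAlg k) :
    Quot (relSc E.cech A) → Quotient (Deformation.setoid E A) :=
  Quot.lift (fun m => Quotient.mk (Deformation.setoid E A) (deformationOf hE m))
    fun _ _ h => Quotient.sound (s := Deformation.setoid E A) ((deformationOf_equiv_iff hE).2 h)

theorem comparison_bijective (hE : ∀ i, (E.sheaf i).IsLocallyFree)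
    (hU : ∀ i, ∀ G : ModSheaf S k (U i), G.IsLocallyFree → G.H1Vanishes) (A : ArtAlg k) :
    Function.Bijective (comparison hE A) := by
  constructor
  · intro x y h
    induction x using Quot.inductionOn with | h m => ?_
    induction y using Quot.inductionOn with | h m' => ?_
    exact Quot.sound ((deformationOf_equiv_iff hE).1
      (Quotient.exact (s := Deformation.setoid E A) h))
  · intro D
    induction D using Quotient.inductionOn with | h D => ?_
    obtain ⟨m, hm⟩ := exists_equiv_deformationOf hE hU D
    exact ⟨Quot.mk _ m, Quotient.sound (s := Deformation.setoid E A) hm⟩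

/-- If all the `E_i` are locally free and locally free sheaves on the `U_i` have no `H¹`, then the
deformation functor of `E` is isomorphic to `H¹_sc(exp g)`. -/
theorem nonempty_defFunctor_iso (hE : ∀ i, (E.sheaf i).IsLocallyFree)
    (hU : ∀ i, ∀ G : ModSheaf S k (U i), G.IsLocallyFree → G.H1Vanishes) :
    Nonempty (E.defFunctor ≅ H1sc E.cech ⋙ uliftFunctor.{u + 1}) := by
  -- Deformations contain types of universe `u`, so their classes live one universe higher than
  -- `H¹_sc`, which has to be lifted.
  refine ⟨(NatIso.ofComponents (F := H1sc E.cech ⋙ uliftFunctor.{u + 1}) (G := E.defFunctor)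
    (fun A => (_root_.Equiv.ulift.trans
      (_root_.Equiv.ofBijective _ (comparison_bijective hE hU A))).toIso) ?_).symm⟩
  intro A B f
  ext x
  obtain ⟨x⟩ := x
  induction x using Quot.inductionOn with | h m => ?_
  -- Naturality: both deformations over `B` are pullbacks of the same one along `f`, hence
  -- isomorphic.
  exact Quotient.sound (s := Deformation.setoid E B) (Deformation.equiv_of_isPullbackOf
    (deformationOf_isPullbackOf hE f m) ((deformationOf hE m).pullback_isPullbackOf f))

end TwistedSheaf

end

end TwistedDef


/-- Locally free twisted sheaves: the deformation functor is isomorphic to the functor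
`H¹_sc(exp g^Δ)` of the Čech semicosimplicial Lie algebra of `End(E)`, for an affine open cover
of a locally Noetherian scheme over a field of characteristic zero, and for a Stein open cover of
a complex manifold. -/
theorem theorem3p5 :
    (∀ (k : Type u) [Field k] [CharZero k] (X : Scheme.{u}) [IsLocallyNoetherian X]
      (p : X ⟶ Spec (CommRingCat.of k)) (I : Type u) (U : I → X.Opens)
      (_ : ⨆ i, U i = ⊤) (_ : ∀ i, IsAffineOpen (U i))
      (α : TwistedDef.Cocycle2 (TwistedDef.KSpace.ofScheme X p) U)
      (E : TwistedDef.TwistedSheaf (TwistedDef.KSpace.ofScheme X p) U α)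
      (_ : ∀ i, (E.sheaf i).IsLocallyFree),
      Nonempty (E.defFunctor ≅ TwistedDef.H1sc E.cech ⋙ uliftFunctor.{u + 1})) ∧
    (∀ (V M : Type) [NormedAddCommGroup V] [NormedSpace ℂ V] [FiniteDimensional ℂ V]
      [TopologicalSpace M] [T2Space M] [SecondCountableTopology M] [ChartedSpace V M]
      [IsManifold 𝓘(ℂ, V) ∞ M] (I : Type) (U : I → Opens M)
      (_ : ⨆ i, U i = ⊤) (_ : ∀ i, (TwistedDef.KSpace.ofManifold V M).IsStein (U i))
      (α : TwistedDef.Cocycle2 (TwistedDef.KSpace.ofManifold V M) U)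
      (E : TwistedDef.TwistedSheaf (TwistedDef.KSpace.ofManifold V M) U α)
      (_ : ∀ i, (E.sheaf i).IsLocallyFree),
      Nonempty (E.defFunctor ≅ TwistedDef.H1sc E.cech ⋙ uliftFunctor.{1})) := by
  refine ⟨?_, ?_⟩
  · intro k _ _ X _ p I U _ hU α E hE
    exact TwistedDef.TwistedSheaf.nonempty_defFunctor_iso hE fun i _ hG =>
      TwistedDef.ModSheaf.H1Vanishes_of_isAffineOpen (hU i) hG
  · intro V M _ _ _ _ _ _ _ _ I U _ hU α E hE
    -- The Stein condition concerns coherent sheaves, and locally free sheaves are coherent.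
    exact TwistedDef.TwistedSheaf.nonempty_defFunctor_iso hE fun i G hG =>
      hU i G hG.isCoherent
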